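/- Let $m=2k+1$ with $k\in\mathbb N=\{0,1,2,\dots\}$ and let $n\ge 0$ be an integer. Consider the piecewise polynomial system $$(\dot x,\dot y)=\begin{cases}(y+\epsilon p^+(x,y),\,-x+\epsilon q^+(x,y)), & y\ge x^m,\\ (y+\epsilon p^-(x,y),\,-x+\epsilon q^-(x,y)), & y<x^m,\end{cases}\qquad(1.1)_\epsilon$$ where $p^\pm,q^\pm$ are real polynomials of degree at most $n$. Its first order Melnikov function is $$M(h)=\int_{L_h^+}q^+dx-p^+dy+\int_{L_h^-}q^-dx-p^-dy,\qquad h>0,$$ where $L_h^+$ and $L_h^-$ are the parts of the clockwise oriented circle $x^2+y^2=h$ in $y\ge x^m$ and $y<x^m$. A limit cycle is an isolated periodic orbit; its multiplicity is the order of vanishing of the displacement function of the Poincaré return map on the branch $\{(x,x^m):x>0\}$ of the switching curve. The number of limit cycles that bifurcate from the period annulus is at most $N$ if for all $0<a<b$ and all sufficiently small $\epsilon\ne0$ the system $(1.1)_\epsilon$ has at most $N$ limit cycles, counted with multiplicity, in $a<x^2+y^2<b$; the smallest such $N$ is that number. Let $Z(m,n)$ be the maximum of this number over all $(p^\pm,q^\pm)$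 for which $M$ is not identically zero, and let $Z_M(m,n)$ be the maximal number of zeros of $M$ in $(0,\infty)$, counted with multiplicity, over the same perturbations. Let $[\cdot]$ denote the integer part (floor), and let $\delta_n=0$ if $n$ is odd and $\delta_n=-1$ if $n$ is even. Then $Z(m,n)$ and $Z_M(m,n)$ are finite, and the following holds for $Z=Z(m,n)$ and also for $Z=Z_M(m,n)$. (i) If $n<m-1$, then $$\left[\tfrac n2\right]\left[\tfrac{n+6}2\right]+\left[\tfrac{n-1}2\right]+2\;\le\; Z\;\le\;\tfrac12\left[\tfrac{n+3}2\right]\left[\tfrac{n+5}2\right]+\left[\tfrac{n+2}2\right]\left[\tfrac{n+4}2\right]-2 .$$ (ii) If $m-1\le n<2m-1$, then $$Z\le\tfrac12\left[\tfrac{n+3}2\right]\left[\tfrac{n+5}2\right]+(2k+1)\left[\tfrac n2\right]-(k-1)^2;$$ if $n\ge 2m-1$, then $$Z\le(2k+1)\left(2\left[\tfrac n2\right]+\delta_n\right)+k(5-3k)+1;$$ and in both cases $$Z\ge 2(k+1)\left[\tfrac n2\right]+\delta_n-(k-1)^2+2 .$$ In (i) and in (ii) the lower bound $\ell$ is reached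 by some system: there are $p^\pm,q^\pm$ such that $M\not\equiv0$ has exactly $\ell$ zeros in $(0,\infty)$, counted with multiplicity, and exactly $\ell$ limit cycles bifurcate from the period annulus, i.e. for all sufficiently small $a>0$ and sufficiently large $b$, the system $(1.1)_\epsilon$ has exactly $\ell$ distinct limit cycles in $a<x^2+y^2<b$ for all sufficiently small $\epsilon\neq0$. -/

import Mathlib

open Filter Topology MeasureTheory

noncomputable section

namespace PiecewiseCenter

/-- The perturbation terms `p⁺, q⁺, p⁻, q⁻`: real polynomials in `x = X 0`, `y = X 1` of total
degree at most `n`. -/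
structure Perturbation (n : ℕ) where
  pPlus : MvPolynomial (Fin 2) ℝ
  qPlus : MvPolynomial (Fin 2) ℝ
  pMinus : MvPolynomial (Fin 2) ℝ
  qMinus : MvPolynomial (Fin 2) ℝ
  pPlus_deg : pPlus.totalDegree ≤ n
  qPlus_deg : qPlus.totalDegree ≤ n
  pMinus_deg : pMinus.totalDegree ≤ n
  qMinus_deg : qMinus.totalDegree ≤ n

/-- The value of a polynomial in two variables at a point of the plane. -/
def ev (p : MvPolynomial (Fin 2) ℝ) (z : ℝ × ℝ) : ℝ := MvPolynomial.eval ![z.1, z.2] p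

/-! ### The piecewise smooth system and its limit cycles -/

/-- The vector field of the system: the perturbed linear center
`x' = y + ε p, y' = -x + ε q`, with `p⁺, q⁺` where `y ≥ x ^ m` and `p⁻, q⁻` where `y < x ^ m`. -/
def field (m : ℕ) {n : ℕ} (P : Perturbation n) (ε : ℝ) (z : ℝ × ℝ) : ℝ × ℝ :=
  open Classical in
  if z.1 ^ m ≤ z.2 then (z.2 + ε * ev P.pPlus z, -z.1 + ε * ev P.qPlus z)
  else (z.2 + ε * ev P.pMinus z, -z.1 + ε * ev P.qMinus z)

/-- `γ` is a solution of the system on the interval `I`: it is continuous there and satisfies the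
differential equation at all interior times outside a countable set (the times at which it crosses
the switching curve). -/
def IsSolutionOn (m : ℕ) {n : ℕ} (P : Perturbation n) (ε : ℝ) (γ : ℝ → ℝ × ℝ) (I : Set ℝ) : Prop :=
  ContinuousOn γ I ∧
    ∃ S : Set ℝ, S.Countable ∧ ∀ t ∈ interior I \ S, HasDerivAt γ (field m P ε (γ t)) t

/-- `Γ` is a periodic orbit: the image of a periodic solution that is injective on a period. -/
def IsPeriodicOrbit (m : ℕ) {n : ℕ} (P : Perturbation n) (ε : ℝ) (Γ : Set (ℝ × ℝ)) : Prop :=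
  ∃ (γ : ℝ → ℝ × ℝ) (T : ℝ), 0 < T ∧ IsSolutionOn m P ε γ Set.univ ∧ Function.Periodic γ T ∧
    Set.InjOn γ (Set.Ico 0 T) ∧ Γ = Set.range γ

/-- A limit cycle is an isolated periodic orbit: some neighbourhood of it contains no other
periodic orbit. -/
def IsLimitCycle (m : ℕ) {n : ℕ} (P : Perturbation n) (ε : ℝ) (Γ : Set (ℝ × ℝ)) : Prop :=
  IsPeriodicOrbit m P ε Γ ∧
    ∃ U : Set (ℝ × ℝ), IsOpen U ∧ Γ ⊆ U ∧ ∀ Γ', IsPeriodicOrbit m P ε Γ' → Γ' ⊆ U → Γ' = Γ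

/-- The order of vanishing of `f` at `x`: the least order of a derivative that does not vanish. -/
def vanishingOrder (f : ℝ → ℝ) (x : ℝ) : ℕ∞ :=
  ⨅ (k : ℕ) (_ : iteratedDeriv k f x ≠ 0), (k : ℕ∞)

/-- The elements of `A` counted with the multiplicities `μ`. -/
def countWithMult {α : Type*} (A : Set α) (μ : α → ℕ∞) : ℕ∞ :=
  ⨆ (s : Finset α) (_ : (s : Set α) ⊆ A), ∑ a ∈ s, μ a

/-- A solution that starts at the point `(x, x ^ m)` of the branch `x > 0` of the switching curve
meets that branch again for the first time at `(x', x' ^ m)`. -/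
def IsFirstReturn (m : ℕ) {n : ℕ} (P : Perturbation n) (ε : ℝ) (x x' : ℝ) : Prop :=
  0 < x ∧ 0 < x' ∧ ∃ (γ : ℝ → ℝ × ℝ) (T : ℝ), 0 < T ∧ IsSolutionOn m P ε γ (Set.Icc 0 T) ∧
    γ 0 = (x, x ^ m) ∧ γ T = (x', x' ^ m) ∧
    ∀ t ∈ Set.Ioo 0 T, ¬ (0 < (γ t).1 ∧ (γ t).2 = (γ t).1 ^ m)

/-- The Poincaré return map on the branch `x > 0` of the switching curve (with parameter `x`). -/
def returnMap (m : ℕ) {n : ℕ} (P : Perturbation n) (ε : ℝ) (x : ℝ) : ℝ :=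
  Classical.epsilon fun x' => IsFirstReturn m P ε x x'

/-- The multiplicity of a limit cycle: the order of vanishing of the displacement function
`x ↦ returnMap x - x` at the point where the cycle meets the branch `x > 0`. -/
def cycleMultiplicity (m : ℕ) {n : ℕ} (P : Perturbation n) (ε : ℝ) (Γ : Set (ℝ × ℝ)) : ℕ∞ :=
  ⨆ (x : ℝ) (_ : 0 < x ∧ (x, x ^ m) ∈ Γ), vanishingOrder (fun s => returnMap m P ε s - s) x

/-- The limit cycles that lie in the part `a < x² + y² < b` of the period annulus. -/
def limitCyclesIn (m : ℕ) {n : ℕ} (P : Perturbation n) (ε a b : ℝ) : Set (Set (ℝ × ℝ)) :=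
  {Γ | IsLimitCycle m P ε Γ ∧ Γ ⊆ {z | a < z.1 ^ 2 + z.2 ^ 2 ∧ z.1 ^ 2 + z.2 ^ 2 < b}}

/-- The number of limit cycles, counted with multiplicity, that bifurcate from the period annulus
for `0 < |ε| ≪ 1`: it is at most `N : ℕ` iff for all `0 < a < b` and all small `ε ≠ 0` there are
at most `N` limit cycles in `a < x² + y² < b`. -/
def bifurcatingCount (m : ℕ) {n : ℕ} (P : Perturbation n) : ℕ∞ :=
  ⨆ (a : ℝ) (b : ℝ) (_ : 0 < a ∧ a < b),
    limsup (fun ε : ℝ => countWithMult (limitCyclesIn m P ε a b) (cycleMultiplicity m P ε)) (𝓝[≠] 0)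

/-- Exactly `N` distinct limit cycles bifurcate from the period annulus for `0 < |ε| ≪ 1`. -/
def ExactlyBifurcating (m : ℕ) {n : ℕ} (P : Perturbation n) (N : ℕ) : Prop :=
  ∃ a₀ b₀ : ℝ, 0 < a₀ ∧ a₀ < b₀ ∧ ∀ a b : ℝ, 0 < a → a ≤ a₀ → b₀ ≤ b →
    ∀ᶠ ε in 𝓝[≠] (0 : ℝ), (limitCyclesIn m P ε a b).encard = N

/-! ### The first order Melnikov function -/

/-- The orbit `x² + y² = h` of the unperturbed center, with its (clockwise) orientation. -/
def circ (h t : ℝ) : ℝ × ℝ := (√h * Real.cos t, -(√h * Real.sin t))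

/-- The integral of `q dx - p dy` over the part of the oriented orbit `x² + y² = h` that lies in the
region `R`; here `dx = y dt` and `dy = -x dt`. -/
def arcIntegral (p q : MvPolynomial (Fin 2) ℝ) (R : Set (ℝ × ℝ)) (h : ℝ) : ℝ :=
  ∫ t in {t | t ∈ Set.Ioc 0 (2 * Real.pi) ∧ circ h t ∈ R},
    (ev q (circ h t) * deriv (fun s => (circ h s).1) t
      - ev p (circ h t) * deriv (fun s => (circ h s).2) t)

/-- The first order Melnikov function
`M(h) = ∫_{L_h⁺} q⁺ dx - p⁺ dy + ∫_{L_h⁻} q⁻ dx - p⁻ dy`. -/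
def melnikov (m : ℕ) {n : ℕ} (P : Perturbation n) (h : ℝ) : ℝ :=
  arcIntegral P.pPlus P.qPlus {z | z.1 ^ m ≤ z.2} h
    + arcIntegral P.pMinus P.qMinus {z | z.2 < z.1 ^ m} h

/-- The Melnikov function does not vanish identically on the period annulus. -/
def MelnikovNontrivial (m : ℕ) {n : ℕ} (P : Perturbation n) : Prop :=
  ∃ h : ℝ, 0 < h ∧ melnikov m P h ≠ 0

/-- The number of zeros of the Melnikov function on `(0, ∞)`, counted with multiplicity. -/
def melnikovZeroCount (m : ℕ) {n : ℕ} (P : Perturbation n) : ℕ∞ :=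
  countWithMult {h : ℝ | 0 < h ∧ melnikov m P h = 0} (vanishingOrder (melnikov m P))

/-- `Z(m, n)`: the maximal number of limit cycles (counted with multiplicity) that bifurcate from
the period annulus, over all perturbations whose first order Melnikov function is not
identically zero. -/
def Z (m n : ℕ) : ℕ∞ :=
  ⨆ (P : Perturbation n) (_ : MelnikovNontrivial m P), bifurcatingCount m P

/-- The maximal number of zeros (counted with multiplicity) of a first order Melnikov function
that is not identically zero. -/
def melnikovZ (m n : ℕ) : ℕ∞ :=
  ⨆ (P : Perturbation n) (_ : MelnikovNontrivial m P), melnikovZeroCount m P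

/-- Some system reaches the value `N`: its Melnikov function is not identically zero and has exactly
`N` zeros, and exactly `N` limit cycles bifurcate from the period annulus. -/
def IsReached (m n : ℕ) (N : ℤ) : Prop :=
  ∃ (P : Perturbation n) (l : ℕ), (l : ℤ) = N ∧ MelnikovNontrivial m P ∧
    melnikovZeroCount m P = l ∧ ExactlyBifurcating m P l

/-- `δ_n = 0` for odd `n` and `δ_n = -1` for even `n`. -/
def delta (n : ℕ) : ℤ := if Odd n then 0 else -1

end PiecewiseCenter

end

namespace PiecewiseCenter

/-! ### Orders of vanishing and zero counts -/

/-! Straightening. The clockwise rotation of `(s, s ^ m)` through the angle `t` is `flow m s t`. As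
`m` is odd, the circle through `(s, s ^ m)` meets the switching curve only there and at the
antipode, so in the coordinates `(s, t)` the curve becomes `sin t = 0` (`flow_above_iff`). The
system turns into `ds/dt = slopeField`, an equation of size `ε` that is rational in `s` and jumps
only at times independent of `s`.

Return map. Picard iteration over a complex neighbourhood of `[c, d]` gives solutions holomorphic in
the initial value. The displacement divided by `ε` converges uniformly there to the integral of
`radial` over one turn, divided by `jac`; hence all its derivatives converge on `[c, d]`
(`exists_returnFamily`). Arbitrary solutions of the discontinuous system are shown to follow this
family, which therefore describes the return map, the periodic orbits and their multiplicities
(`IsReturnFamily.returnMap_eq`, `IsReturnFamily.eq_cycleOf_of_isPeriodicOrbit`).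

Reduction to polynomials. The limiting integral is the Melnikov function at `h = s ^ 2 + s ^ (2 *
m)`, and it is a polynomial `Q` in `s`. Rolle's theorem bounds the zeros of nearby functions by
those of `Q`, with multiplicity (`eventually_sum_vanishingOrder_le`), and simple zeros persist. So
both `Z` and `melnikovZ` are controlled by the positive roots of nonzero elements of `melnikovSpace
m n`, each of which comes from some perturbation.

Counting roots. Moments of even total degree over a half turn are multiples of powers of `h`. Those
of odd total degree reduce, through `x ^ 2 + y ^ 2 = h`, to `s ^ (2 * r + 1) * h ^ e` and `s ^ (m *
(2 * r + 1)) * h ^ e`. These two families span all monomials with exponent in `oddExponents`,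
whereas even exponents enter only through the powers `h ^ l`. The upper bounds are Descartes' rule,
applied to the set of all exponents that can occur.

For the lower bounds one starts from a polynomial with exponents in `oddExponents` and `2 * m * l`
that has the maximal number of positive roots, all simple. Replacing `s ^ (2 * m * l)` by `s ^ (2 *
l) * (s ^ (2 * m - 2) + ν ^ (2 * m - 2)) ^ l` keeps the number of roots for small `ν`
(`eventually_deform`), and the substitution `s = ν * x` turns this term into a multiple of `h ^ l`.
The remaining work is the count of exponents. -/

theorem vanishingOrder_le {f : ℝ → ℝ} {x : ℝ} {k : ℕ} (h : iteratedDeriv k f x ≠ 0) :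
    vanishingOrder f x ≤ k :=
  iInf₂_le k h

theorem le_vanishingOrder {f : ℝ → ℝ} {x : ℝ} {k : ℕ} (h : ∀ i < k, iteratedDeriv i f x = 0) :
    (k : ℕ∞) ≤ vanishingOrder f x := by
  refine le_iInf₂ fun j hj => ?_
  have : ¬ j < k := fun hlt => hj (h j hlt)
  exact_mod_cast not_lt.1 this

theorem vanishingOrder_eq_zero {f : ℝ → ℝ} {x : ℝ} (h : f x ≠ 0) : vanishingOrder f x = 0 := by
  have := vanishingOrder_le (f := f) (x := x) (k := 0) (by simpa using h)
  simpa using this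

theorem one_le_vanishingOrder {f : ℝ → ℝ} {x : ℝ} (h : f x = 0) : 1 ≤ vanishingOrder f x := by
  have := le_vanishingOrder (f := f) (x := x) (k := 1) (by
    intro i hi
    obtain rfl : i = 0 := by omega
    simpa using h)
  simpa using this

/-- For analytic functions the definition through derivatives agrees with the order of the power
series, which behaves well under products and composition. The multiplicities of the Melnikov zeros
are computed this way. -/
theorem vanishingOrder_eq_analyticOrderAt {f : ℝ → ℝ} {x : ℝ} (hf : AnalyticAt ℝ f x) :
    vanishingOrder f x = analyticOrderAt f x := by
  cases h : analyticOrderAt f x with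
  | top =>
    refine top_le_iff.1 (le_iInf₂ fun k hk => ?_)
    exact absurd ((natCast_le_analyticOrderAt_iff_iteratedDeriv_eq_zero hf (n := k + 1)).1
      (by rw [h]; exact le_top) k (Nat.lt_succ_self k)) hk
  | coe n =>
    refine le_antisymm (vanishingOrder_le ?_) (le_vanishingOrder ?_)
    · intro h0
      have h1 := (natCast_le_analyticOrderAt_iff_iteratedDeriv_eq_zero hf (n := n)).1 h.ge
      have h2 := (natCast_le_analyticOrderAt_iff_iteratedDeriv_eq_zero hf (n := n + 1)).2
        (fun i hi => by
          rcases Nat.lt_succ_iff_lt_or_eq.1 hi with hi | rfl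
          · exact h1 i hi
          · exact h0)
      rw [h] at h2
      have : n + 1 ≤ n := by exact_mod_cast h2
      omega
    · exact (natCast_le_analyticOrderAt_iff_iteratedDeriv_eq_zero hf).1 h.ge

/-- The derivatives of `f` of positive order are the derivatives of `deriv f`, and order zero
contributes nothing since `f x = 0`. This is the bookkeeping for the Rolle induction; no smoothness
is needed. -/
theorem vanishingOrder_eq_deriv_add_one {f : ℝ → ℝ} {x : ℝ} (h : f x = 0) :
    vanishingOrder f x = vanishingOrder (deriv f) x + 1 := by
  apply le_antisymm
  · by_cases hd : ∃ k, iteratedDeriv k (deriv f) x ≠ 0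
    · have hne : vanishingOrder (deriv f) x ≠ ⊤ := by
        obtain ⟨k, hk⟩ := hd
        exact ne_top_of_le_ne_top (ENat.natCast_ne_top k) (vanishingOrder_le hk)
      obtain ⟨n, hn⟩ := ENat.ne_top_iff_exists.1 hne
      have hn' : iteratedDeriv n (deriv f) x ≠ 0 := by
        intro h0
        have hall : ∀ i < n + 1, iteratedDeriv i (deriv f) x = 0 := by
          intro i hi
          by_contra hi0
          have := vanishingOrder_le hi0
          rw [← hn] at this
          have h3 : n ≤ i := by exact_mod_cast this
          obtain rfl : i = n := by omega
          exact hi0 h0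
        have := le_vanishingOrder hall
        rw [← hn] at this
        have h3 : n + 1 ≤ n := by exact_mod_cast this
        omega
      rw [← hn]
      exact_mod_cast vanishingOrder_le (k := n + 1) (by rwa [iteratedDeriv_succ'])
    · have : vanishingOrder (deriv f) x = ⊤ := by
        refine top_le_iff.1 (le_iInf₂ fun k hk => absurd ⟨k, hk⟩ hd)
      rw [this]; simp
  · refine le_iInf₂ fun k hk => ?_
    cases k with
    | zero => simp [h] at hk
    | succ k =>
      rw [iteratedDeriv_succ'] at hk
      push_cast
      gcongr
      exact vanishingOrder_le hk

theorem vanishingOrder_const_mul {f : ℝ → ℝ} {x c : ℝ} (hc : c ≠ 0) :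
    vanishingOrder (fun y => c * f y) x = vanishingOrder f x := by
  unfold vanishingOrder
  simp [iteratedDeriv_const_mul_field, hc]

theorem vanishingOrder_congr {f g : ℝ → ℝ} {x : ℝ} (h : f =ᶠ[𝓝 x] g) :
    vanishingOrder f x = vanishingOrder g x := by
  unfold vanishingOrder
  have : ∀ k, iteratedDeriv k f x = iteratedDeriv k g x := fun k =>
    Filter.EventuallyEq.iteratedDeriv_eq k h
  simp [this]

/-- Between consecutive zeros of a continuous function there are zeros of its derivative. -/
theorem exists_finset_zeros_deriv {f : ℝ → ℝ} {I : Set ℝ} (hI : I.OrdConnected)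
    (hf : ContinuousOn f I) (s : Finset ℝ) (hs : (s : Set ℝ) ⊆ I) (h0 : ∀ x ∈ s, f x = 0) :
    ∃ t : Finset ℝ, (t : Set ℝ) ⊆ I ∧ Disjoint s t ∧ (∀ y ∈ t, deriv f y = 0) ∧
      (∀ y ∈ t, ∃ x ∈ s, y < x) ∧ s.card ≤ t.card + 1 := by
  induction s using Finset.induction_on_max with
  | empty => exact ⟨∅, by simp⟩
  | insert a s ha ih =>
    have has : a ∉ s := fun h => lt_irrefl a (ha a h)
    obtain ⟨t, htI, hdis, ht0, htlt, hcard⟩ :=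
      ih (fun x hx => hs (by simp at hx ⊢; exact Or.inr hx)) (fun x hx => h0 x (by simp [hx]))
    rcases s.eq_empty_or_nonempty with rfl | hne
    · exact ⟨∅, by simp⟩
    set b := s.max' hne with hb
    have hbs : b ∈ s := s.max'_mem hne
    have hba : b < a := ha b hbs
    have hsub : Set.Icc b a ⊆ I := hI.out (hs (by simp [hbs])) (hs (by simp))
    -- Rolle between the old maximum `b` and the new one. Every earlier point of `t` lies below some
    -- point of `s`, so `y` is new; this is why the statement carries the clause `y < x`.
    obtain ⟨y, hy, hy0⟩ := exists_deriv_eq_zero hba (hf.mono hsub)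
      ((h0 b (by simp [hbs])).trans (h0 a (by simp)).symm)
    have hyt : y ∉ t := fun h => by
      obtain ⟨x, hx, hyx⟩ := htlt y h
      exact absurd (s.le_max' x hx) (not_le.2 (hy.1.trans hyx))
    have hys : y ∉ s := fun h => absurd (s.le_max' y h) (not_le.2 hy.1)
    have hat : a ∉ t := fun h => by
      obtain ⟨x, hx, hyx⟩ := htlt a h
      exact lt_asymm hyx (ha x hx)
    refine ⟨insert y t, ?_, ?_, ?_, ?_, ?_⟩
    · intro z hz
      simp only [Finset.coe_insert, Set.mem_insert_iff, Finset.mem_coe] at hz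
      rcases hz with rfl | hz
      · exact hsub ⟨hy.1.le, hy.2.le⟩
      · exact htI hz
    · simp only [Finset.disjoint_insert_left, Finset.disjoint_insert_right, Finset.mem_insert,
        not_or]
      exact ⟨⟨hy.2.ne, hys⟩, hat, hdis⟩
    · intro z hz
      rcases Finset.mem_insert.1 hz with rfl | hz
      · exact hy0
      · exact ht0 z hz
    · intro z hz
      rcases Finset.mem_insert.1 hz with rfl | hz
      · exact ⟨a, by simp, hy.2⟩
      · obtain ⟨x, hx, h⟩ := htlt z hz
        exact ⟨x, by simp [hx], h⟩
    · rw [Finset.card_insert_of_notMem has, Finset.card_insert_of_notMem hyt]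
      omega

/-- If the `k`-th derivative does not vanish on an interval, the function has at most `k` zeros
there, counted with multiplicity. -/
theorem sum_vanishingOrder_le {I : Set ℝ} (hI : I.OrdConnected) (k : ℕ) (f : ℝ → ℝ)
    (hf : ∀ j < k, ContinuousOn (iteratedDeriv j f) I) (hk : ∀ x ∈ I, iteratedDeriv k f x ≠ 0)
    (s : Finset ℝ) (hs : (s : Set ℝ) ⊆ I) : ∑ x ∈ s, vanishingOrder f x ≤ k := by
  induction k generalizing f s with
  | zero =>
    rw [Finset.sum_eq_zero]
    · simp
    · intro x hx
      exact vanishingOrder_eq_zero (by simpa using hk x (hs hx))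
  | succ k ih =>
    classical
    set s0 := s.filter (fun x => f x = 0) with hs0
    have hs0I : (s0 : Set ℝ) ⊆ I := fun x hx => hs (Finset.mem_filter.1 hx).1
    have hs00 : ∀ x ∈ s0, f x = 0 := fun x hx => (Finset.mem_filter.1 hx).2
    have hsum : ∑ x ∈ s, vanishingOrder f x = ∑ x ∈ s0, vanishingOrder f x := by
      symm
      apply Finset.sum_subset (Finset.filter_subset _ _)
      intro x hx hx'
      apply vanishingOrder_eq_zero
      intro h
      exact hx' (Finset.mem_filter.2 ⟨hx, h⟩)
    obtain ⟨t, htI, hdis, ht0, -, hcard⟩ := exists_finset_zeros_deriv hI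
      (by simpa using hf 0 (Nat.succ_pos k)) s0 hs0I hs00
    -- Each zero loses one order in passing to the derivative, while Rolle supplies new zeros, one
    -- fewer than the number of points of `s0` at worst; the induction gains one order in total.
    have key := ih (deriv f) (fun j hj => by
        have := hf (j + 1) (by omega)
        rwa [iteratedDeriv_succ'] at this)
      (fun x hx => by have := hk x hx; rwa [iteratedDeriv_succ'] at this)
      (s0 ∪ t) (by simpa using ⟨hs0I, htI⟩)
    rw [Finset.sum_union hdis] at key
    have ht : (t.card : ℕ∞) ≤ ∑ x ∈ t, vanishingOrder (deriv f) x := by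
      have := Finset.sum_le_sum (s := t) (f := fun _ => (1 : ℕ∞))
        (g := fun x => vanishingOrder (deriv f) x) fun y hy => one_le_vanishingOrder (ht0 y hy)
      simpa using this
    rw [hsum, Finset.sum_congr rfl fun x hx => vanishingOrder_eq_deriv_add_one (hs00 x hx),
      Finset.sum_add_distrib]
    have h1 : ∑ x ∈ s0, (1 : ℕ∞) ≤ t.card + 1 := by
      simp only [Finset.sum_const, nsmul_eq_mul, mul_one]
      exact_mod_cast hcard
    calc ∑ x ∈ s0, vanishingOrder (deriv f) x + ∑ x ∈ s0, (1 : ℕ∞)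
        ≤ ∑ x ∈ s0, vanishingOrder (deriv f) x + (t.card + 1) := by gcongr
      _ ≤ ∑ x ∈ s0, vanishingOrder (deriv f) x + (∑ x ∈ t, vanishingOrder (deriv f) x + 1) := by
          gcongr
      _ = (∑ x ∈ s0, vanishingOrder (deriv f) x + ∑ x ∈ t, vanishingOrder (deriv f) x) + 1 := by
          rw [add_assoc]
      _ ≤ k + 1 := by gcongr
      _ = ((k + 1 : ℕ) : ℕ∞) := by push_cast; rfl

/-- On a compact set `|g₀|` has a positive minimum, and uniform convergence within that distance
excludes zeros. -/
theorem eventually_forall_ne_zero {ι : Type*} {l : Filter ι} {g : ι → ℝ → ℝ} {g₀ : ℝ → ℝ}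
    {C : Set ℝ} (hC : IsCompact C) (hconv : TendstoUniformlyOn g g₀ l C)
    (h0 : ContinuousOn g₀ C) (hne : ∀ x ∈ C, g₀ x ≠ 0) : ∀ᶠ i in l, ∀ x ∈ C, g i x ≠ 0 := by
  rcases C.eq_empty_or_nonempty with rfl | hCne
  · simp
  obtain ⟨x₀, hx₀, hmin⟩ := hC.exists_isMinOn hCne h0.norm
  have hpos : 0 < ‖g₀ x₀‖ := norm_pos_iff.2 (hne x₀ hx₀)
  filter_upwards [Metric.tendstoUniformlyOn_iff.1 hconv _ hpos] with i hi x hx hz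
  have h1 := hi x hx
  rw [hz, dist_zero_right] at h1
  exact absurd (hmin hx) (not_le.2 h1)

/-- Upper semicontinuity of the number of zeros, counted with multiplicity, on a compact interval
under convergence of all derivatives. -/
theorem eventually_sum_vanishingOrder_le {ι : Type*} {l : Filter ι} {g : ι → ℝ → ℝ} {g₀ : ℝ → ℝ}
    {c d : ℝ}
    (hconv : ∀ k, TendstoUniformlyOn (fun i => iteratedDeriv k (g i)) (iteratedDeriv k g₀) l
      (Set.Icc c d))
    (hcont : ∀ᶠ i in l, ∀ k, ContinuousOn (iteratedDeriv k (g i)) (Set.Icc c d))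
    (h0 : ∀ k, ContinuousOn (iteratedDeriv k g₀) (Set.Icc c d))
    (S : Finset ℝ) (hS : ∀ x ∈ Set.Icc c d, g₀ x = 0 → x ∈ S) (hSI : (S : Set ℝ) ⊆ Set.Icc c d)
    (μ : ℝ → ℕ) (hμ : ∀ z ∈ S, iteratedDeriv (μ z) g₀ z ≠ 0) :
    ∀ᶠ i in l, ∀ s : Finset ℝ, (s : Set ℝ) ⊆ Set.Icc c d →
      ∑ x ∈ s, vanishingOrder (g i) x ≤ ((∑ z ∈ S, μ z : ℕ) : ℕ∞) := by
  classical
  -- Near a zero `z` of the limit some derivative does not vanish. This passes to nearby functions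
  -- and caps their zeros there by `sum_vanishingOrder_le`; off these balls nearby functions have no
  -- zeros at all.
  have hloc : ∀ z ∈ S, ∃ r > 0, ∀ x ∈ Set.Icc c d ∩ Metric.closedBall z r,
      iteratedDeriv (μ z) g₀ x ≠ 0 := by
    intro z hz
    have h1 := (h0 (μ z) z (hSI hz)).eventually_ne (hμ z hz)
    rw [eventually_nhdsWithin_iff] at h1
    obtain ⟨r, hr, h2⟩ := Metric.nhds_basis_closedBall.eventually_iff.1 h1
    exact ⟨r, hr, fun x hx => h2 hx.2 hx.1⟩
  choose! r hr hne using hloc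
  have hE1 : ∀ᶠ i in l, ∀ z ∈ S, ∀ x ∈ Set.Icc c d ∩ Metric.closedBall z (r z),
      iteratedDeriv (μ z) (g i) x ≠ 0 := by
    rw [Filter.eventually_all_finset]
    intro z hz
    exact eventually_forall_ne_zero (isCompact_Icc.inter_right Metric.isClosed_closedBall)
      ((hconv (μ z)).mono Set.inter_subset_left) ((h0 (μ z)).mono Set.inter_subset_left) (hne z hz)
  have hC : IsCompact (Set.Icc c d \ ⋃ z ∈ S, Metric.ball z (r z)) :=
    isCompact_Icc.diff (isOpen_biUnion fun _ _ => Metric.isOpen_ball)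
  have hE2 : ∀ᶠ i in l, ∀ x ∈ Set.Icc c d \ ⋃ z ∈ S, Metric.ball z (r z), g i x ≠ 0 := by
    refine eventually_forall_ne_zero hC (g₀ := g₀) ?_ ?_ ?_
    · have := hconv 0
      simp only [iteratedDeriv_zero] at this
      exact this.mono Set.sdiff_subset
    · have := h0 0
      simp only [iteratedDeriv_zero] at this
      exact this.mono Set.sdiff_subset
    · intro x hx hx0
      exact hx.2 (Set.mem_biUnion (hS x hx.1 hx0) (Metric.mem_ball_self (hr x (hS x hx.1 hx0))))
  filter_upwards [hE1, hE2, hcont] with i h1 h2 h3 s hs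
  -- The balls may overlap, so a point may be counted several times; only an inequality is needed.
  have hcover : ∑ x ∈ s, vanishingOrder (g i) x ≤
      ∑ z ∈ S, ∑ x ∈ s.filter (fun x => x ∈ Metric.closedBall z (r z)), vanishingOrder (g i) x := by
    simp_rw [Finset.sum_filter]
    rw [Finset.sum_comm]
    refine Finset.sum_le_sum fun x hx => ?_
    by_cases hU : x ∈ ⋃ z ∈ S, Metric.ball z (r z)
    · simp only [Set.mem_iUnion] at hU
      obtain ⟨z, hz, hzx⟩ := hU
      have := Finset.single_le_sum (s := S)
        (f := fun z => if x ∈ Metric.closedBall z (r z) then vanishingOrder (g i) x else 0)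
        (fun _ _ => zero_le) hz
      simpa only [if_pos (Metric.ball_subset_closedBall hzx)] using this
    · rw [vanishingOrder_eq_zero (h2 x ⟨hs hx, hU⟩)]
      exact zero_le
  refine hcover.trans ?_
  push_cast
  refine Finset.sum_le_sum fun z hz => ?_
  refine sum_vanishingOrder_le (I := Set.Icc c d ∩ Metric.closedBall z (r z)) ?_ (μ z) (g i) ?_
    (h1 z hz) _ ?_
  · rw [Real.closedBall_eq_Icc]
    exact Set.ordConnected_Icc.inter Set.ordConnected_Icc
  · exact fun j _ => (h3 j).mono Set.inter_subset_left
  · intro x hx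
    simp only [Finset.coe_filter, Set.mem_ofPred_eq] at hx
    exact ⟨hs hx.1, hx.2⟩

end PiecewiseCenter

namespace PiecewiseCenter

/-! ### Holomorphic dependence of solutions on the initial value -/

theorem intervalIntegrable_of_bounded {E : Type*} [NormedAddCommGroup E] [MeasurableSpace E]
    [BorelSpace E] [SecondCountableTopology E] {f : ℝ → E} {B : ℝ} (hf : Measurable f)
    (hB : ∀ t, ‖f t‖ ≤ B) (a b : ℝ) : IntervalIntegrable f volume a b := by
  refine (intervalIntegrable_const (c := B)).mono_fun hf.aestronglyMeasurable ?_
  filter_upwards with t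
  exact (hB t).trans (le_abs_self B)

/-- Cauchy's estimate on an open disc. -/
theorem norm_deriv_le_of_forall_mem_ball {f : ℂ → ℂ} {z : ℂ} {R C : ℝ} (hR : 0 < R)
    (hf : DifferentiableOn ℂ f (Metric.ball z R)) (hC : ∀ w ∈ Metric.ball z R, ‖f w‖ ≤ C) :
    ‖deriv f z‖ ≤ C / R := by
  have key : ∀ r ∈ Set.Ioo 0 R, ‖deriv f z‖ ≤ C / r := by
    intro r hr
    have hcl : Metric.closedBall z r ⊆ Metric.ball z R := Metric.closedBall_subset_ball hr.2
    refine Complex.norm_deriv_le_of_forall_mem_sphere_norm_le hr.1 ?_ ?_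
    · exact (hf.mono hcl).diffContOnCl_ball le_rfl
    · exact fun w hw => hC w (hcl (Metric.sphere_subset_closedBall hw))
  have ht : Tendsto (fun r : ℝ => C / r) (𝓝[<] R) (𝓝 (C / R)) :=
    (tendsto_const_nhds.div tendsto_id hR.ne').mono_left nhdsWithin_le_nhds
  refine ge_of_tendsto ht ?_
  filter_upwards [Ioo_mem_nhdsLT hR] with r hr using key r hr

/-- Each point of the inner thickening is the centre of a disc of radius `b` in the domain, so
Cauchy's estimate bounds the derivative by `C / b`. The thickening of a convex set is convex, which
allows the mean value inequality. Lipschitz constants thus come from sup bounds alone. -/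
theorem norm_sub_le_of_forall_mem_thickening {f : ℂ → ℂ} {K : Set ℂ} (hK : Convex ℝ K) {a b C : ℝ}
    (hb : 0 < b) (hf : DifferentiableOn ℂ f (Metric.thickening (b + a) K))
    (hC : ∀ w ∈ Metric.thickening (b + a) K, ‖f w‖ ≤ C) {z w : ℂ}
    (hz : z ∈ Metric.thickening a K) (hw : w ∈ Metric.thickening a K) :
    ‖f z - f w‖ ≤ C / b * ‖z - w‖ := by
  have hball : ∀ x ∈ Metric.thickening a K, Metric.ball x b ⊆ Metric.thickening (b + a) K := by
    intro x hx
    exact (Metric.ball_subset_thickening hx b).trans (Metric.thickening_thickening_subset _ _ _)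
  refine (hK.thickening a).norm_image_sub_le_of_norm_deriv_le (𝕜 := ℂ) ?_ ?_ hw hz
  · intro x hx
    exact hf.differentiableAt (Metric.isOpen_thickening.mem_nhds
      (hball x hx (Metric.mem_ball_self hb)))
  · intro x hx
    exact norm_deriv_le_of_forall_mem_ball hb (hf.mono (hball x hx)) fun y hy => hC y (hball x hx hy)

/-- Differentiation under the integral sign; Cauchy's estimate on half-size discs supplies the
dominating constant. -/
theorem differentiableOn_intervalIntegral {f : ℝ → ℂ → ℂ} {U : Set ℂ} (hU : IsOpen U) (a b : ℝ)
    {C : ℝ} (hm : ∀ z ∈ U, Measurable fun τ => f τ z) (hd : ∀ τ, DifferentiableOn ℂ (f τ) U)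
    (hb : ∀ τ, ∀ z ∈ U, ‖f τ z‖ ≤ C) :
    DifferentiableOn ℂ (fun z => ∫ τ in a..b, f τ z) U := by
  intro z₀ hz₀
  obtain ⟨ρ, hρ, hball⟩ := Metric.isOpen_iff.1 hU z₀ hz₀
  have hρ2 : 0 < ρ / 2 := by positivity
  have hder : ∀ τ, ∀ z ∈ Metric.ball z₀ (ρ / 2), ‖deriv (f τ) z‖ ≤ C / (ρ / 2) := by
    intro τ z hz
    have hsub : Metric.ball z (ρ / 2) ⊆ U := by
      refine Set.Subset.trans ?_ hball
      apply Metric.ball_subset_ball'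
      rw [Metric.mem_ball] at hz
      linarith
    exact norm_deriv_le_of_forall_mem_ball hρ2 ((hd τ).mono hsub) fun w hw => hb τ w (hsub hw)
  have hhas : ∀ τ, ∀ z ∈ Metric.ball z₀ (ρ / 2), HasDerivAt (f τ) (deriv (f τ) z) z := by
    intro τ z hz
    have hzU : z ∈ U := hball (Metric.ball_subset_ball (by linarith) hz)
    exact ((hd τ).differentiableAt (hU.mem_nhds hzU)).hasDerivAt
  -- Measurability of the derivative in `τ` is not assumed: it is a pointwise limit of difference
  -- quotients along a sequence inside the disc.
  have hmeas' : Measurable fun τ => deriv (f τ) z₀ := by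
    have hseq : Tendsto (fun n : ℕ => z₀ + ((ρ / 2 / (n + 2) : ℝ) : ℂ)) atTop (𝓝[≠] z₀) := by
      rw [tendsto_nhdsWithin_iff]
      constructor
      · have h1 : Tendsto (fun n : ℕ => (ρ / 2 / ((n : ℝ) + 2))) atTop (𝓝 0) :=
          tendsto_const_nhds.div_atTop
            (tendsto_atTop_add_const_right _ _ tendsto_natCast_atTop_atTop)
        have h2 := (Complex.continuous_ofReal.tendsto 0).comp h1
        simpa using tendsto_const_nhds (x := z₀).add h2
      · filter_upwards with n
        have : (ρ / 2 / ((n : ℝ) + 2)) ≠ 0 := by positivity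
        simpa using (by exact_mod_cast this : ((ρ / 2 / ((n : ℝ) + 2) : ℝ) : ℂ) ≠ 0)
    refine measurable_of_tendsto_metrizable
      (f := fun (n : ℕ) τ => slope (f τ) z₀ (z₀ + ((ρ / 2 / (n + 2) : ℝ) : ℂ))) ?_ ?_
    · intro n
      have hmem : z₀ + ((ρ / 2 / (n + 2) : ℝ) : ℂ) ∈ U := by
        apply hball
        rw [Metric.mem_ball, dist_self_add_left, Complex.norm_real, Real.norm_of_nonneg (by positivity)]
        rw [div_lt_iff₀ (by positivity)]
        nlinarith [(Nat.cast_nonneg n : (0 : ℝ) ≤ n)]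
      simp only [slope_def_field]
      exact ((hm _ hmem).sub (hm _ hz₀)).div_const _
    · rw [tendsto_pi_nhds]
      intro τ
      exact (hasDerivAt_iff_tendsto_slope.1 (hhas τ z₀ (Metric.mem_ball_self hρ2))).comp hseq
  have hint : IntervalIntegrable (fun τ => f τ z₀) volume a b :=
    intervalIntegrable_of_bounded (hm z₀ hz₀) (fun τ => hb τ z₀ hz₀) a b
  have := intervalIntegral.hasDerivAt_integral_of_dominated_loc_of_deriv_le (𝕜 := ℂ) (μ := volume)
    (a := a) (b := b) (F := fun z τ => f τ z) (F' := fun z τ => deriv (f τ) z) (x₀ := z₀)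
    (s := Metric.ball z₀ (ρ / 2)) (bound := fun _ => C / (ρ / 2))
    (Metric.ball_mem_nhds z₀ hρ2) ?_ hint hmeas'.aestronglyMeasurable ?_ ?_ ?_
  · exact this.2.differentiableAt.differentiableWithinAt
  · filter_upwards [hU.mem_nhds hz₀] with z hz using (hm z hz).aestronglyMeasurable
  · filter_upwards with τ _ z hz using hder τ z hz
  · exact intervalIntegrable_const
  · filter_upwards with τ _ z hz using hhas τ z hz

/-- Truncation of the time to the interval `[0, T]`. -/
noncomputable def clampTime (T t : ℝ) : ℝ := max 0 (min t T)

theorem continuous_clampTime (T : ℝ) : Continuous (clampTime T) := by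
  unfold clampTime; fun_prop

theorem abs_clampTime_le {T : ℝ} (hT : 0 ≤ T) (t : ℝ) : |clampTime T t| ≤ T := by
  unfold clampTime
  rw [abs_of_nonneg (le_max_left _ _)]
  exact max_le hT (min_le_right _ _)

theorem clampTime_eq {T t : ℝ} (h : t ∈ Set.Icc 0 T) : clampTime T t = t := by
  unfold clampTime
  rw [min_eq_left h.2, max_eq_right h.1]

/-- The Picard iterates for `z' = G(t, z)` on `[0, T]`, as functions of the initial value. -/
noncomputable def picardIterate (G : ℝ → ℂ → ℂ) (T : ℝ) : ℕ → ℝ → ℂ → ℂ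
  | 0, _, z => z
  | k + 1, t, z => z + ∫ τ in 0..clampTime T t, G τ (picardIterate G T k τ z)

section Picard

variable {G : ℝ → ℂ → ℂ} {T B Λ : ℝ} {U V : Set ℂ}

theorem continuous_add_integral_clampTime (hG : Measurable (Function.uncurry G))
    (hB : ∀ t z, ‖G t z‖ ≤ B) {v : ℝ → ℂ} (hv : Continuous v) (z : ℂ) :
    Continuous fun t => z + ∫ τ in 0..clampTime T t, G τ (v τ) := by
  have hm : Measurable fun τ => G τ (v τ) := hG.comp (measurable_id.prodMk hv.measurable)
  exact continuous_const.add ((intervalIntegral.continuous_primitive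
    (intervalIntegrable_of_bounded hm fun τ => hB τ _) 0).comp (continuous_clampTime T))

theorem continuous_picardIterate (hG : Measurable (Function.uncurry G))
    (hB : ∀ t z, ‖G t z‖ ≤ B) (k : ℕ) (z : ℂ) : Continuous fun t => picardIterate G T k t z := by
  induction k with
  | zero => exact continuous_const
  | succ k ih => exact continuous_add_integral_clampTime hG hB ih z

theorem norm_integral_clampTime_le (hT : 0 ≤ T) {f : ℝ → ℂ} {C : ℝ} (hf : ∀ τ, ‖f τ‖ ≤ C) (t : ℝ) :
    ‖∫ τ in 0..clampTime T t, f τ‖ ≤ C * T := by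
  have hC : 0 ≤ C := (norm_nonneg _).trans (hf 0)
  refine (intervalIntegral.norm_integral_le_of_norm_le_const fun τ _ => hf τ).trans ?_
  rw [sub_zero]
  gcongr
  exact abs_clampTime_le hT t

theorem norm_picardIterate_sub_le (hT : 0 ≤ T) (hB : ∀ t z, ‖G t z‖ ≤ B) (k : ℕ) (t : ℝ) (z : ℂ) :
    ‖picardIterate G T k t z - z‖ ≤ B * T := by
  have hB0 : 0 ≤ B := (norm_nonneg _).trans (hB 0 0)
  cases k with
  | zero => simpa [picardIterate] using mul_nonneg hB0 hT
  | succ k =>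
    simp only [picardIterate, add_sub_cancel_left]
    exact norm_integral_clampTime_le hT (fun τ => hB τ _) t

theorem norm_integral_sub_integral_le (hT : 0 ≤ T) (hG : Measurable (Function.uncurry G))
    (hB : ∀ t z, ‖G t z‖ ≤ B)
    (hΛ : ∀ t, ∀ z ∈ V, ∀ w ∈ V, ‖G t z - G t w‖ ≤ Λ * ‖z - w‖) (hΛ0 : 0 ≤ Λ)
    {v w : ℝ → ℂ} (hv : Continuous v) (hw : Continuous w) (hvV : ∀ t, v t ∈ V) (hwV : ∀ t, w t ∈ V)
    {C : ℝ} (hC : ∀ t, ‖v t - w t‖ ≤ C) (t : ℝ) :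
    ‖(∫ τ in 0..clampTime T t, G τ (v τ)) - ∫ τ in 0..clampTime T t, G τ (w τ)‖ ≤ Λ * C * T := by
  have hmv : Measurable fun τ => G τ (v τ) := hG.comp (measurable_id.prodMk hv.measurable)
  have hmw : Measurable fun τ => G τ (w τ) := hG.comp (measurable_id.prodMk hw.measurable)
  rw [← intervalIntegral.integral_sub
    (intervalIntegrable_of_bounded hmv (fun τ => hB τ _) _ _)
    (intervalIntegrable_of_bounded hmw (fun τ => hB τ _) _ _)]
  refine norm_integral_clampTime_le hT (fun τ => ?_) t
  refine (hΛ τ _ (hvV τ) _ (hwV τ)).trans ?_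
  gcongr
  exact hC τ

/-- Existence of solutions of `z' = G(t, z)` on `[0, T]` that depend holomorphically on the initial
value, in integral form. -/
theorem exists_holomorphic_solution (hT : 0 ≤ T) (hG : Measurable (Function.uncurry G))
    (hB : ∀ t z, ‖G t z‖ ≤ B) (hd : ∀ t, DifferentiableOn ℂ (G t) V)
    (hΛ : ∀ t, ∀ z ∈ V, ∀ w ∈ V, ‖G t z - G t w‖ ≤ Λ * ‖z - w‖) (hΛ0 : 0 ≤ Λ) (hΛT : Λ * T ≤ 1 / 2)
    (hU : IsOpen U) (hUV : ∀ z ∈ U, Metric.closedBall z (B * T) ⊆ V) :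
    ∃ u : ℝ → ℂ → ℂ, (∀ z ∈ U, Continuous fun t => u t z) ∧ (∀ z ∈ U, ∀ t, ‖u t z - z‖ ≤ B * T) ∧
      (∀ z ∈ U, ∀ t, u t z = z + ∫ τ in 0..clampTime T t, G τ (u τ z)) ∧
      (∀ t, DifferentiableOn ℂ (u t) U) ∧
      ((∀ t (x : ℝ), (G t x).im = 0) → ∀ x : ℝ, (x : ℂ) ∈ U → ∀ t, (u t x).im = 0) := by
  have hB0 : 0 ≤ B := (norm_nonneg _).trans (hB 0 0)
  have hcont := continuous_picardIterate (T := T) hG hB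
  have hball : ∀ k t z, picardIterate G T k t z ∈ Metric.closedBall z (B * T) := fun k t z => by
    rw [mem_closedBall_iff_norm]; exact norm_picardIterate_sub_le hT hB k t z
  have hV : ∀ k t, ∀ z ∈ U, picardIterate G T k t z ∈ V := fun k t z hz => hUV z hz (hball k t z)
  have hdiff : ∀ k t, DifferentiableOn ℂ (picardIterate G T k t) U := by
    intro k
    induction k with
    | zero => intro t; exact differentiableOn_id
    | succ k ih =>
      intro t
      refine differentiableOn_id.add (differentiableOn_intervalIntegral hU _ _ (C := B) ?_ ?_ ?_)
      · intro z _
        exact hG.comp (measurable_id.prodMk (hcont k z).measurable)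
      · intro τ
        exact (hd τ).comp (ih τ) fun z hz => hV k τ z hz
      · exact fun τ z _ => hB _ _
  -- The integral operator contracts by `Λ * T ≤ 1 / 2`, uniformly for `z ∈ U` and, thanks to the
  -- clamped time, for all real `t`.
  have hstep : ∀ k t, ∀ z ∈ U,
      ‖picardIterate G T (k + 1) t z - picardIterate G T k t z‖ ≤ B * T * (1 / 2) ^ k := by
    intro k
    induction k with
    | zero => intro t z _; simpa [picardIterate] using norm_picardIterate_sub_le hT hB 1 t z
    | succ k ih =>
      intro t z hz
      have := norm_integral_sub_integral_le hT hG hB hΛ hΛ0 (hcont (k + 1) z) (hcont k z)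
        (fun t => hV _ t z hz) (fun t => hV _ t z hz) (fun t => ih t z hz) t
      calc ‖picardIterate G T (k + 1 + 1) t z - picardIterate G T (k + 1) t z‖
          = ‖(∫ τ in 0..clampTime T t, G τ (picardIterate G T (k + 1) τ z)) -
            ∫ τ in 0..clampTime T t, G τ (picardIterate G T k τ z)‖ := by
              conv_lhs => rw [picardIterate]
              rw [picardIterate, add_sub_add_left_eq_sub]
        _ ≤ Λ * (B * T * (1 / 2) ^ k) * T := this
        _ = (Λ * T) * (B * T * (1 / 2) ^ k) := by ring
        _ ≤ (1 / 2) * (B * T * (1 / 2) ^ k) := by gcongr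
        _ = B * T * (1 / 2) ^ (k + 1) := by ring
  set u : ℝ → ℂ → ℂ := fun t z => limUnder atTop fun k => picardIterate G T k t z with hu
  have hdist : ∀ t, ∀ z ∈ U, ∀ k,
      dist (picardIterate G T k t z) (picardIterate G T (k + 1) t z) ≤ B * T * (1 / 2) ^ k := by
    intro t z hz k
    rw [dist_comm, dist_eq_norm]
    exact hstep k t z hz
  have hlim : ∀ t, ∀ z ∈ U, Tendsto (fun k => picardIterate G T k t z) atTop (𝓝 (u t z)) :=
    fun t z hz => (cauchySeq_of_le_geometric _ _ (by norm_num) (hdist t z hz)).tendsto_limUnder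
  have hrate : ∀ t, ∀ z ∈ U, ∀ k,
      ‖picardIterate G T k t z - u t z‖ ≤ B * T * (1 / 2) ^ k / (1 - 1 / 2) := by
    intro t z hz k
    rw [← dist_eq_norm]
    exact dist_le_of_le_geometric_of_tendsto _ _ (by norm_num) (hdist t z hz) (hlim t z hz) k
  have hrate0 : Tendsto (fun k : ℕ => B * T * (1 / 2 : ℝ) ^ k / (1 - 1 / 2)) atTop (𝓝 0) := by
    have := ((tendsto_pow_atTop_nhds_zero_of_lt_one (r := (1 / 2 : ℝ)) (by norm_num)
      (by norm_num)).const_mul (B * T)).div_const (1 - 1 / 2)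
    simpa using this
  have hunit : ∀ z ∈ U, TendstoUniformly (fun k t => picardIterate G T k t z) (fun t => u t z)
      atTop := by
    intro z hz
    rw [Metric.tendstoUniformly_iff]
    intro e he
    filter_upwards [hrate0.eventually (gt_mem_nhds he)] with k hk t
    rw [dist_comm, dist_eq_norm]
    exact (hrate t z hz k).trans_lt hk
  have hucont : ∀ z ∈ U, Continuous fun t => u t z := fun z hz =>
    (hunit z hz).continuous (Frequently.of_forall fun k => hcont k z)
  have huball : ∀ z ∈ U, ∀ t, u t z ∈ Metric.closedBall z (B * T) := fun z hz t =>
    Metric.isClosed_closedBall.mem_of_tendsto (hlim t z hz) (Eventually.of_forall fun k => hball k t z)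
  refine ⟨u, hucont, fun z hz t => ?_, fun z hz t => ?_, fun t => ?_, fun hre x hx t => ?_⟩
  · rw [← mem_closedBall_iff_norm]; exact huball z hz t
  · have h1 : Tendsto (fun k => picardIterate G T (k + 1) t z) atTop
        (𝓝 (z + ∫ τ in 0..clampTime T t, G τ (u τ z))) := by
      rw [tendsto_iff_norm_sub_tendsto_zero]
      refine squeeze_zero (fun _ => norm_nonneg _) (fun k => ?_)
        (g := fun k : ℕ => Λ * (B * T * (1 / 2 : ℝ) ^ k / (1 - 1 / 2)) * T) ?_
      · rw [picardIterate, add_sub_add_left_eq_sub]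
        exact norm_integral_sub_integral_le hT hG hB hΛ hΛ0 (hcont k z) (hucont z hz)
          (fun t => hV _ t z hz) (fun t => hUV z hz (huball z hz t)) (fun t => hrate t z hz k) t
      · simpa using (hrate0.const_mul Λ).mul_const T
    exact tendsto_nhds_unique ((hlim t z hz).comp (tendsto_add_atTop_nat 1)) h1
  -- Holomorphy in the initial value survives the uniform limit.
  · refine TendstoLocallyUniformlyOn.differentiableOn (φ := atTop)
      (F := fun k => picardIterate G T k t) ?_ (Eventually.of_forall fun k => hdiff k t) hU
    apply TendstoUniformlyOn.tendstoLocallyUniformlyOn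
    rw [Metric.tendstoUniformlyOn_iff]
    intro e he
    filter_upwards [hrate0.eventually (gt_mem_nhds he)] with k hk z hz
    rw [dist_comm, dist_eq_norm]
    exact (hrate t z hz k).trans_lt hk
  -- If the right-hand side is real on the real axis, every iterate started at a real point stays
  -- real, and so does the limit.
  · have him : ∀ k t, (picardIterate G T k t x).im = 0 := by
      intro k
      induction k with
      | zero => intro t; simp [picardIterate]
      | succ k ih =>
        intro t
        have hm : Measurable fun τ => G τ (picardIterate G T k τ x) :=
          hG.comp (measurable_id.prodMk (hcont k x).measurable)
        have hii := intervalIntegrable_of_bounded hm (fun τ => hB τ _) 0 (clampTime T t)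
        have h2 : (∫ τ in 0..clampTime T t, G τ (picardIterate G T k τ x)).im = 0 := by
          have h3 := Complex.imCLM.intervalIntegral_comp_comm hii
          simp only [Complex.imCLM_apply] at h3
          rw [← h3]
          have : ∀ τ, (G τ (picardIterate G T k τ x)).im = 0 := by
            intro τ
            have h4 : picardIterate G T k τ x = ((picardIterate G T k τ x).re : ℂ) := by
              apply Complex.ext <;> simp [ih τ]
            rw [h4]
            exact hre τ _
          simp [this]
        simp [picardIterate, h2]
    have h5 := (Complex.continuous_im.tendsto _).comp (hlim t x hx)
    have h6 : (Complex.im ∘ fun k => picardIterate G T k t (x : ℂ)) = fun _ => 0 :=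
      funext fun k => him k t
    rw [h6] at h5
    exact tendsto_nhds_unique tendsto_const_nhds h5 |>.symm

end Picard

end PiecewiseCenter

namespace PiecewiseCenter

/-! ### The system in the coordinates of the unperturbed flow -/

/-- The point reached at time `t` by the unperturbed flow from the point `(s, s ^ m)`. -/
noncomputable def flow (m : ℕ) (s t : ℝ) : ℝ × ℝ :=
  (s * Real.cos t + s ^ m * Real.sin t, -(s * Real.sin t) + s ^ m * Real.cos t)

/-- Half the derivative of `s ^ 2 + s ^ (2 * m)`. -/
def jac (m : ℕ) (s : ℝ) : ℝ := s + m * s ^ (2 * m - 1)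

open Classical in
/-- The first component of the perturbation that is active at the angle `t`. -/
noncomputable def pAt {n : ℕ} (P : Perturbation n) (t : ℝ) : MvPolynomial (Fin 2) ℝ :=
  if 0 < Real.sin t then P.pMinus else P.pPlus

open Classical in
/-- The second component of the perturbation that is active at the angle `t`. -/
noncomputable def qAt {n : ℕ} (P : Perturbation n) (t : ℝ) : MvPolynomial (Fin 2) ℝ :=
  if 0 < Real.sin t then P.qMinus else P.qPlus

/-- The radial component of `(p, q)` in the coordinates `flow m s t`. -/
noncomputable def radial (m : ℕ) (p q : MvPolynomial (Fin 2) ℝ) (t s : ℝ) : ℝ :=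
  (flow m s t).1 * ev p (flow m s t) + (flow m s t).2 * ev q (flow m s t)

/-- The angular component of `(p, q)` in the coordinates `flow m s t`. -/
noncomputable def angular (m : ℕ) (p q : MvPolynomial (Fin 2) ℝ) (t s : ℝ) : ℝ :=
  (-Real.sin t + m * s ^ (m - 1) * Real.cos t) * ev p (flow m s t)
    - (Real.cos t + m * s ^ (m - 1) * Real.sin t) * ev q (flow m s t)

/-- The right-hand side of the equation `ds/dt = slopeField` for the orbits. -/
noncomputable def slopeField (m : ℕ) {n : ℕ} (P : Perturbation n) (ε t s : ℝ) : ℝ :=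
  ε * radial m (pAt P t) (qAt P t) t s / (jac m s + ε * angular m (pAt P t) (qAt P t) t s)

/-! ### Complexification -/

/-- The value of a real polynomial at a complex point. -/
noncomputable def evC (p : MvPolynomial (Fin 2) ℝ) (x y : ℂ) : ℂ :=
  MvPolynomial.eval ![x, y] (MvPolynomial.map Complex.ofRealHom p)

/-- This and the next three definitions extend `flow`, `jac`, `radial` and `angular` to complex `s`,
with the time `t` kept real. The extension serves to control all `s`-derivatives of the displacement
by sup bounds. -/
noncomputable def flowC (m : ℕ) (z : ℂ) (t : ℝ) : ℂ × ℂ :=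
  (z * Real.cos t + z ^ m * Real.sin t, -(z * Real.sin t) + z ^ m * Real.cos t)

def jacC (m : ℕ) (z : ℂ) : ℂ := z + m * z ^ (2 * m - 1)

noncomputable def radialC (m : ℕ) (p q : MvPolynomial (Fin 2) ℝ) (t : ℝ) (z : ℂ) : ℂ :=
  (flowC m z t).1 * evC p (flowC m z t).1 (flowC m z t).2
    + (flowC m z t).2 * evC q (flowC m z t).1 (flowC m z t).2

noncomputable def angularC (m : ℕ) (p q : MvPolynomial (Fin 2) ℝ) (t : ℝ) (z : ℂ) : ℂ :=
  (-Real.sin t + m * z ^ (m - 1) * Real.cos t) * evC p (flowC m z t).1 (flowC m z t).2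
    - (Real.cos t + m * z ^ (m - 1) * Real.sin t) * evC q (flowC m z t).1 (flowC m z t).2

theorem evC_ofReal (p : MvPolynomial (Fin 2) ℝ) (x y : ℝ) :
    evC p x y = ev p (x, y) := by
  unfold evC ev
  have : (![(x : ℂ), (y : ℂ)] : Fin 2 → ℂ) = Complex.ofRealHom ∘ ![x, y] := by
    ext i; fin_cases i <;> rfl
  rw [this]
  exact (MvPolynomial.map_eval Complex.ofRealHom ![x, y] p).symm

theorem flowC_ofReal (m : ℕ) (s t : ℝ) :
    flowC m s t = (((flow m s t).1 : ℂ), ((flow m s t).2 : ℂ)) := by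
  simp [flowC, flow]

theorem jacC_ofReal (m : ℕ) (s : ℝ) : jacC m s = jac m s := by
  simp [jacC, jac]

theorem radialC_ofReal (m : ℕ) (p q : MvPolynomial (Fin 2) ℝ) (t s : ℝ) :
    radialC m p q t s = radial m p q t s := by
  simp only [radialC, radial, flowC_ofReal, evC_ofReal]
  push_cast
  rfl

theorem angularC_ofReal (m : ℕ) (p q : MvPolynomial (Fin 2) ℝ) (t s : ℝ) :
    angularC m p q t s = angular m p q t s := by
  simp only [angularC, angular, flowC_ofReal, evC_ofReal]
  push_cast
  rfl

theorem continuous_evC (p : MvPolynomial (Fin 2) ℝ) : Continuous fun z : ℂ × ℂ => evC p z.1 z.2 := by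
  unfold evC
  refine (MvPolynomial.continuous_eval _).comp (continuous_pi fun i => ?_)
  fin_cases i
  · exact continuous_fst
  · exact continuous_snd

theorem continuous_flowC (m : ℕ) : Continuous fun w : ℝ × ℂ => flowC m w.2 w.1 := by
  unfold flowC; fun_prop

theorem continuous_radialC (m : ℕ) (p q : MvPolynomial (Fin 2) ℝ) :
    Continuous fun w : ℝ × ℂ => radialC m p q w.1 w.2 := by
  have h := continuous_flowC m
  have hp := (continuous_evC p).comp h
  have hq := (continuous_evC q).comp h
  exact ((continuous_fst.comp h).mul hp).add ((continuous_snd.comp h).mul hq)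

theorem continuous_angularC (m : ℕ) (p q : MvPolynomial (Fin 2) ℝ) :
    Continuous fun w : ℝ × ℂ => angularC m p q w.1 w.2 := by
  have h := continuous_flowC m
  have hp := (continuous_evC p).comp h
  have hq := (continuous_evC q).comp h
  exact (Continuous.mul (by fun_prop) hp).sub (Continuous.mul (by fun_prop) hq)

theorem continuous_jacC (m : ℕ) : Continuous (jacC m) := by unfold jacC; fun_prop

theorem differentiable_jacC (m : ℕ) : Differentiable ℂ (jacC m) := by unfold jacC; fun_prop

theorem differentiable_evC_comp (p : MvPolynomial (Fin 2) ℝ) {f g : ℂ → ℂ}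
    (hf : Differentiable ℂ f) (hg : Differentiable ℂ g) :
    Differentiable ℂ fun z => evC p (f z) (g z) := by
  unfold evC
  induction p using MvPolynomial.induction_on with
  | C a => simp
  | add p q hp hq =>
    simp only [map_add]
    exact hp.add hq
  | mul_X p i hp =>
    simp only [map_mul, MvPolynomial.map_X, MvPolynomial.eval_X]
    refine hp.mul ?_
    fin_cases i
    · exact hf
    · exact hg

theorem differentiable_radialC (m : ℕ) (p q : MvPolynomial (Fin 2) ℝ) (t : ℝ) :
    Differentiable ℂ (radialC m p q t) := by
  have h1 : Differentiable ℂ fun z => (flowC m z t).1 := by unfold flowC; fun_prop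
  have h2 : Differentiable ℂ fun z => (flowC m z t).2 := by unfold flowC; fun_prop
  exact (h1.mul (differentiable_evC_comp p h1 h2)).add (h2.mul (differentiable_evC_comp q h1 h2))

theorem differentiable_angularC (m : ℕ) (p q : MvPolynomial (Fin 2) ℝ) (t : ℝ) :
    Differentiable ℂ (angularC m p q t) := by
  have h1 : Differentiable ℂ fun z => (flowC m z t).1 := by unfold flowC; fun_prop
  have h2 : Differentiable ℂ fun z => (flowC m z t).2 := by unfold flowC; fun_prop
  exact (Differentiable.mul (by fun_prop) (differentiable_evC_comp p h1 h2)).sub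
    (Differentiable.mul (by fun_prop) (differentiable_evC_comp q h1 h2))

attribute [irreducible] radialC angularC

/-- A function of `(t, z)` that is `2π`-periodic in `t` and continuous is bounded for `z` in a
compact set. -/
theorem exists_bound_of_periodic {f : ℝ → ℂ → ℂ} (hf : Continuous fun w : ℝ × ℂ => f w.1 w.2)
    (hper : ∀ t z, f (t + 2 * Real.pi) z = f t z) {W : Set ℂ} (hW : IsCompact W) :
    ∃ C : ℝ, ∀ t, ∀ z ∈ W, ‖f t z‖ ≤ C := by
  obtain ⟨C, hC⟩ := (isCompact_Icc (a := (0 : ℝ)) (b := 2 * Real.pi)).prod hW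
    |>.exists_bound_of_continuousOn hf.continuousOn
  refine ⟨C, fun t z hz => ?_⟩
  have hp : Function.Periodic (fun t => f t z) (2 * Real.pi) := fun t => hper t z
  obtain ⟨y, hy, hty⟩ := hp.exists_mem_Ico₀ Real.two_pi_pos t
  have : f t z = f y z := hty
  rw [this]
  exact hC (y, z) ⟨⟨hy.1, hy.2.le⟩, hz⟩

theorem flowC_add_two_pi (m : ℕ) (z : ℂ) (t : ℝ) : flowC m z (t + 2 * Real.pi) = flowC m z t := by
  simp only [flowC, Real.sin_add_two_pi, Real.cos_add_two_pi]

theorem radialC_add_two_pi (m : ℕ) (p q : MvPolynomial (Fin 2) ℝ) (t : ℝ) (z : ℂ) :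
    radialC m p q (t + 2 * Real.pi) z = radialC m p q t z := by
  simp only [radialC, flowC_add_two_pi]

theorem angularC_add_two_pi (m : ℕ) (p q : MvPolynomial (Fin 2) ℝ) (t : ℝ) (z : ℂ) :
    angularC m p q (t + 2 * Real.pi) z = angularC m p q t z := by
  simp only [angularC, flowC_add_two_pi, Real.sin_add_two_pi, Real.cos_add_two_pi]

theorem measurable_ite_sin {f g : ℝ × ℂ → ℂ} (hf : Measurable f) (hg : Measurable g) :
    Measurable fun w : ℝ × ℂ => open Classical in if 0 < Real.sin w.1 then f w else g w := by
  classical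
  refine Measurable.ite ?_ hf hg
  exact measurableSet_lt measurable_const (Real.measurable_sin.comp measurable_fst)

variable {m n : ℕ} (P : Perturbation n)

theorem measurable_radialC_at :
    Measurable fun w : ℝ × ℂ => radialC m (pAt P w.1) (qAt P w.1) w.1 w.2 := by
  classical
  have := measurable_ite_sin (continuous_radialC m P.pMinus P.qMinus).measurable
    (continuous_radialC m P.pPlus P.qPlus).measurable
  convert this using 2 with w
  unfold pAt qAt
  split_ifs <;> rfl

theorem measurable_angularC_at :
    Measurable fun w : ℝ × ℂ => angularC m (pAt P w.1) (qAt P w.1) w.1 w.2 := by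
  classical
  have := measurable_ite_sin (continuous_angularC m P.pMinus P.qMinus).measurable
    (continuous_angularC m P.pPlus P.qPlus).measurable
  convert this using 2 with w
  unfold pAt qAt
  split_ifs <;> rfl

theorem exists_bound_at {f : MvPolynomial (Fin 2) ℝ → MvPolynomial (Fin 2) ℝ → ℝ → ℂ → ℂ}
    (hf : ∀ p q, Continuous fun w : ℝ × ℂ => f p q w.1 w.2)
    (hper : ∀ p q t z, f p q (t + 2 * Real.pi) z = f p q t z) {W : Set ℂ} (hW : IsCompact W) :
    ∃ C > 0, ∀ t, ∀ z ∈ W, ‖f (pAt P t) (qAt P t) t z‖ ≤ C := by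
  obtain ⟨C₁, h₁⟩ := exists_bound_of_periodic (hf P.pMinus P.qMinus) (hper _ _) hW
  obtain ⟨C₂, h₂⟩ := exists_bound_of_periodic (hf P.pPlus P.qPlus) (hper _ _) hW
  refine ⟨max 1 (max C₁ C₂), by positivity, fun t z hz => ?_⟩
  unfold pAt qAt
  split_ifs
  · exact (h₁ t z hz).trans ((le_max_left _ _).trans (le_max_right _ _))
  · exact (h₂ t z hz).trans ((le_max_right _ _).trans (le_max_right _ _))

/-- The complexified right-hand side, divided by `ε`. -/
noncomputable def slopeC (m : ℕ) {n : ℕ} (P : Perturbation n) (ε t : ℝ) (z : ℂ) : ℂ :=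
  radialC m (pAt P t) (qAt P t) t z / (jacC m z + ε * angularC m (pAt P t) (qAt P t) t z)

theorem slopeC_ofReal (ε t s : ℝ) : ε * slopeC m P ε t s = slopeField m P ε t s := by
  simp only [slopeC, slopeField, radialC_ofReal, angularC_ofReal, jacC_ofReal]
  push_cast
  ring

theorem measurable_slopeC (ε : ℝ) : Measurable fun w : ℝ × ℂ => slopeC m P ε w.1 w.2 := by
  refine (measurable_radialC_at P).div (Measurable.add ?_ ((measurable_angularC_at P).const_mul _))
  exact (continuous_jacC m).measurable.comp measurable_snd

attribute [irreducible] slopeC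

/-- The real derivative of the real part along the real axis is the real part of the complex
derivative. This brings holomorphic information back to real functions. -/
theorem iteratedDeriv_re_comp_ofReal {f : ℂ → ℂ} {U : Set ℂ} (hU : IsOpen U)
    (hf : DifferentiableOn ℂ f U) (k : ℕ) :
    DifferentiableOn ℂ (iteratedDeriv k f) U ∧ ∀ x : ℝ, (x : ℂ) ∈ U →
      iteratedDeriv k (fun y : ℝ => (f y).re) x = (iteratedDeriv k f x).re := by
  induction k with
  | zero => simpa using hf
  | succ k ih =>
    refine ⟨by rw [iteratedDeriv_succ]; exact ih.1.deriv hU, fun x hx => ?_⟩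
    rw [iteratedDeriv_succ, iteratedDeriv_succ]
    have hev : ∀ᶠ y : ℝ in 𝓝 x, (y : ℂ) ∈ U :=
      Complex.continuous_ofReal.continuousAt.eventually_mem (hU.mem_nhds hx)
    have h1 : iteratedDeriv k (fun y : ℝ => (f y).re) =ᶠ[𝓝 x]
        fun y => (iteratedDeriv k f y).re := by
      filter_upwards [hev] with y hy using ih.2 y hy
    rw [h1.deriv_eq]
    exact ((ih.1.differentiableAt (hU.mem_nhds hx)).hasDerivAt.real_of_complex).deriv

/-- Weierstrass' theorem, iterated. -/
theorem tendstoLocallyUniformlyOn_iteratedDeriv {ι : Type*} {l : Filter ι} {F : ι → ℂ → ℂ}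
    {f : ℂ → ℂ} {U : Set ℂ} (hU : IsOpen U) (h : TendstoLocallyUniformlyOn F f l U)
    (hF : ∀ᶠ i in l, DifferentiableOn ℂ (F i) U) (k : ℕ) :
    TendstoLocallyUniformlyOn (fun i => iteratedDeriv k (F i)) (iteratedDeriv k f) l U := by
  induction k with
  | zero => simpa using h
  | succ k ih =>
    simp only [iteratedDeriv_succ]
    exact ih.deriv (hF.mono fun i hi => (iteratedDeriv_re_comp_ofReal hU hi k).1) hU

end PiecewiseCenter

/-! ### Bounds for the complexified equation and its family of solutions -/

namespace PiecewiseCenter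

/-- The solutions `v ε t s` of `ds/dt = slopeField` with initial value `s` near `[c, d]`, for
`|ε| < ε₀` and `0 ≤ t ≤ 2π`, together with the first order expansion of the return map. -/
structure IsReturnFamily (m : ℕ) {n : ℕ} (P : Perturbation n) (c d ρ ε₀ C Λ : ℝ)
    (v : ℝ → ℝ → ℝ → ℝ) : Prop where
  c_lt_d : c < d
  ρ_pos : 0 < ρ
  lower_pos : 0 < c - 2 * ρ
  ε₀_pos : 0 < ε₀
  angular_le : ∀ ε, |ε| < ε₀ → ∀ t, ∀ x ∈ Set.Icc (c - 2 * ρ) (d + 2 * ρ),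
    |ε * angular m (pAt P t) (qAt P t) t x| ≤ jac m x / 2
  lipschitz : ∀ ε, |ε| < ε₀ → ∀ t, ∀ x ∈ Set.Icc (c - 2 * ρ) (d + 2 * ρ),
    ∀ y ∈ Set.Icc (c - 2 * ρ) (d + 2 * ρ),
    |slopeField m P ε t x - slopeField m P ε t y| ≤ Λ * |x - y|
  continuous : ∀ ε, |ε| < ε₀ → ∀ s ∈ Set.Icc (c - ρ) (d + ρ), Continuous fun t => v ε t s
  init : ∀ ε, |ε| < ε₀ → ∀ s ∈ Set.Icc (c - ρ) (d + ρ), v ε 0 s = s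
  near : ∀ ε, |ε| < ε₀ → ∀ s ∈ Set.Icc (c - ρ) (d + ρ), ∀ t, |v ε t s - s| ≤ C * |ε|
  near' : ∀ ε, |ε| < ε₀ → C * |ε| ≤ ρ / 2
  deriv : ∀ ε, |ε| < ε₀ → ∀ s ∈ Set.Icc (c - ρ) (d + ρ), ∀ t ∈ Set.Ioo 0 (2 * Real.pi),
    Real.sin t ≠ 0 → HasDerivAt (fun t => v ε t s) (slopeField m P ε t (v ε t s)) t
  strictMono : ∀ ε, |ε| < ε₀ → StrictMonoOn (v ε (2 * Real.pi)) (Set.Icc (c - ρ) (d + ρ))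
  conv : ∀ k, TendstoUniformlyOn
    (fun ε => iteratedDeriv k fun s => ε⁻¹ * (v ε (2 * Real.pi) s - s))
    (iteratedDeriv k fun s =>
      (∫ t in 0..2 * Real.pi, radial m (pAt P t) (qAt P t) t s) / jac m s)
    (𝓝[≠] 0) (Set.Icc c d)
  cont_iteratedDeriv : ∀ ε, |ε| < ε₀ → ∀ k,
    ContinuousOn (iteratedDeriv k fun s => ε⁻¹ * (v ε (2 * Real.pi) s - s)) (Set.Icc c d)
  cont_iteratedDeriv_limit : ∀ k, ContinuousOn (iteratedDeriv k fun s =>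
      (∫ t in 0..2 * Real.pi, radial m (pAt P t) (qAt P t) t s) / jac m s) (Set.Icc c d)

theorem jac_pos (m : ℕ) {s : ℝ} (hs : 0 < s) : 0 < jac m s := by
  unfold jac; positivity

theorem exists_le_norm_of_ne_zero {f : ℂ → ℂ} {W : Set ℂ} (hW : IsCompact W)
    (hf : ContinuousOn f W) (h0 : ∀ z ∈ W, f z ≠ 0) : ∃ j > 0, ∀ z ∈ W, j ≤ ‖f z‖ := by
  rcases W.eq_empty_or_nonempty with rfl | hne
  · exact ⟨1, one_pos, by simp⟩
  obtain ⟨x, hx, hmin⟩ := hW.exists_isMinOn hne hf.norm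
  exact ⟨‖f x‖, norm_pos_iff.2 (h0 x hx), fun z hz => hmin hz⟩

variable {m n : ℕ} (P : Perturbation n)

section Estimates

variable {K : Set ℂ} {r CA CB j : ℝ}

/-- Uniform bounds for the right-hand side on a neighbourhood of `K`. -/
structure SlopeBounds (m : ℕ) {n : ℕ} (P : Perturbation n) (K : Set ℂ) (r CA CB j : ℝ) : Prop where
  convex : Convex ℝ K
  r_pos : 0 < r
  CA_pos : 0 < CA
  CB_pos : 0 < CB
  j_pos : 0 < j
  radial_le : ∀ t, ∀ z ∈ Metric.thickening (4 * r) K, ‖radialC m (pAt P t) (qAt P t) t z‖ ≤ CA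
  angular_le : ∀ t, ∀ z ∈ Metric.thickening (4 * r) K, ‖angularC m (pAt P t) (qAt P t) t z‖ ≤ CB
  le_jac : ∀ z ∈ Metric.thickening (4 * r) K, j ≤ ‖jacC m z‖

namespace SlopeBounds

variable {P} {ε : ℝ}

theorem le_denom (h : SlopeBounds m P K r CA CB j) (hε : |ε| * CB ≤ j / 2) (t : ℝ) {z : ℂ} (hz : z ∈ Metric.thickening (4 * r) K) :
    j / 2 ≤ ‖jacC m z + ε * angularC m (pAt P t) (qAt P t) t z‖ := by
  have h1 := h.le_jac z hz
  have h2 : ‖(ε : ℂ) * angularC m (pAt P t) (qAt P t) t z‖ ≤ j / 2 := by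
    rw [norm_mul, Complex.norm_real, Real.norm_eq_abs]
    exact (mul_le_mul_of_nonneg_left (h.angular_le t z hz) (abs_nonneg _)).trans hε
  have h3 := norm_sub_le (jacC m z + ε * angularC m (pAt P t) (qAt P t) t z)
    (ε * angularC m (pAt P t) (qAt P t) t z)
  rw [add_sub_cancel_right] at h3
  linarith

theorem denom_ne_zero (h : SlopeBounds m P K r CA CB j) (hε : |ε| * CB ≤ j / 2) (t : ℝ) {z : ℂ} (hz : z ∈ Metric.thickening (4 * r) K) :
    jacC m z + ε * angularC m (pAt P t) (qAt P t) t z ≠ 0 := by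
  have := h.le_denom hε t hz
  have := h.j_pos
  rw [← norm_pos_iff]
  linarith

theorem norm_slopeC_le (h : SlopeBounds m P K r CA CB j) (hε : |ε| * CB ≤ j / 2) (t : ℝ) {z : ℂ} (hz : z ∈ Metric.thickening (4 * r) K) :
    ‖slopeC m P ε t z‖ ≤ 2 * CA / j := by
  have hj := h.j_pos
  unfold slopeC
  rw [norm_div]
  calc _ ≤ CA / (j / 2) :=
        div_le_div₀ h.CA_pos.le (h.radial_le t z hz) (by positivity) (h.le_denom hε t hz)
    _ = 2 * CA / j := by field_simp

theorem differentiableOn_slopeC (h : SlopeBounds m P K r CA CB j) (hε : |ε| * CB ≤ j / 2) (t : ℝ) :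
    DifferentiableOn ℂ (slopeC m P ε t) (Metric.thickening (4 * r) K) := by
  unfold slopeC
  refine DifferentiableOn.div (differentiable_radialC _ _ _ _).differentiableOn ?_
    fun z hz => h.denom_ne_zero hε t hz
  exact ((differentiable_jacC m).add
    ((differentiable_angularC _ _ _ _).const_mul _)).differentiableOn

theorem norm_slopeC_sub_le (h : SlopeBounds m P K r CA CB j) (hε : |ε| * CB ≤ j / 2) (t : ℝ) {z w : ℂ} (hz : z ∈ Metric.thickening (3 * r) K)
    (hw : w ∈ Metric.thickening (3 * r) K) :
    ‖slopeC m P ε t z - slopeC m P ε t w‖ ≤ 2 * CA / j / r * ‖z - w‖ := by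
  have e4 : 4 * r = r + 3 * r := by ring
  refine norm_sub_le_of_forall_mem_thickening h.convex h.r_pos (a := 3 * r) ?_ ?_ hz hw
  · rw [← e4]; exact h.differentiableOn_slopeC hε t
  · rw [← e4]; exact fun w hw => h.norm_slopeC_le hε t hw

theorem norm_slopeC_sub_slopeC_zero_le (h : SlopeBounds m P K r CA CB j) (hε : |ε| * CB ≤ j / 2) (t : ℝ) {z : ℂ} (hz : z ∈ Metric.thickening (4 * r) K) :
    ‖slopeC m P ε t z - slopeC m P 0 t z‖ ≤ |ε| * (2 * CA * CB / j ^ 2) := by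
  have hj := h.j_pos
  have h0 : |(0 : ℝ)| * CB ≤ j / 2 := by simp; positivity
  have hd := h.denom_ne_zero hε t hz
  have hJ : jacC m z ≠ 0 := norm_pos_iff.1 (hj.trans_le (h.le_jac z hz))
  have : slopeC m P ε t z - slopeC m P 0 t z =
      -(radialC m (pAt P t) (qAt P t) t z * (ε * angularC m (pAt P t) (qAt P t) t z)) /
        ((jacC m z + ε * angularC m (pAt P t) (qAt P t) t z) * jacC m z) := by
    unfold slopeC
    rw [Complex.ofReal_zero, zero_mul, add_zero, div_sub_div _ _ hd hJ]
    congr 1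
    ring
  rw [this, norm_div, norm_neg, norm_mul, norm_mul, norm_mul, Complex.norm_real, Real.norm_eq_abs]
  calc _ ≤ CA * (|ε| * CB) / (j / 2 * j) := by
        refine div_le_div₀ (by have := h.CA_pos; have := h.CB_pos; positivity) ?_ (by positivity) ?_
        · have := h.radial_le t z hz
          have := h.angular_le t z hz
          have := h.CA_pos
          gcongr
        · exact mul_le_mul (h.le_denom hε t hz) (h.le_jac z hz) hj.le (norm_nonneg _)
    _ = _ := by field_simp

end SlopeBounds

end Estimates

/-- `jac` is positive on the real segment, hence nonzero on a compact complex neighbourhood, where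
periodicity in `t` bounds everything uniformly. The condition `8 * r ≤ c` keeps the real points used
later positive. -/
theorem exists_slopeBounds {c : ℝ} (hc : 0 < c) (d : ℝ) :
    ∃ r CA CB j : ℝ, 8 * r ≤ c ∧
      SlopeBounds m P ((fun x : ℝ => (x : ℂ)) '' Set.Icc c d) r CA CB j := by
  set K : Set ℂ := (fun x : ℝ => (x : ℂ)) '' Set.Icc c d with hK
  have hKc : IsCompact K := isCompact_Icc.image Complex.continuous_ofReal
  have hO : IsOpen {z : ℂ | jacC m z ≠ 0} := isOpen_ne_fun (continuous_jacC m) continuous_const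
  have hKO : K ⊆ {z : ℂ | jacC m z ≠ 0} := by
    rintro _ ⟨x, hx, rfl⟩
    simp only [Set.mem_ofPred_eq, jacC_ofReal]
    exact_mod_cast (jac_pos m (hc.trans_le hx.1)).ne'
  obtain ⟨δ, hδ, hsub⟩ := hKc.exists_cthickening_subset_open hO hKO
  set r := min δ (c / 2) / 4 with hr
  have hr0 : 0 < r := by have : 0 < c / 2 := by positivity
                         positivity
  have hrδ : 4 * r ≤ δ := by rw [hr]; linarith [min_le_left δ (c / 2)]
  have hrc : 8 * r ≤ c := by rw [hr]; linarith [min_le_right δ (c / 2)]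
  have hW : IsCompact (Metric.cthickening (4 * r) K) := hKc.cthickening
  obtain ⟨CA, hCA, hA⟩ := exists_bound_at P (continuous_radialC m) (radialC_add_two_pi m) hW
  obtain ⟨CB, hCB, hB⟩ := exists_bound_at P (continuous_angularC m) (angularC_add_two_pi m) hW
  obtain ⟨j, hj, hJ⟩ := exists_le_norm_of_ne_zero hW (continuous_jacC m).continuousOn
    fun z hz => hsub (Metric.cthickening_mono hrδ K hz)
  have hth := Metric.thickening_subset_cthickening (4 * r) K
  refine ⟨r, CA, CB, j, hrc, ⟨?_, hr0, hCA, hCB, hj, fun t z hz => hA t z (hth hz),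
    fun t z hz => hB t z (hth hz), fun z hz => hJ z (hth hz)⟩⟩
  exact (convex_Icc c d).linear_image Complex.ofRealCLM.toLinearMap

theorem ofReal_mem_thickening {c d e x : ℝ} (hcd : c ≤ d) (he : 0 < e) (h₁ : c - e < x)
    (h₂ : x < d + e) :
    (x : ℂ) ∈ Metric.thickening e ((fun x : ℝ => (x : ℂ)) '' Set.Icc c d) := by
  rw [Metric.mem_thickening_iff]
  refine ⟨_, ⟨max c (min x d), ⟨le_max_left _ _, max_le hcd (min_le_right _ _)⟩, rfl⟩, ?_⟩
  rw [Complex.dist_eq, ← Complex.ofReal_sub, Complex.norm_real, Real.norm_eq_abs, abs_lt]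
  rcases le_total x c with h | h
  · rw [min_eq_left (h.trans hcd), max_eq_left h]; constructor <;> linarith
  · rcases le_total x d with h' | h'
    · rw [min_eq_left h', max_eq_right h]; constructor <;> linarith
    · rw [min_eq_right h', max_eq_right hcd]; constructor <;> linarith

theorem continuousAt_quotient (p q : MvPolynomial (Fin 2) ℝ) {ε t : ℝ} {w : ℝ → ℂ}
    (hw : ContinuousAt w t) (hne : jacC m (w t) + ε * angularC m p q t (w t) ≠ 0) :
    ContinuousAt (fun τ => radialC m p q τ (w τ) / (jacC m (w τ) + ε * angularC m p q τ (w τ))) t := by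
  have hc : ContinuousAt (fun τ : ℝ => ((τ, w τ) : ℝ × ℂ)) t := continuousAt_id.prodMk hw
  have hR : ContinuousAt (fun τ => radialC m p q τ (w τ)) t :=
    ContinuousAt.comp' (g := fun y : ℝ × ℂ => radialC m p q y.1 y.2)
      (continuous_radialC m p q).continuousAt hc
  have hA : ContinuousAt (fun τ => angularC m p q τ (w τ)) t :=
    ContinuousAt.comp' (g := fun y : ℝ × ℂ => angularC m p q y.1 y.2)
      (continuous_angularC m p q).continuousAt hc
  have hJ : ContinuousAt (fun τ => jacC m (w τ)) t :=
    ContinuousAt.comp' (continuous_jacC m).continuousAt hw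
  exact hR.div (hJ.add (continuousAt_const.mul hA)) hne

/-- The active zone changes only at zeros of `sin t`, whatever `s` is. So the equation is continuous
in time off a fixed countable set. -/
theorem eventually_pAt_eq {t : ℝ} (ht : Real.sin t ≠ 0) :
    ∀ᶠ τ in 𝓝 t, pAt P τ = pAt P t ∧ qAt P τ = qAt P t := by
  rcases lt_or_gt_of_ne ht with h | h
  · filter_upwards [Real.continuous_sin.continuousAt.eventually (gt_mem_nhds h)] with τ hτ
    simp [pAt, qAt, hτ.le.not_gt, h.le.not_gt]
  · filter_upwards [Real.continuous_sin.continuousAt.eventually (lt_mem_nhds h)] with τ hτ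
    simp [pAt, qAt, hτ, h]

theorem continuousAt_slopeC {ε t : ℝ} {w : ℝ → ℂ} (hw : ContinuousAt w t) (ht : Real.sin t ≠ 0)
    (hne : jacC m (w t) + ε * angularC m (pAt P t) (qAt P t) t (w t) ≠ 0) :
    ContinuousAt (fun τ => slopeC m P ε τ (w τ)) t := by
  refine (continuousAt_quotient (pAt P t) (qAt P t) hw hne).congr ?_
  filter_upwards [eventually_pAt_eq P ht] with τ hτ
  simp only [slopeC, hτ.1, hτ.2]

/-- Nested thickenings of `K`: initial values in radius `2 * r`, solutions in `3 * r`, bounds in `4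
* r`. For small `ε` solutions move by less than `r / 8`, and Cauchy's estimate between the last two
radii gives the Lipschitz constant. -/
theorem exists_solution_family {K : Set ℂ} {r CA CB j : ℝ} (h : SlopeBounds m P K r CA CB j)
    {ε : ℝ} (hε : |ε| * CB ≤ j / 2) (hεr : |ε| * (2 * CA / j * (2 * Real.pi)) < r / 8) :
    ∃ u : ℝ → ℂ → ℂ, (∀ z ∈ Metric.thickening (2 * r) K, Continuous fun t => u t z) ∧
      (∀ z ∈ Metric.thickening (2 * r) K, ∀ t,
        ‖u t z - z‖ ≤ |ε| * (2 * CA / j * (2 * Real.pi))) ∧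
      (∀ z ∈ Metric.thickening (2 * r) K, ∀ t, u t z ∈ Metric.thickening (3 * r) K) ∧
      (∀ z ∈ Metric.thickening (2 * r) K, ∀ t,
        u t z = z + ∫ τ in 0..clampTime (2 * Real.pi) t, ε * slopeC m P ε τ (u τ z)) ∧
      (∀ t, DifferentiableOn ℂ (u t) (Metric.thickening (2 * r) K)) ∧
      (∀ x : ℝ, (x : ℂ) ∈ Metric.thickening (2 * r) K → ∀ t, (u t x).im = 0) := by
  classical
  have hr := h.r_pos
  have hπ := Real.two_pi_pos
  have hb : 0 ≤ 2 * CA / j := by have := h.CA_pos; have := h.j_pos; positivity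
  set V := Metric.thickening (4 * r) K with hV
  have hVm : MeasurableSet V := Metric.isOpen_thickening.measurableSet
  -- The right-hand side is cut off outside `V` to make it globally bounded; the solutions never
  -- reach the cut-off.
  set G : ℝ → ℂ → ℂ := fun t z => if z ∈ V then ε * slopeC m P ε t z else 0 with hG
  have hGV : ∀ t, ∀ z ∈ V, G t z = ε * slopeC m P ε t z := fun t z hz => if_pos hz
  have h34 : Metric.thickening (3 * r) K ⊆ V := Metric.thickening_mono (by linarith) K
  have hball : ∀ z ∈ Metric.thickening (2 * r) K,
      Metric.closedBall z (|ε| * (2 * CA / j) * (2 * Real.pi)) ⊆ Metric.thickening (3 * r) K := by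
    intro z hz w hw
    have h1 : w ∈ Metric.ball z r := by
      rw [Metric.mem_closedBall] at hw
      rw [Metric.mem_ball]
      calc dist w z ≤ |ε| * (2 * CA / j) * (2 * Real.pi) := hw
        _ = |ε| * (2 * CA / j * (2 * Real.pi)) := by ring
        _ < r := by linarith
    have h2 := Metric.ball_subset_thickening hz r h1
    have h3 := Metric.thickening_thickening_subset r (2 * r) K h2
    have e3 : r + 2 * r = 3 * r := by ring
    rwa [e3] at h3
  have hGm : Measurable (Function.uncurry G) := by
    refine Measurable.ite (measurable_snd hVm) ?_ measurable_const
    exact (measurable_slopeC P ε).const_mul _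
  have hGB : ∀ t z, ‖G t z‖ ≤ |ε| * (2 * CA / j) := by
    intro t z
    simp only [hG]
    split_ifs with hz
    · rw [norm_mul, Complex.norm_real, Real.norm_eq_abs]
      gcongr
      exact h.norm_slopeC_le hε t hz
    · rw [norm_zero]; positivity
  have hGd : ∀ t, DifferentiableOn ℂ (G t) (Metric.thickening (3 * r) K) := by
    intro t
    exact DifferentiableOn.congr (((h.differentiableOn_slopeC hε t).mono h34).const_mul (ε : ℂ))
      fun z hz => hGV t z (h34 hz)
  have hGL : ∀ t, ∀ z ∈ Metric.thickening (3 * r) K, ∀ w ∈ Metric.thickening (3 * r) K,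
      ‖G t z - G t w‖ ≤ |ε| * (2 * CA / j / r) * ‖z - w‖ := by
    intro t z hz w hw
    rw [hGV t z (h34 hz), hGV t w (h34 hw), ← mul_sub, norm_mul, Complex.norm_real,
      Real.norm_eq_abs, mul_assoc]
    gcongr
    exact h.norm_slopeC_sub_le hε t hz hw
  have hGT : |ε| * (2 * CA / j / r) * (2 * Real.pi) ≤ 1 / 2 := by
    calc |ε| * (2 * CA / j / r) * (2 * Real.pi) = |ε| * (2 * CA / j * (2 * Real.pi)) / r := by
          field_simp
      _ ≤ (r / 8) / r := by gcongr
      _ = 1 / 8 := by field_simp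
      _ ≤ 1 / 2 := by norm_num
  obtain ⟨u, h1, h2, h3, h4, h5⟩ := exists_holomorphic_solution (G := G) (T := 2 * Real.pi)
    (B := |ε| * (2 * CA / j)) (Λ := |ε| * (2 * CA / j / r)) (V := Metric.thickening (3 * r) K)
    (U := Metric.thickening (2 * r) K) hπ.le hGm hGB hGd hGL (by positivity) hGT
    Metric.isOpen_thickening hball
  have hmem : ∀ z ∈ Metric.thickening (2 * r) K, ∀ t, u t z ∈ Metric.thickening (3 * r) K := by
    intro z hz t
    apply hball z hz
    rw [mem_closedBall_iff_norm]
    exact h2 z hz t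
  refine ⟨u, h1, fun z hz t => ?_, hmem, fun z hz t => ?_, h4, h5 fun t x => ?_⟩
  · rw [← mul_assoc]; exact h2 z hz t
  · conv_lhs => rw [h3 z hz t]
    congr 2
    ext τ
    exact hGV τ _ (h34 (hmem z hz τ))
  · simp only [hG]
    split_ifs
    · rw [slopeC_ofReal, Complex.ofReal_im]
    · rfl

end PiecewiseCenter

/-! ### First order expansion of the displacement, and existence of the return family -/

namespace PiecewiseCenter

variable {m n : ℕ} (P : Perturbation n)

/-- Divided by `ε`, the displacement is the integral of `slopeC` along the solution. Replacing `ε`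
by `0` in the denominator and the solution by its initial value costs `O(ε)` each, uniformly in the
complex neighbourhood. -/
theorem tendstoUniformlyOn_displacement {K : Set ℂ} {r CA CB j ε₀ : ℝ}
    (h : SlopeBounds m P K r CA CB j) (hε₀ : 0 < ε₀)
    (hε : ∀ ε : ℝ, |ε| < ε₀ → |ε| * CB ≤ j / 2) {u : ℝ → ℝ → ℂ → ℂ}
    (hcont : ∀ ε : ℝ, |ε| < ε₀ → ∀ z ∈ Metric.thickening (2 * r) K, Continuous fun t => u ε t z)
    (hnear : ∀ ε : ℝ, |ε| < ε₀ → ∀ z ∈ Metric.thickening (2 * r) K, ∀ t,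
        ‖u ε t z - z‖ ≤ |ε| * (2 * CA / j * (2 * Real.pi)))
    (hmem : ∀ ε : ℝ, |ε| < ε₀ → ∀ z ∈ Metric.thickening (2 * r) K, ∀ t,
        u ε t z ∈ Metric.thickening (3 * r) K)
    (heq : ∀ ε : ℝ, |ε| < ε₀ → ∀ z ∈ Metric.thickening (2 * r) K, ∀ t,
        u ε t z = z + ∫ τ in 0..clampTime (2 * Real.pi) t, ε * slopeC m P ε τ (u ε τ z)) :
    TendstoUniformlyOn (fun ε z => ((ε⁻¹ : ℝ) : ℂ) * (u ε (2 * Real.pi) z - z))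
      (fun z => ∫ τ in 0..2 * Real.pi, slopeC m P 0 τ z) (𝓝[≠] 0)
      (Metric.thickening (2 * r) K) := by
  have hπ := Real.two_pi_pos
  have hr := h.r_pos
  have hCA := h.CA_pos
  have hCB := h.CB_pos
  have hj := h.j_pos
  have h34 : Metric.thickening (3 * r) K ⊆ Metric.thickening (4 * r) K :=
    Metric.thickening_mono (by linarith) K
  have h23 : Metric.thickening (2 * r) K ⊆ Metric.thickening (3 * r) K :=
    Metric.thickening_mono (by linarith) K
  set b := 2 * CA / j with hb
  have hb0 : 0 < b := by positivity
  set D := (2 * CA * CB / j ^ 2 + b / r * (b * (2 * Real.pi))) * (2 * Real.pi) with hD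
  have hD0 : 0 < D := by positivity
  have key : ∀ ε : ℝ, |ε| < ε₀ → ε ≠ 0 → ∀ z ∈ Metric.thickening (2 * r) K,
      ‖((ε⁻¹ : ℝ) : ℂ) * (u ε (2 * Real.pi) z - z) - ∫ τ in 0..2 * Real.pi, slopeC m P 0 τ z‖ ≤
        |ε| * D := by
    intro ε hlt hne z hz
    have hneC : (ε : ℂ) ≠ 0 := by exact_mod_cast hne
    have hmeas : Measurable fun τ => slopeC m P ε τ (u ε τ z) :=
      (measurable_slopeC P ε).comp (measurable_id.prodMk (hcont ε hlt z hz).measurable)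
    have hmeas0 : Measurable fun τ => slopeC m P 0 τ z :=
      (measurable_slopeC P 0).comp (measurable_id.prodMk measurable_const)
    have hint : IntervalIntegrable (fun τ => slopeC m P ε τ (u ε τ z)) volume 0 (2 * Real.pi) :=
      intervalIntegrable_of_bounded hmeas
        (fun τ => h.norm_slopeC_le (hε ε hlt) τ (h34 (hmem ε hlt z hz τ))) _ _
    have h00 : |(0 : ℝ)| * CB ≤ j / 2 := hε 0 (by simpa using hε₀)
    have hint0 : IntervalIntegrable (fun τ => slopeC m P 0 τ z) volume 0 (2 * Real.pi) :=
      intervalIntegrable_of_bounded hmeas0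
        (fun τ => h.norm_slopeC_le h00 τ (h34 (h23 hz))) _ _
    have h1 : ((ε⁻¹ : ℝ) : ℂ) * (u ε (2 * Real.pi) z - z) =
        ∫ τ in 0..2 * Real.pi, slopeC m P ε τ (u ε τ z) := by
      rw [heq ε hlt z hz, clampTime_eq ⟨hπ.le, le_rfl⟩, add_sub_cancel_left,
        intervalIntegral.integral_const_mul, Complex.ofReal_inv, inv_mul_cancel_left₀ hneC]
    rw [h1, ← intervalIntegral.integral_sub hint hint0]
    refine (intervalIntegral.norm_integral_le_of_norm_le_const (C := |ε| *
      (2 * CA * CB / j ^ 2 + b / r * (b * (2 * Real.pi)))) fun τ _ => ?_).trans ?_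
    · have e1 := h.norm_slopeC_sub_slopeC_zero_le (hε ε hlt) τ (h34 (hmem ε hlt z hz τ))
      have e2 := h.norm_slopeC_sub_le h00 τ (hmem ε hlt z hz τ) (h23 hz)
      have e3 : b / r * ‖u ε τ z - z‖ ≤ b / r * (|ε| * (b * (2 * Real.pi))) := by
        gcongr; exact hnear ε hlt z hz τ
      have e4 := norm_add_le (slopeC m P ε τ (u ε τ z) - slopeC m P 0 τ (u ε τ z))
        (slopeC m P 0 τ (u ε τ z) - slopeC m P 0 τ z)
      rw [sub_add_sub_cancel] at e4
      rw [← hb] at e2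
      calc _ ≤ _ := e4
        _ ≤ |ε| * (2 * CA * CB / j ^ 2) + b / r * (|ε| * (b * (2 * Real.pi))) :=
          add_le_add e1 (e2.trans e3)
        _ = _ := by ring
    · rw [sub_zero, abs_of_pos hπ, hD, mul_assoc]
  rw [Metric.tendstoUniformlyOn_iff]
  intro e he
  have hpos : 0 < min ε₀ (e / D) := by positivity
  filter_upwards [nhdsWithin_le_nhds (Metric.ball_mem_nhds (0 : ℝ) hpos), self_mem_nhdsWithin]
    with ε hlt hne z hz
  rw [Metric.mem_ball, dist_zero_right, Real.norm_eq_abs, lt_min_iff] at hlt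
  rw [dist_comm, dist_eq_norm]
  refine (key ε hlt.1 hne z hz).trans_lt ?_
  rw [← lt_div_iff₀ hD0]
  exact hlt.2

/-- The family consists of the real parts of the holomorphic solutions, which are real on the real
axis. -/
theorem exists_returnFamily {c d : ℝ} (hc : 0 < c) (hcd : c < d) :
    ∃ ρ ε₀ C Λ v, IsReturnFamily m P c d ρ ε₀ C Λ v := by
  obtain ⟨r, CA, CB, j, hrc, h⟩ := exists_slopeBounds (m := m) P hc d
  set K : Set ℂ := (fun x : ℝ => (x : ℂ)) '' Set.Icc c d with hK
  have hr := h.r_pos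
  have hCA := h.CA_pos
  have hCB := h.CB_pos
  have hj := h.j_pos
  have hπ := Real.two_pi_pos
  set C := 2 * CA / j * (2 * Real.pi) with hCdef
  have hC : 0 < C := by positivity
  set ε₀ := min (j / (2 * CB)) (r / (8 * C)) with hε₀def
  have hε₀ : 0 < ε₀ := by positivity
  have hε1 : ∀ ε : ℝ, |ε| < ε₀ → |ε| * CB ≤ j / 2 := by
    intro ε hε
    have := (hε.trans_le (min_le_left _ _)).le
    calc |ε| * CB ≤ j / (2 * CB) * CB := by gcongr
      _ = j / 2 := by field_simp
  have hε2 : ∀ ε : ℝ, |ε| < ε₀ → |ε| * C < r / 8 := by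
    intro ε hε
    have := (hε.trans_le (min_le_right _ _))
    calc |ε| * C < r / (8 * C) * C := by gcongr
      _ = r / 8 := by field_simp
  have hex : ∀ ε : ℝ, ∃ u : ℝ → ℂ → ℂ, |ε| < ε₀ → _ := fun ε => by
    by_cases hε : |ε| < ε₀
    · obtain ⟨u, hu⟩ := exists_solution_family P h (hε1 ε hε) (hε2 ε hε)
      exact ⟨u, fun _ => hu⟩
    · exact ⟨fun _ _ => 0, fun hε' => absurd hε' hε⟩
  choose u hu using hex
  have h34 : Metric.thickening (3 * r) K ⊆ Metric.thickening (4 * r) K :=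
    Metric.thickening_mono (by linarith) K
  have h23 : Metric.thickening (2 * r) K ⊆ Metric.thickening (3 * r) K :=
    Metric.thickening_mono (by linarith) K
  have hreal : ∀ {e x : ℝ}, 0 < e → c - e < x → x < d + e → (x : ℂ) ∈ Metric.thickening e K :=
    fun he h1 h2 => ofReal_mem_thickening hcd.le he h1 h2
  have hreal1 : ∀ s ∈ Set.Icc (c - r / 2) (d + r / 2), (s : ℂ) ∈ Metric.thickening (1 * r) K :=
    fun s hs => hreal (by linarith) (by linarith [hs.1]) (by linarith [hs.2])
  have hreal2 : ∀ s ∈ Set.Icc (c - r / 2) (d + r / 2), (s : ℂ) ∈ Metric.thickening (2 * r) K :=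
    fun s hs => hreal (by linarith) (by linarith [hs.1]) (by linarith [hs.2])
  have hreal3 : ∀ s ∈ Set.Icc (c - 2 * (r / 2)) (d + 2 * (r / 2)),
      (s : ℂ) ∈ Metric.thickening (3 * r) K :=
    fun s hs => hreal (by linarith) (by linarith [hs.1]) (by linarith [hs.2])
  have hIcc2 : ∀ s ∈ Set.Icc c d, (s : ℂ) ∈ Metric.thickening (2 * r) K :=
    fun s hs => hreal2 s ⟨by linarith [hs.1], by linarith [hs.2]⟩
  have hofReal : ∀ ε : ℝ, |ε| < ε₀ → ∀ s : ℝ, (s : ℂ) ∈ Metric.thickening (2 * r) K → ∀ t,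
      u ε t s = ((u ε t s).re : ℂ) := by
    intro ε hε s hs t
    apply Complex.ext
    · simp
    · simpa using (hu ε hε).2.2.2.2.2 s hs t
  have hopen : IsOpen (Metric.thickening (2 * r) K) := Metric.isOpen_thickening
  -- the displacement divided by `ε` and its limit
  set g : ℝ → ℂ → ℂ := fun ε z => ((ε⁻¹ : ℝ) : ℂ) * (u ε (2 * Real.pi) z - z) with hg
  set g₀ : ℂ → ℂ := fun z => ∫ τ in 0..2 * Real.pi, slopeC m P 0 τ z with hg₀
  have hgd : ∀ ε : ℝ, |ε| < ε₀ → DifferentiableOn ℂ (g ε) (Metric.thickening (2 * r) K) :=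
    fun ε hε => (((hu ε hε).2.2.2.2.1 _).sub differentiableOn_id).const_mul _
  have hunif : TendstoUniformlyOn g g₀ (𝓝[≠] 0) (Metric.thickening (2 * r) K) :=
    tendstoUniformlyOn_displacement P h hε₀ hε1 (fun ε hε => (hu ε hε).1)
      (fun ε hε => (hu ε hε).2.1) (fun ε hε => (hu ε hε).2.2.1) (fun ε hε => (hu ε hε).2.2.2.1)
  have hsmall : ∀ᶠ ε : ℝ in 𝓝[≠] 0, |ε| < ε₀ := by
    filter_upwards [nhdsWithin_le_nhds (Metric.ball_mem_nhds (0 : ℝ) hε₀)] with ε hε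
    simpa using hε
  have hgdE : ∀ᶠ ε : ℝ in 𝓝[≠] 0, DifferentiableOn ℂ (g ε) (Metric.thickening (2 * r) K) :=
    hsmall.mono hgd
  have hg₀d : DifferentiableOn ℂ g₀ (Metric.thickening (2 * r) K) :=
    hunif.tendstoLocallyUniformlyOn.differentiableOn hgdE hopen
  have hgre : ∀ ε : ℝ, (fun s : ℝ => ε⁻¹ * ((u ε (2 * Real.pi) s).re - s)) =
      fun s : ℝ => (g ε s).re := by
    intro ε
    ext s
    simp only [hg, Complex.re_ofReal_mul, Complex.sub_re, Complex.ofReal_re]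
  have hg₀real : ∀ s : ℝ, (g₀ s).re =
      (∫ t in 0..2 * Real.pi, radial m (pAt P t) (qAt P t) t s) / jac m s := by
    intro s
    simp only [hg₀, slopeC, Complex.ofReal_zero, zero_mul, add_zero, radialC_ofReal, jacC_ofReal]
    rw [intervalIntegral.integral_div, intervalIntegral.integral_ofReal, ← Complex.ofReal_div,
      Complex.ofReal_re]
  have hg₀re : (fun s : ℝ => (∫ t in 0..2 * Real.pi, radial m (pAt P t) (qAt P t) t s) / jac m s) =
      fun s : ℝ => (g₀ s).re := by
    ext s; rw [hg₀real]
  have hcontre : ∀ {f : ℂ → ℂ}, DifferentiableOn ℂ f (Metric.thickening (2 * r) K) → ∀ k,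
      ContinuousOn (iteratedDeriv k fun s : ℝ => (f s).re) (Set.Icc c d) := by
    intro f hf k
    have := (iteratedDeriv_re_comp_ofReal hopen hf k)
    refine ContinuousOn.congr (f := fun s : ℝ => (iteratedDeriv k f s).re) ?_ fun s hs =>
      this.2 s (hIcc2 s hs)
    exact Complex.continuous_re.comp_continuousOn (this.1.continuousOn.comp
      Complex.continuous_ofReal.continuousOn fun s hs => hIcc2 s hs)
  refine ⟨r / 2, ε₀, C, ε₀ * (2 * CA / j / r), fun ε t s => (u ε t s).re, ?_⟩
  refine
    { c_lt_d := hcd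
      ρ_pos := by linarith
      lower_pos := by linarith
      ε₀_pos := hε₀
      angular_le := ?_
      lipschitz := ?_
      continuous := ?_
      init := ?_
      near := ?_
      near' := fun ε hε => by have := hε2 ε hε; rw [mul_comm]; linarith
      deriv := ?_
      strictMono := ?_
      conv := ?_
      cont_iteratedDeriv := ?_
      cont_iteratedDeriv_limit := ?_ }
  · intro ε hε t x hx
    have hx4 := h34 (hreal3 x hx)
    have hx0 : 0 < x := by linarith [hx.1]
    have h1 := h.le_jac _ hx4
    have h2 := h.angular_le t _ hx4
    rw [jacC_ofReal, Complex.norm_real, Real.norm_of_nonneg (jac_pos m hx0).le] at h1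
    rw [angularC_ofReal, Complex.norm_real, Real.norm_eq_abs] at h2
    rw [abs_mul]
    have h3 := hε1 ε hε
    have h4 : |ε| * |angular m (pAt P t) (qAt P t) t x| ≤ |ε| * CB := by gcongr
    linarith
  · intro ε hε t x hx y hy
    have h1 := h.norm_slopeC_sub_le (hε1 ε hε) t (hreal3 x hx) (hreal3 y hy)
    have h2 : ‖(ε : ℂ) * (slopeC m P ε t x - slopeC m P ε t y)‖ ≤
        |ε| * (2 * CA / j / r * ‖(x : ℂ) - y‖) := by
      rw [norm_mul, Complex.norm_real, Real.norm_eq_abs]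
      gcongr
    rw [mul_sub, slopeC_ofReal, slopeC_ofReal, ← Complex.ofReal_sub, ← Complex.ofReal_sub,
      Complex.norm_real, Complex.norm_real, Real.norm_eq_abs, Real.norm_eq_abs] at h2
    refine h2.trans ?_
    rw [← mul_assoc]
    gcongr
  · intro ε hε s hs
    exact Complex.continuous_re.comp ((hu ε hε).1 s (hreal2 s hs))
  · intro ε hε s hs
    rw [(hu ε hε).2.2.2.1 s (hreal2 s hs) 0, clampTime_eq ⟨le_rfl, hπ.le⟩]
    simp
  · intro ε hε s hs t
    have h1 := (hu ε hε).2.1 s (hreal2 s hs) t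
    rw [hofReal ε hε s (hreal2 s hs) t, ← Complex.ofReal_sub, Complex.norm_real,
      Real.norm_eq_abs] at h1
    rw [mul_comm C]
    exact h1
  · intro ε hε s hs t ht hsin
    have hs2 := hreal2 s hs
    have hmeas : Measurable fun τ => slopeC m P ε τ (u ε τ s) :=
      (measurable_slopeC P ε).comp (measurable_id.prodMk ((hu ε hε).1 s hs2).measurable)
    have hmem := (hu ε hε).2.2.1 s hs2
    have hint : IntervalIntegrable (fun τ => (ε : ℂ) * slopeC m P ε τ (u ε τ s)) volume 0 t :=
      (intervalIntegrable_of_bounded hmeas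
        (fun τ => h.norm_slopeC_le (hε1 ε hε) τ (h34 (hmem τ))) _ _).const_mul _
    have hca : ContinuousAt (fun τ => (ε : ℂ) * slopeC m P ε τ (u ε τ s)) t :=
      continuousAt_const.mul (continuousAt_slopeC P ((hu ε hε).1 s hs2).continuousAt hsin
        (h.denom_ne_zero (hε1 ε hε) t (h34 (hmem t))))
    have h1 := intervalIntegral.integral_hasDerivAt_right hint
      (hmeas.const_mul _).stronglyMeasurable.stronglyMeasurableAtFilter hca
    have h2 : HasDerivAt (fun t => u ε t s) ((ε : ℂ) * slopeC m P ε t (u ε t s)) t := by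
      refine (h1.const_add (s : ℂ)).congr_of_eventuallyEq ?_
      filter_upwards [Ioo_mem_nhds ht.1 ht.2] with τ hτ
      rw [(hu ε hε).2.2.2.1 s hs2 τ, clampTime_eq ⟨hτ.1.le, hτ.2.le⟩]
    have h3 := (Complex.reCLM.hasFDerivAt (x := u ε t s)).comp_hasDerivAt t h2
    have h4 : Complex.reCLM ((ε : ℂ) * slopeC m P ε t (u ε t s)) =
        slopeField m P ε t (u ε t s).re := by
      conv_lhs => rw [hofReal ε hε s hs2 t]
      rw [slopeC_ofReal]
      simp
    rw [h4] at h3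
    exact h3
  -- The displacement is at most `|ε| * C < r / 8` on the thickening of radius `2 * r`, so by Cauchy
  -- it is `1 / 8`-Lipschitz on that of radius `r`. The return map is thus a small perturbation of
  -- the identity and strictly increasing.
  · intro ε hε x hx y hy hxy
    have e2 : 2 * r = r + 1 * r := by ring
    have h1 := norm_sub_le_of_forall_mem_thickening (f := fun z => u ε (2 * Real.pi) z - z)
      (C := |ε| * C) h.convex hr (a := 1 * r)
      (by rw [← e2]; exact ((hu ε hε).2.2.2.2.1 _).sub differentiableOn_id)
      (by rw [← e2]; exact fun w hw => (hu ε hε).2.1 w hw _) (hreal1 x hx) (hreal1 y hy)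
    rw [hofReal ε hε x (hreal2 x hx), hofReal ε hε y (hreal2 y hy), ← Complex.ofReal_sub,
      ← Complex.ofReal_sub, ← Complex.ofReal_sub, ← Complex.ofReal_sub, Complex.norm_real,
      Complex.norm_real, Real.norm_eq_abs, Real.norm_eq_abs, abs_of_neg (sub_neg.2 hxy)] at h1
    have h2 : |ε| * C / r ≤ 1 / 8 := by
      rw [div_le_iff₀ hr]; linarith [hε2 ε hε]
    have h3 : |ε| * C / r * -(x - y) ≤ 1 / 8 * -(x - y) := by
      gcongr; linarith
    have h4 := (abs_le.1 (h1.trans h3)).2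
    simp only
    linarith
  · intro k
    simp only [hgre, hg₀re]
    -- Uniform convergence on an open complex set yields convergence of every derivative on the
    -- compact real interval.
    have h1 := tendstoLocallyUniformlyOn_iteratedDeriv hopen hunif.tendstoLocallyUniformlyOn hgdE k
    have h2 := (tendstoLocallyUniformlyOn_iff_forall_isCompact hopen).1 h1 K
      (fun z ⟨s, hs, hz⟩ => hz ▸ hIcc2 s hs) (isCompact_Icc.image Complex.continuous_ofReal)
    rw [Metric.tendstoUniformlyOn_iff] at h2 ⊢
    intro e he
    filter_upwards [h2 e he, hgdE] with ε h3 h4 s hs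
    rw [(iteratedDeriv_re_comp_ofReal hopen h4 k).2 s (hIcc2 s hs),
      (iteratedDeriv_re_comp_ofReal hopen hg₀d k).2 s (hIcc2 s hs)]
    refine lt_of_le_of_lt ?_ (h3 s ⟨s, hs, rfl⟩)
    rw [Real.dist_eq, Complex.dist_eq, ← Complex.sub_re]
    exact Complex.abs_re_le_norm _
  · intro ε hε k
    rw [hgre]
    exact hcontre (hgd ε hε) k
  · intro k
    rw [hg₀re]
    exact hcontre hg₀d k

end PiecewiseCenter

namespace PiecewiseCenter

/-! ### The squared radius as a function of the parameter of the switching curve -/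

/-- The squared distance of `(s, s ^ m)` from the origin. -/
def sqRadius (m : ℕ) (s : ℝ) : ℝ := s ^ 2 + s ^ (2 * m)

theorem sqRadius_pos (m : ℕ) {s : ℝ} (hs : 0 < s) : 0 < sqRadius m s := by
  unfold sqRadius; positivity

theorem continuous_sqRadius (m : ℕ) : Continuous (sqRadius m) := by unfold sqRadius; fun_prop

theorem hasStrictDerivAt_sqRadius (m : ℕ) (s : ℝ) :
    HasStrictDerivAt (sqRadius m) (2 * jac m s) s := by
  have h := (hasStrictDerivAt_pow 2 s).fun_add (hasStrictDerivAt_pow (2 * m) s)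
  refine HasStrictDerivAt.congr_deriv h ?_
  unfold jac
  push_cast
  ring

theorem strictMonoOn_sqRadius (m : ℕ) : StrictMonoOn (sqRadius m) (Set.Ici 0) := by
  intro x hx y hy hxy
  have hx : 0 ≤ x := hx
  have h1 : x ^ 2 < y ^ 2 := by gcongr
  have h2 : x ^ (2 * m) ≤ y ^ (2 * m) := by gcongr
  unfold sqRadius
  linarith

theorem sqRadius_injOn (m : ℕ) {x y : ℝ} (hx : 0 < x) (hy : 0 < y)
    (h : sqRadius m x = sqRadius m y) : x = y :=
  (strictMonoOn_sqRadius m).injOn hx.le hy.le h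

theorem exists_sqRadius_eq {m : ℕ} (hm : 0 < m) {h : ℝ} (hh : 0 < h) :
    ∃ s, 0 < s ∧ sqRadius m s = h := by
  have h0 : sqRadius m 0 = 0 := by simp [sqRadius, hm.ne']
  have h1 : h ≤ sqRadius m (h + 1) := by
    have : 0 ≤ (h + 1) ^ (2 * m) := by positivity
    unfold sqRadius
    nlinarith
  obtain ⟨s, hs, hse⟩ := intermediate_value_Icc (by linarith : (0 : ℝ) ≤ h + 1)
    (continuous_sqRadius m).continuousOn (show h ∈ Set.Icc (sqRadius m 0) (sqRadius m (h + 1)) from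
      ⟨by rw [h0]; exact hh.le, h1⟩)
  refine ⟨s, lt_of_le_of_ne hs.1 ?_, hse⟩
  rintro rfl
  rw [h0] at hse
  exact hh.ne hse

/-- The positive parameter `s` with `sqRadius m s = h`. -/
noncomputable def sqRadiusInv (m : ℕ) (h : ℝ) : ℝ := Function.invFunOn (sqRadius m) (Set.Ioi 0) h

theorem sqRadiusInv_pos {m : ℕ} (hm : 0 < m) {h : ℝ} (hh : 0 < h) : 0 < sqRadiusInv m h :=
  Function.invFunOn_mem (s := Set.Ioi 0) (exists_sqRadius_eq hm hh)

theorem sqRadius_sqRadiusInv {m : ℕ} (hm : 0 < m) {h : ℝ} (hh : 0 < h) :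
    sqRadius m (sqRadiusInv m h) = h :=
  Function.invFunOn_eq (s := Set.Ioi 0) (exists_sqRadius_eq hm hh)

theorem sqRadiusInv_sqRadius {m : ℕ} (hm : 0 < m) {s : ℝ} (hs : 0 < s) :
    sqRadiusInv m (sqRadius m s) = s :=
  sqRadius_injOn m (sqRadiusInv_pos hm (sqRadius_pos m hs)) hs
    (sqRadius_sqRadiusInv hm (sqRadius_pos m hs))

theorem hasStrictDerivAt_sqRadiusInv {m : ℕ} (hm : 0 < m) {s : ℝ} (hs : 0 < s) :
    HasStrictDerivAt (sqRadiusInv m) (2 * jac m s)⁻¹ (sqRadius m s) := by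
  refine (hasStrictDerivAt_sqRadius m s).to_local_left_inverse
    (mul_pos two_pos (jac_pos m hs)).ne' ?_
  filter_upwards [lt_mem_nhds hs] with x hx using sqRadiusInv_sqRadius hm hx

/-- `sqRadius` has nonzero derivative at positive points, so the analytic inverse function theorem
applies. Orders of vanishing in `h` and in `s` can then be compared. The regularity index `⊤` below
means analytic. -/
theorem analyticAt_sqRadiusInv {m : ℕ} (hm : 0 < m) {s : ℝ} (hs : 0 < s) :
    AnalyticAt ℝ (sqRadiusInv m) (sqRadius m s) := by
  have hne : 2 * jac m s ≠ 0 := (mul_pos two_pos (jac_pos m hs)).ne'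
  have hd := (hasStrictDerivAt_sqRadius m s).hasStrictFDerivAt_equiv hne
  have hcd : ContDiffAt ℝ ⊤ (sqRadius m) s := by
    unfold sqRadius; fun_prop
  have h1 := hcd.to_localInverse hd.hasFDerivAt (by simp)
  have h2 := HasStrictFDerivAt.localInverse_unique (hcd.hasStrictFDerivAt' hd.hasFDerivAt (by simp))
    (g := sqRadiusInv m) (by
      filter_upwards [lt_mem_nhds hs] with x hx using sqRadiusInv_sqRadius hm hx)
  exact (h1.congr_of_eventuallyEq h2).analyticAt

theorem continuousAt_sqRadiusInv {m : ℕ} (hm : 0 < m) {h : ℝ} (hh : 0 < h) :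
    ContinuousAt (sqRadiusInv m) h := by
  have := (analyticAt_sqRadiusInv hm (sqRadiusInv_pos hm hh)).continuousAt
  rwa [sqRadius_sqRadiusInv hm hh] at this

/-! ### The coordinates `(s, t) ↦ flow m s t` -/

theorem flow_sq_add_sq (m : ℕ) (s t : ℝ) :
    (flow m s t).1 ^ 2 + (flow m s t).2 ^ 2 = sqRadius m s := by
  have := Real.sin_sq_add_cos_sq t
  have e : s ^ (2 * m) = (s ^ m) ^ 2 := by rw [← pow_mul, mul_comm]
  simp only [flow, sqRadius, e]
  linear_combination (s ^ 2 + (s ^ m) ^ 2) * this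

theorem flow_zero (m : ℕ) (s : ℝ) : flow m s 0 = (s, s ^ m) := by simp [flow]

theorem flow_add_two_pi_mul (m : ℕ) (s t : ℝ) (j : ℤ) : flow m s (t + j * (2 * Real.pi)) = flow m s t := by
  simp [flow, Real.sin_add_int_mul_two_pi, Real.cos_add_int_mul_two_pi]

theorem flow_two_pi (m : ℕ) (s : ℝ) : flow m s (2 * Real.pi) = (s, s ^ m) := by simp [flow]

/-- Cross product with the base point `(s, s ^ m)`; the next identity is the inner product. Together
they recover the angle from the point. -/
theorem sqRadius_mul_sin (m : ℕ) (s t : ℝ) :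
    sqRadius m s * Real.sin t = s ^ m * (flow m s t).1 - s * (flow m s t).2 := by
  have e : s ^ (2 * m) = (s ^ m) ^ 2 := by rw [← pow_mul, mul_comm]
  simp only [flow, sqRadius, e]
  ring

theorem sqRadius_mul_cos (m : ℕ) (s t : ℝ) :
    sqRadius m s * Real.cos t = s * (flow m s t).1 + s ^ m * (flow m s t).2 := by
  have e : s ^ (2 * m) = (s ^ m) ^ 2 := by rw [← pow_mul, mul_comm]
  simp only [flow, sqRadius, e]
  ring

theorem flow_inj {m : ℕ} {s s' t t' : ℝ} (hs : 0 < s) (hs' : 0 < s')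
    (h : flow m s t = flow m s' t') :
    s = s' ∧ ∃ j : ℤ, t = t' + j * (2 * Real.pi) := by
  have h1 : s = s' := sqRadius_injOn m hs hs' (by
    rw [← flow_sq_add_sq m s t, h, flow_sq_add_sq])
  subst h1
  have hR := (sqRadius_pos m hs).ne'
  have hsin : Real.sin t = Real.sin t' := by
    apply mul_left_cancel₀ hR
    rw [sqRadius_mul_sin, h, sqRadius_mul_sin]
  have hcos : Real.cos t = Real.cos t' := by
    apply mul_left_cancel₀ hR
    rw [sqRadius_mul_cos, h, sqRadius_mul_cos]
  refine ⟨rfl, ?_⟩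
  have h2 : Real.cos (t - t') = 1 := by
    rw [Real.cos_sub, hsin, hcos, ← sq, ← sq, add_comm, Real.sin_sq_add_cos_sq]
  obtain ⟨j, hj⟩ := (Real.cos_eq_one_iff _).1 h2
  exact ⟨j, by linarith⟩

theorem flow_eq_branch {m : ℕ} {s t x : ℝ} (hs : 0 < s) (hx : 0 < x)
    (h : flow m s t = (x, x ^ m)) : s = x ∧ ∃ j : ℤ, t = j * (2 * Real.pi) := by
  rw [← flow_zero] at h
  simpa using flow_inj hs hx h

/-- On the circle through `(s, s ^ (2 * k + 1))` the curve may be replaced by the line through that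
point and the origin. If `|x| ≤ s`, then `|y|` dominates both left-hand sides and the sign of `y`
decides, except in boundary cases where `x ^ 2 = s ^ 2` and the two sides coincide. If `|x| > s`,
the sign of `x` decides. -/
theorem le_mul_pow_iff_aux {k : ℕ} {x y s : ℝ} (hs : 0 < s)
    (h : x ^ 2 + y ^ 2 = s ^ 2 + (s * (s ^ 2) ^ k) ^ 2) :
    x * (x ^ 2) ^ k ≤ y ↔ x * (s ^ 2) ^ k ≤ y := by
  have hs2 : 0 < (s ^ 2) ^ k := by positivity
  rcases le_or_gt (x ^ 2) (s ^ 2) with hle | hlt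
  · have hp : (x ^ 2) ^ k ≤ (s ^ 2) ^ k := pow_le_pow_left₀ (sq_nonneg x) hle k
    have hp0 : 0 ≤ (x ^ 2) ^ k := by positivity
    have hxs : |x| ≤ s := abs_le_of_sq_le_sq hle hs.le
    have hy : s * (s ^ 2) ^ k ≤ |y| := by
      apply le_of_sq_le_sq _ (abs_nonneg y)
      rw [sq_abs]; linarith
    have h1 : |x * (x ^ 2) ^ k| ≤ s * (s ^ 2) ^ k := by
      rw [abs_mul, abs_of_nonneg hp0]
      gcongr
    have h2 : |x * (s ^ 2) ^ k| ≤ s * (s ^ 2) ^ k := by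
      rw [abs_mul, abs_of_pos hs2]
      gcongr
    rcases le_or_gt 0 y with hy0 | hy0
    · rw [abs_of_nonneg hy0] at hy
      exact ⟨fun _ => (le_abs_self _).trans (h2.trans hy), fun _ => (le_abs_self _).trans (h1.trans hy)⟩
    · rw [abs_of_neg hy0] at hy
      constructor
      · intro h3
        have h4 := (abs_le.1 h1).1
        have h5 : |y| = s * (s ^ 2) ^ k := by rw [abs_of_neg hy0]; linarith
        have h6 : x ^ 2 = s ^ 2 := by
          have : y ^ 2 = (s * (s ^ 2) ^ k) ^ 2 := by rw [← h5, sq_abs]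
          linarith
        rwa [h6] at h3
      · intro h3
        have h4 := (abs_le.1 h2).1
        have h5 : |y| = s * (s ^ 2) ^ k := by rw [abs_of_neg hy0]; linarith
        have h6 : x ^ 2 = s ^ 2 := by
          have : y ^ 2 = (s * (s ^ 2) ^ k) ^ 2 := by rw [← h5, sq_abs]
          linarith
        rwa [← h6] at h3
  · have hp : (s ^ 2) ^ k ≤ (x ^ 2) ^ k := pow_le_pow_left₀ (sq_nonneg s) hlt.le k
    have hxs : s < |x| := by
      apply lt_of_pow_lt_pow_left₀ 2 (abs_nonneg x)
      rwa [sq_abs]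
    have hy : |y| < s * (s ^ 2) ^ k := by
      apply lt_of_pow_lt_pow_left₀ 2 (by positivity)
      rw [sq_abs]; linarith
    have h1 : |y| < |x| * (s ^ 2) ^ k := hy.trans (by gcongr)
    have h2 : |y| < |x| * (x ^ 2) ^ k := h1.trans_le (by gcongr)
    rcases le_or_gt 0 x with hx0 | hx0
    · rw [abs_of_nonneg hx0] at h1 h2
      have := le_abs_self y
      constructor <;> intro h3 <;> linarith
    · rw [abs_of_neg hx0] at h1 h2
      have := neg_abs_le y
      constructor <;> intro _ <;> linarith

/-- The straightening of the switching curve: membership in the upper zone depends on `t` alone.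
After the reduction to a line, the side is read off from the cross product `sqRadius_mul_sin`. -/
theorem flow_above_iff {k m : ℕ} (hm : m = 2 * k + 1) {s : ℝ} (hs : 0 < s) (t : ℝ) :
    (flow m s t).1 ^ m ≤ (flow m s t).2 ↔ Real.sin t ≤ 0 := by
  have hR := sqRadius_pos m hs
  have e1 : ∀ x : ℝ, x ^ m = x * (x ^ 2) ^ k := by
    intro x; rw [hm, pow_succ, pow_mul, mul_comm]
  have h1 := le_mul_pow_iff_aux (k := k) (x := (flow m s t).1) (y := (flow m s t).2) hs (by
    rw [flow_sq_add_sq, sqRadius, mul_comm 2 m, pow_mul, e1 s])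
  rw [e1, h1]
  have h2 := sqRadius_mul_sin m s t
  rw [e1 s] at h2
  constructor
  · intro h3
    by_contra h4
    push Not at h4
    have h5 : 0 < sqRadius m s * Real.sin t := mul_pos hR h4
    nlinarith
  · intro h3
    have h5 : sqRadius m s * Real.sin t ≤ 0 := mul_nonpos_of_nonneg_of_nonpos hR.le h3
    rw [h2] at h5
    have h6 : s * ((flow m s t).1 * (s ^ 2) ^ k) ≤ s * (flow m s t).2 := by nlinarith
    exact le_of_mul_le_mul_left h6 hs

variable {m n : ℕ} (P : Perturbation n)

theorem field_flow {k : ℕ} (hm : m = 2 * k + 1) (ε : ℝ) {s : ℝ} (hs : 0 < s) (t : ℝ) :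
    field m P ε (flow m s t) = ((flow m s t).2 + ε * ev (pAt P t) (flow m s t),
      -(flow m s t).1 + ε * ev (qAt P t) (flow m s t)) := by
  unfold field pAt qAt
  by_cases h : Real.sin t ≤ 0
  · rw [if_pos ((flow_above_iff hm hs t).2 h), if_neg h.not_gt, if_neg h.not_gt]
  · rw [if_neg (fun h' => h ((flow_above_iff hm hs t).1 h')), if_pos (not_le.1 h),
      if_pos (not_le.1 h)]

theorem hasDerivAt_flow_comp {σ ψ : ℝ → ℝ} {σ' ψ' τ : ℝ} (hσ : HasDerivAt σ σ' τ)
    (hψ : HasDerivAt ψ ψ' τ) :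
    HasDerivAt (fun τ => flow m (σ τ) (ψ τ))
      ((Real.cos (ψ τ) + m * σ τ ^ (m - 1) * Real.sin (ψ τ)) * σ' + (flow m (σ τ) (ψ τ)).2 * ψ',
        (-Real.sin (ψ τ) + m * σ τ ^ (m - 1) * Real.cos (ψ τ)) * σ'
          - (flow m (σ τ) (ψ τ)).1 * ψ') τ := by
  have hm := hσ.fun_pow m
  refine HasDerivAt.prodMk ?_ ?_
  · refine ((hσ.fun_mul hψ.cos).fun_add (hm.fun_mul hψ.sin)).congr_deriv ?_
    simp only [flow]
    ring
  · refine ((hσ.fun_mul hψ.sin).fun_neg.fun_add (hm.fun_mul hψ.cos)).congr_deriv ?_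
    simp only [flow]
    ring

/-- Up to sign, the Jacobian determinant of the coordinates `(s, t)`. It does not depend on `t`. -/
theorem jac_eq (hm : 0 < m) (s t : ℝ) :
    (-Real.sin t + m * s ^ (m - 1) * Real.cos t) * (flow m s t).2
      + (Real.cos t + m * s ^ (m - 1) * Real.sin t) * (flow m s t).1 = jac m s := by
  have h := Real.sin_sq_add_cos_sq t
  have e : s ^ (2 * m - 1) = s ^ (m - 1) * s ^ m := by
    rw [← pow_add]; congr 1; omega
  simp only [flow, jac, e]
  linear_combination (s + m * s ^ (m - 1) * s ^ m) * h

/-- The coordinates of a solution solve the transformed system. -/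
theorem hasDerivAt_coordinates (hm : 0 < m) {σ ψ : ℝ → ℝ} {p q : MvPolynomial (Fin 2) ℝ}
    {ε τ : ℝ} (hσc : ContinuousAt σ τ) (hψc : ContinuousAt ψ τ) (hσ : 0 < σ τ)
    (h : HasDerivAt (fun τ => flow m (σ τ) (ψ τ))
      ((flow m (σ τ) (ψ τ)).2 + ε * ev p (flow m (σ τ) (ψ τ)),
        -(flow m (σ τ) (ψ τ)).1 + ε * ev q (flow m (σ τ) (ψ τ))) τ) :
    HasDerivAt σ (ε * radial m p q (ψ τ) (σ τ) / jac m (σ τ)) τ ∧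
      HasDerivAt ψ (1 + ε * angular m p q (ψ τ) (σ τ) / jac m (σ τ)) τ := by
  have hJ := (jac_pos m hσ).ne'
  have hx : DifferentiableAt ℝ (fun t => (flow m (σ t) (ψ t)).1) τ := h.differentiableAt.fst
  have hy : DifferentiableAt ℝ (fun t => (flow m (σ t) (ψ t)).2) τ := h.differentiableAt.snd
  have hσev : ∀ᶠ t in 𝓝 τ, 0 < σ t := hσc.eventually (lt_mem_nhds hσ)
  -- differentiability of `σ`
  have hσd : DifferentiableAt ℝ σ τ := by
    have h1 : DifferentiableAt ℝ (fun t => (flow m (σ t) (ψ t)).1 ^ 2 + (flow m (σ t) (ψ t)).2 ^ 2) τ :=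
      (hx.pow 2).add (hy.pow 2)
    have h2 : DifferentiableAt ℝ (sqRadiusInv m)
        ((fun t => (flow m (σ t) (ψ t)).1 ^ 2 + (flow m (σ t) (ψ t)).2 ^ 2) τ) := by
      simp only [flow_sq_add_sq]
      exact (hasStrictDerivAt_sqRadiusInv hm hσ).hasDerivAt.differentiableAt
    refine (h2.comp τ h1).congr_of_eventuallyEq ?_
    filter_upwards [hσev] with t ht
    simp only [Function.comp_apply, flow_sq_add_sq, sqRadiusInv_sqRadius hm ht]
  -- differentiability of `ψ`
  have hψd : DifferentiableAt ℝ ψ τ := by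
    have hR : DifferentiableAt ℝ (fun t => sqRadius m (σ t)) τ :=
      (hasStrictDerivAt_sqRadius m (σ τ)).hasDerivAt.differentiableAt.comp τ hσd
    have hRne : sqRadius m (σ τ) ≠ 0 := (sqRadius_pos m hσ).ne'
    have hsin : DifferentiableAt ℝ (fun t => Real.sin (ψ t)) τ := by
      refine (((hσd.pow m).mul hx).sub (hσd.mul hy)
        |>.div hR hRne).congr_of_eventuallyEq ?_
      filter_upwards [hσev] with t ht
      simp only [Pi.sub_apply, Pi.mul_apply, Pi.div_apply, Pi.pow_apply]
      rw [eq_div_iff (sqRadius_pos m ht).ne', mul_comm, sqRadius_mul_sin]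
    have hcos : DifferentiableAt ℝ (fun t => Real.cos (ψ t)) τ := by
      refine ((hσd.mul hx).add ((hσd.pow m).mul hy)
        |>.div hR hRne).congr_of_eventuallyEq ?_
      filter_upwards [hσev] with t ht
      simp only [Pi.add_apply, Pi.mul_apply, Pi.div_apply, Pi.pow_apply]
      rw [eq_div_iff (sqRadius_pos m ht).ne', mul_comm, sqRadius_mul_cos]
    -- This is `sin (ψ t - ψ τ)`, which vanishes at `τ`; near there `arcsin` recovers the increment
    -- of the continuous function `ψ`.
    have hφ : DifferentiableAt ℝ (fun t => Real.sin (ψ t) * Real.cos (ψ τ)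
        - Real.cos (ψ t) * Real.sin (ψ τ)) τ :=
      (hsin.mul_const _).sub (hcos.mul_const _)
    have harc : DifferentiableAt ℝ Real.arcsin ((fun t => Real.sin (ψ t) * Real.cos (ψ τ)
        - Real.cos (ψ t) * Real.sin (ψ τ)) τ) := by
      have : (fun t => Real.sin (ψ t) * Real.cos (ψ τ)
        - Real.cos (ψ t) * Real.sin (ψ τ)) τ = 0 := by ring
      rw [this]
      exact Real.differentiableAt_arcsin.2 ⟨by norm_num, by norm_num⟩
    refine ((harc.comp τ hφ).const_add (ψ τ)).congr_of_eventuallyEq ?_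
    have hnear : ∀ᶠ t in 𝓝 τ, ψ t ∈ Metric.ball (ψ τ) 1 :=
      hψc.eventually (Metric.ball_mem_nhds _ one_pos)
    filter_upwards [hnear] with t ht
    rw [Metric.mem_ball, Real.dist_eq, abs_lt] at ht
    simp only [Function.comp_apply, ← Real.sin_sub]
    rw [Real.arcsin_sin (by linarith [Real.pi_gt_three]) (by linarith [Real.pi_gt_three])]
    ring
  -- the values of the derivatives
  have hchain := hasDerivAt_flow_comp (m := m) hσd.hasDerivAt hψd.hasDerivAt
  have heq := hchain.unique h
  rw [Prod.mk.injEq] at heq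
  obtain ⟨e1, e2⟩ := heq
  have hj := jac_eq hm (σ τ) (ψ τ)
  -- Cramer's rule: weighting the components by `x` and `y` eliminates the derivative of the angle.
  -- For the angle, the weights are the components of the `s`-derivative of `flow`.
  have hs : deriv σ τ = ε * radial m p q (ψ τ) (σ τ) / jac m (σ τ) := by
    rw [eq_div_iff hJ]
    unfold radial
    linear_combination (flow m (σ τ) (ψ τ)).1 * e1 + (flow m (σ τ) (ψ τ)).2 * e2
      - deriv σ τ * hj
  have hp : deriv ψ τ = 1 + ε * angular m p q (ψ τ) (σ τ) / jac m (σ τ) := by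
    have : jac m (σ τ) * deriv ψ τ = jac m (σ τ) + ε * angular m p q (ψ τ) (σ τ) := by
      unfold angular
      linear_combination (-Real.sin (ψ τ) + m * σ τ ^ (m - 1) * Real.cos (ψ τ)) * e1
        - (Real.cos (ψ τ) + m * σ τ ^ (m - 1) * Real.sin (ψ τ)) * e2
        + (1 - deriv ψ τ) * hj
    field_simp
    linarith
  rw [← hs, ← hp]
  exact ⟨hσd.hasDerivAt, hψd.hasDerivAt⟩

/-- A path that avoids the origin has continuous coordinates. -/
theorem exists_coordinates (hm : 0 < m) {γ : ℝ → ℝ × ℝ} (hγ : Continuous γ) (h0 : ∀ τ, γ τ ≠ 0) :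
    ∃ σ ψ : ℝ → ℝ, Continuous σ ∧ Continuous ψ ∧ (∀ τ, 0 < σ τ) ∧ ∀ τ, γ τ = flow m (σ τ) (ψ τ) := by
  have hpos : ∀ τ, 0 < (γ τ).1 ^ 2 + (γ τ).2 ^ 2 := by
    intro τ
    by_contra hle
    push Not at hle
    apply h0 τ
    have h1 : (γ τ).1 = 0 := by nlinarith [sq_nonneg (γ τ).1, sq_nonneg (γ τ).2]
    have h2 : (γ τ).2 = 0 := by nlinarith [sq_nonneg (γ τ).1, sq_nonneg (γ τ).2]
    exact Prod.ext h1 h2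
  set σ : ℝ → ℝ := fun τ => sqRadiusInv m ((γ τ).1 ^ 2 + (γ τ).2 ^ 2) with hσ
  have hσpos : ∀ τ, 0 < σ τ := fun τ => sqRadiusInv_pos hm (hpos τ)
  have hσR : ∀ τ, sqRadius m (σ τ) = (γ τ).1 ^ 2 + (γ τ).2 ^ 2 :=
    fun τ => sqRadius_sqRadiusInv hm (hpos τ)
  have hσc : Continuous σ := by
    rw [continuous_iff_continuousAt]
    intro τ
    have h1 : ContinuousAt (fun τ => (γ τ).1 ^ 2 + (γ τ).2 ^ 2) τ := by fun_prop
    exact ContinuousAt.comp' (continuousAt_sqRadiusInv hm (hpos τ)) h1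
  set z : ℝ → ℂ := fun τ => ⟨(γ τ).1, (γ τ).2⟩ with hz
  set b : ℝ → ℂ := fun τ => ⟨σ τ, σ τ ^ m⟩ with hb
  have hnz : ∀ τ, Complex.normSq (z τ) = sqRadius m (σ τ) := by
    intro τ; rw [hσR, Complex.normSq_mk]; ring
  have hnb : ∀ τ, Complex.normSq (b τ) = sqRadius m (σ τ) := by
    intro τ; rw [Complex.normSq_mk, sqRadius]; ring
  have hbne : ∀ τ, b τ ≠ 0 := fun τ => by
    rw [← Complex.normSq_pos, hnb]; exact sqRadius_pos m (hσpos τ)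
  have hzc : Continuous z := by
    have : z = fun τ => ((γ τ).1 : ℂ) + (γ τ).2 * Complex.I := by
      ext τ; simp [hz, Complex.mk_eq_add_mul_I]
    rw [this]; fun_prop
  have hbc : Continuous b := by
    have : b = fun τ => ((σ τ : ℝ) : ℂ) + ((σ τ ^ m : ℝ) : ℂ) * Complex.I := by
      ext τ; simp only [hb, Complex.mk_eq_add_mul_I]
    rw [this]; fun_prop
  have hnorm : ∀ τ, ‖z τ / b τ‖ = 1 := by
    intro τ
    have h1 : Complex.normSq (z τ / b τ) = 1 := by
      rw [Complex.normSq_div, hnz, hnb, div_self (sqRadius_pos m (hσpos τ)).ne']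
    rw [Complex.normSq_eq_norm_sq] at h1
    exact (pow_eq_one_iff_of_nonneg (norm_nonneg _) two_ne_zero).1 h1
  have hκc : Continuous fun τ => z τ / b τ := hzc.div hbc hbne
  -- The quotient of the point by its base point on the branch is a path in the unit circle and
  -- lifts to a continuous angle. `flow` turns clockwise, hence the minus sign in the final choice.
  set κ : C(ℝ, Circle) := ⟨fun τ => ⟨z τ / b τ, mem_sphere_zero_iff_norm.2 (hnorm τ)⟩,
    Continuous.subtype_mk hκc _⟩ with hκ
  obtain ⟨e₀, he₀⟩ := Circle.exp_surjective (κ 0)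
  obtain ⟨F, ⟨-, hF⟩, -⟩ := Circle.isCoveringMap_exp.existsUnique_continuousMap_lifts κ 0 e₀ he₀
  refine ⟨σ, fun τ => -F τ, hσc, F.continuous.neg, hσpos, fun τ => ?_⟩
  have h1 : Complex.exp (F τ * Complex.I) = z τ / b τ := by
    have h2 : (Circle.exp (F τ) : ℂ) = z τ / b τ :=
      congrArg (fun c : Circle => (c : ℂ)) (congrFun hF τ)
    rwa [Circle.coe_exp] at h2
  rw [eq_div_iff (hbne τ)] at h1
  have hre := congrArg Complex.re h1
  have him := congrArg Complex.im h1
  rw [Complex.mul_re, Complex.exp_ofReal_mul_I_re, Complex.exp_ofReal_mul_I_im] at hre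
  rw [Complex.mul_im, Complex.exp_ofReal_mul_I_re, Complex.exp_ofReal_mul_I_im] at him
  simp only [hz, hb] at hre him
  apply Prod.ext
  · simp only [flow, Real.cos_neg, Real.sin_neg]; linarith
  · simp only [flow, Real.cos_neg, Real.sin_neg]; linarith

end PiecewiseCenter

namespace PiecewiseCenter

/-! ### Solutions in the new coordinates -/

/-- Otherwise a value `y` strictly between `g b` and `g a` exists that is not attained on the
countable set `S`. At the last time where `g ≥ y` equality holds, so the derivative exists there and
is positive, contradicting `g < y` afterwards. -/
theorem le_of_deriv_pos_off_countable {g : ℝ → ℝ} {a b : ℝ} (hab : a ≤ b)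
    (hg : ContinuousOn g (Set.Icc a b)) {S : Set ℝ} (hS : S.Countable)
    (h : ∀ t ∈ Set.Ioo a b \ S, ∃ g', 0 < g' ∧ HasDerivAt g g' t) : g a ≤ g b := by
  by_contra hlt
  push Not at hlt
  obtain ⟨y, hyS, hyI⟩ := ((hS.image g).dense_compl ℝ).exists_mem_open isOpen_Ioo
    (Set.nonempty_Ioo.2 hlt)
  set A := {t ∈ Set.Icc a b | y ≤ g t} with hA
  have hAc : IsCompact A := by
    have : A = Set.Icc a b ∩ g ⁻¹' Set.Ici y := rfl
    rw [this]
    exact isCompact_Icc.of_isClosed_subset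
      (hg.preimage_isClosed_of_isClosed isClosed_Icc isClosed_Ici) Set.inter_subset_left
  have hAne : A.Nonempty := ⟨a, ⟨le_rfl, hab⟩, hyI.2.le⟩
  obtain ⟨ht, hyt⟩ := hAc.sSup_mem hAne
  set t := sSup A with htdef
  have hafter : ∀ x ∈ Set.Icc a b, t < x → g x < y := by
    intro x hx htx
    by_contra hc
    exact absurd (le_csSup hAc.bddAbove ⟨hx, not_lt.1 hc⟩) (not_le.2 htx)
  have htb : t < b := by
    refine lt_of_le_of_ne ht.2 fun h => ?_
    rw [h] at hyt
    exact absurd hyt (not_le.2 hyI.1)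
  have hgt : g t = y := by
    refine le_antisymm ?_ hyt
    have h1 : Tendsto g (𝓝[>] t) (𝓝 (g t)) := by
      have h2 : ContinuousWithinAt g (Set.Icc a b) t := hg t ht
      exact h2.mono_left (nhdsWithin_le_of_mem (mem_of_superset (Ioo_mem_nhdsGT htb)
        fun x hx => ⟨ht.1.trans hx.1.le, hx.2.le⟩))
    refine le_of_tendsto h1 ?_
    filter_upwards [Ioo_mem_nhdsGT htb] with x hx
    exact (hafter x ⟨ht.1.trans hx.1.le, hx.2.le⟩ hx.1).le
  have hta : a < t := by
    refine lt_of_le_of_ne ht.1 fun h => ?_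
    rw [← h] at hgt
    exact hyI.2.ne' hgt
  obtain ⟨g', hg', hd⟩ := h t ⟨⟨hta, htb⟩, fun hS' => hyS ⟨t, hS', hgt⟩⟩
  have h3 : Tendsto (slope g t) (𝓝[>] t) (𝓝 g') :=
    (hasDerivAt_iff_tendsto_slope.1 hd).mono_left (nhdsWithin_mono t fun x hx => ne_of_gt hx)
  obtain ⟨x, hx1, hx2⟩ := ((h3.eventually (lt_mem_nhds hg')).and (Ioo_mem_nhdsGT htb)).exists
  rw [slope_def_field, div_pos_iff_of_pos_right (sub_pos.2 hx2.1)] at hx1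
  have := hafter x ⟨ht.1.trans hx2.1.le, hx2.2.le⟩ hx2.1
  linarith

theorem le_of_deriv_nonneg_off_countable {f : ℝ → ℝ} {a b : ℝ} (hab : a ≤ b)
    (hf : ContinuousOn f (Set.Icc a b)) {S : Set ℝ} (hS : S.Countable)
    (h : ∀ t ∈ Set.Ioo a b \ S, ∃ f', 0 ≤ f' ∧ HasDerivAt f f' t) : f a ≤ f b := by
  refine le_of_forall_pos_le_add fun e he => ?_
  -- A small slope makes the derivative strictly positive; the `+ 1` covers the case `a = b`.
  have hδ : 0 < e / (b - a + 1) := div_pos he (by linarith)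
  have h1 := le_of_deriv_pos_off_countable (g := fun t => f t + e / (b - a + 1) * t) hab
    (hf.add (by fun_prop)) hS (fun t ht => by
      obtain ⟨f', hf', hd⟩ := h t ht
      exact ⟨f' + e / (b - a + 1) * 1, by linarith, hd.add ((hasDerivAt_id t).const_mul _)⟩)
  have h2 : e / (b - a + 1) * (b - a) ≤ e := by
    rw [div_mul_eq_mul_div, div_le_iff₀ (by linarith)]
    nlinarith
  linarith

theorem countable_sin_eq_zero : {t : ℝ | Real.sin t = 0}.Countable := by
  refine (Set.countable_range fun j : ℤ => (j : ℝ) * Real.pi).mono fun t ht => ?_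
  obtain ⟨j, hj⟩ := Real.sin_eq_zero_iff.1 ht
  exact ⟨j, hj⟩

/-- The speed of the angle `t` along solutions. -/
noncomputable def angularSpeed (m : ℕ) {n : ℕ} (P : Perturbation n) (ε t s : ℝ) : ℝ :=
  1 + ε * angular m (pAt P t) (qAt P t) t s / jac m s

/-- The speed of the parameter `s` along solutions. -/
noncomputable def radialSpeed (m : ℕ) {n : ℕ} (P : Perturbation n) (ε t s : ℝ) : ℝ :=
  ε * radial m (pAt P t) (qAt P t) t s / jac m s

/-- `(σ, ψ)` is a solution on `[a, b]` of the system in the coordinates `flow m s t`. -/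
structure IsCoordSolution (m : ℕ) {n : ℕ} (P : Perturbation n) (ε : ℝ) (σ ψ : ℝ → ℝ) (a b : ℝ) :
    Prop where
  cont_radius : ContinuousOn σ (Set.Icc a b)
  cont_angle : ContinuousOn ψ (Set.Icc a b)
  deriv : ∃ S : Set ℝ, S.Countable ∧ ∀ τ ∈ Set.Ioo a b \ S,
    HasDerivAt σ (radialSpeed m P ε (ψ τ) (σ τ)) τ ∧ HasDerivAt ψ (angularSpeed m P ε (ψ τ) (σ τ)) τ

variable {m n : ℕ} {P : Perturbation n} {ε : ℝ}

theorem IsCoordSolution.mono {σ ψ : ℝ → ℝ} {a b a' b' : ℝ} (h : IsCoordSolution m P ε σ ψ a b)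
    (ha : a ≤ a') (hb : b' ≤ b) : IsCoordSolution m P ε σ ψ a' b' := by
  obtain ⟨S, hS, hd⟩ := h.deriv
  exact ⟨h.cont_radius.mono (Set.Icc_subset_Icc ha hb), h.cont_angle.mono (Set.Icc_subset_Icc ha hb),
    S, hS, fun τ hτ => hd τ ⟨Set.Ioo_subset_Ioo ha hb hτ.1, hτ.2⟩⟩

theorem angularSpeed_add_int_mul (t s : ℝ) (j : ℤ) :
    angularSpeed m P ε (t + j * (2 * Real.pi)) s = angularSpeed m P ε t s := by
  simp only [angularSpeed, angular, pAt, qAt, flow_add_two_pi_mul, Real.sin_add_int_mul_two_pi,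
    Real.cos_add_int_mul_two_pi]

theorem radialSpeed_add_int_mul (t s : ℝ) (j : ℤ) :
    radialSpeed m P ε (t + j * (2 * Real.pi)) s = radialSpeed m P ε t s := by
  simp only [radialSpeed, radial, pAt, qAt, flow_add_two_pi_mul, Real.sin_add_int_mul_two_pi]

theorem slopeField_add_int_mul (t s : ℝ) (j : ℤ) :
    slopeField m P ε (t + j * (2 * Real.pi)) s = slopeField m P ε t s := by
  simp only [slopeField, radial, angular, pAt, qAt, flow_add_two_pi_mul,
    Real.sin_add_int_mul_two_pi, Real.cos_add_int_mul_two_pi]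

theorem IsCoordSolution.shift {σ ψ : ℝ → ℝ} {a b : ℝ} (h : IsCoordSolution m P ε σ ψ a b)
    (j : ℤ) : IsCoordSolution m P ε σ (fun τ => ψ τ + j * (2 * Real.pi)) a b := by
  obtain ⟨S, hS, hd⟩ := h.deriv
  refine ⟨h.cont_radius, h.cont_angle.add continuousOn_const, S, hS, fun τ hτ => ?_⟩
  simp only [angularSpeed_add_int_mul, radialSpeed_add_int_mul]
  exact ⟨(hd τ hτ).1, (hd τ hτ).2.add_const _⟩

/-- A solution of the original system gives a solution in coordinates. -/
theorem isCoordSolution_of_solution {k : ℕ} (hm : m = 2 * k + 1) {γ : ℝ → ℝ × ℝ} {I : Set ℝ}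
    (hγ : IsSolutionOn m P ε γ I) {σ ψ : ℝ → ℝ} {a b : ℝ} (hI : Set.Icc a b ⊆ I)
    (hσ : Continuous σ) (hψ : Continuous ψ) (hpos : ∀ τ, 0 < σ τ)
    (heq : ∀ τ ∈ Set.Icc a b, γ τ = flow m (σ τ) (ψ τ)) : IsCoordSolution m P ε σ ψ a b := by
  obtain ⟨-, S, hS, hd⟩ := hγ
  refine ⟨hσ.continuousOn, hψ.continuousOn, S, hS, fun τ hτ => ?_⟩
  have hint : τ ∈ interior I := interior_mono hI (by rw [interior_Icc]; exact hτ.1)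
  have h1 := hd τ ⟨hint, hτ.2⟩
  have hev : (fun τ => flow m (σ τ) (ψ τ)) =ᶠ[𝓝 τ] γ := by
    filter_upwards [Icc_mem_nhds hτ.1.1 hτ.1.2] with x hx using (heq x hx).symm
  have h2 := h1.congr_of_eventuallyEq hev
  rw [heq τ ⟨hτ.1.1.le, hτ.1.2.le⟩, field_flow P hm ε (hpos τ)] at h2
  exact hasDerivAt_coordinates (by omega) hσ.continuousAt hψ.continuousAt (hpos τ) h2

section Tracking

variable {c d ρ ε₀ C Λ : ℝ} {v : ℝ → ℝ → ℝ → ℝ}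

theorem IsReturnFamily.angularSpeed_mem (R : IsReturnFamily m P c d ρ ε₀ C Λ v) (hε : |ε| < ε₀)
    (t : ℝ) {x : ℝ} (hx : x ∈ Set.Icc (c - 2 * ρ) (d + 2 * ρ)) :
    1 / 2 ≤ angularSpeed m P ε t x ∧ angularSpeed m P ε t x ≤ 3 / 2 := by
  have hJ : 0 < jac m x := jac_pos m (by linarith [R.lower_pos, hx.1])
  have h1 := abs_le.1 (R.angular_le ε hε t x hx)
  unfold angularSpeed
  have h2 : -(1 / 2) ≤ ε * angular m (pAt P t) (qAt P t) t x / jac m x := by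
    rw [le_div_iff₀ hJ]; linarith
  have h3 : ε * angular m (pAt P t) (qAt P t) t x / jac m x ≤ 1 / 2 := by
    rw [div_le_iff₀ hJ]; linarith
  constructor <;> linarith

theorem IsReturnFamily.slopeField_mul (R : IsReturnFamily m P c d ρ ε₀ C Λ v) (hε : |ε| < ε₀)
    (t : ℝ) {x : ℝ} (hx : x ∈ Set.Icc (c - 2 * ρ) (d + 2 * ρ)) :
    slopeField m P ε t x * angularSpeed m P ε t x = radialSpeed m P ε t x := by
  have hJ : 0 < jac m x := jac_pos m (by linarith [R.lower_pos, hx.1])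
  have h1 := abs_le.1 (R.angular_le ε hε t x hx)
  have h2 : jac m x + ε * angular m (pAt P t) (qAt P t) t x ≠ 0 := by linarith
  unfold slopeField angularSpeed radialSpeed
  field_simp

theorem IsReturnFamily.v_mem (R : IsReturnFamily m P c d ρ ε₀ C Λ v) (hε : |ε| < ε₀) {s : ℝ}
    (hs : s ∈ Set.Icc (c - ρ) (d + ρ)) (t : ℝ) :
    v ε t s ∈ Set.Ioo (c - 2 * ρ) (d + 2 * ρ) := by
  have h1 := abs_le.1 ((R.near ε hε s hs t).trans (R.near' ε hε))
  have := R.ρ_pos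
  constructor <;> linarith [hs.1, hs.2]

/-- The angular speed stays above `1 / 2` in the annulus: a solution that remains there must keep
turning. -/
theorem IsReturnFamily.half_sub_le (R : IsReturnFamily m P c d ρ ε₀ C Λ v) (hε : |ε| < ε₀)
    {σ ψ : ℝ → ℝ} {a b : ℝ} (h : IsCoordSolution m P ε σ ψ a b)
    (hσ : ∀ τ ∈ Set.Icc a b, σ τ ∈ Set.Icc (c - 2 * ρ) (d + 2 * ρ)) {τ₁ τ₂ : ℝ}
    (h₁ : τ₁ ∈ Set.Icc a b) (h₂ : τ₂ ∈ Set.Icc a b) (hle : τ₁ ≤ τ₂) :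
    (τ₂ - τ₁) / 2 ≤ ψ τ₂ - ψ τ₁ := by
  obtain ⟨S, hS, hd⟩ := h.deriv
  have hsub : Set.Icc τ₁ τ₂ ⊆ Set.Icc a b := Set.Icc_subset_Icc h₁.1 h₂.2
  have := le_of_deriv_nonneg_off_countable (f := fun τ => ψ τ - 1 / 2 * τ) hle
    ((h.cont_angle.mono hsub).sub (by fun_prop)) hS (fun τ hτ => by
      have hτ' : τ ∈ Set.Ioo a b := Set.Ioo_subset_Ioo h₁.1 h₂.2 hτ.1
      refine ⟨_, ?_, ((hd τ ⟨hτ', hτ.2⟩).2).sub ((hasDerivAt_id τ).const_mul (1 / 2))⟩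
      have := (R.angularSpeed_mem hε (ψ τ) (hσ τ ⟨hτ'.1.le, hτ'.2.le⟩)).1
      linarith)
  linarith

/-- Uniqueness: the orbit of a solution that starts on the switching curve is given by `v`. -/
theorem IsReturnFamily.eq_v (R : IsReturnFamily m P c d ρ ε₀ C Λ v) (hε : |ε| < ε₀)
    {σ ψ : ℝ → ℝ} {a b : ℝ} (h : IsCoordSolution m P ε σ ψ a b)
    (hσ : ∀ τ ∈ Set.Icc a b, σ τ ∈ Set.Icc (c - 2 * ρ) (d + 2 * ρ))
    (ha : ψ a = 0) (hb : ψ b ≤ 2 * Real.pi) (hs : σ a ∈ Set.Icc (c - ρ) (d + ρ)) :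
    ∀ τ ∈ Set.Icc a b, σ τ = v ε (ψ τ) (σ a) := by
  intro τ₁ hτ₁
  obtain ⟨S, hS, hd⟩ := h.deriv
  have hmono : ∀ x ∈ Set.Icc a b, ∀ y ∈ Set.Icc a b, x < y → ψ x < ψ y := by
    intro x hx y hy hxy
    have := R.half_sub_le hε h hσ hx hy hxy.le
    linarith
  have haI : a ∈ Set.Icc a b := ⟨le_rfl, hτ₁.1.trans hτ₁.2⟩
  have hbI : b ∈ Set.Icc a b := ⟨hτ₁.1.trans hτ₁.2, le_rfl⟩
  -- The crossing times join the exceptional set; they are countable because `ψ` is strictly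
  -- increasing.
  set S' := S ∪ {τ ∈ Set.Icc a b | Real.sin (ψ τ) = 0} with hS'
  have hS'c : S'.Countable := by
    refine hS.union ?_
    refine Set.MapsTo.countable_of_injOn (f := ψ) (t := {t : ℝ | Real.sin t = 0})
      (fun τ hτ => hτ.2) ?_ countable_sin_eq_zero
    intro x hx y hy hxy
    by_contra hne
    rcases lt_or_gt_of_ne hne with hlt | hlt
    · exact (hmono x hx.1 y hy.1 hlt).ne hxy
    · exact (hmono y hy.1 x hx.1 hlt).ne hxy.symm
  set w : ℝ → ℝ := fun τ => σ τ - v ε (ψ τ) (σ a) with hw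
  have hvc := R.continuous ε hε (σ a) hs
  have hwc : ContinuousOn w (Set.Icc a b) :=
    h.cont_radius.sub (hvc.comp_continuousOn h.cont_angle)
  set L := 3 / 2 * Λ with hL
  -- Gronwall: `exp (-2 L τ) * w ^ 2` does not increase and starts at zero. The constant `L` is the
  -- Lipschitz constant in `s` times the maximal angular speed `3 / 2`.
  have key := le_of_deriv_nonneg_off_countable (f := fun τ => -(Real.exp (-(2 * L) * τ) * w τ ^ 2))
    (a := a) (b := τ₁) hτ₁.1 ?_ hS'c ?_
  · have hw0 : w a = 0 := by simp only [hw]; rw [ha, R.init ε hε (σ a) hs, sub_self]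
    simp only [hw0] at key
    have h1 : Real.exp (-(2 * L) * τ₁) * w τ₁ ^ 2 ≤ 0 := by linarith
    have h2 : w τ₁ ^ 2 ≤ 0 := by
      by_contra hc
      push Not at hc
      have := mul_pos (Real.exp_pos (-(2 * L) * τ₁)) hc
      linarith
    have h3 : w τ₁ = 0 := by
      have := le_antisymm h2 (sq_nonneg _)
      exact pow_eq_zero_iff two_ne_zero |>.1 this
    simp only [hw] at h3
    linarith
  · have hsub : Set.Icc a τ₁ ⊆ Set.Icc a b := Set.Icc_subset_Icc le_rfl hτ₁.2
    exact (ContinuousOn.mul (by fun_prop) ((hwc.mono hsub).pow 2)).neg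
  · intro τ hτ
    have hτI : τ ∈ Set.Icc a b := ⟨hτ.1.1.le, hτ.1.2.le.trans hτ₁.2⟩
    have hτS : τ ∉ S := fun hx => hτ.2 (Or.inl hx)
    have hsin : Real.sin (ψ τ) ≠ 0 := fun hx => hτ.2 (Or.inr ⟨hτI, hx⟩)
    have hτo : τ ∈ Set.Ioo a b := ⟨hτ.1.1, hτ.1.2.trans_le hτ₁.2⟩
    have hψI : ψ τ ∈ Set.Ioo 0 (2 * Real.pi) :=
      ⟨by rw [← ha]; exact hmono a haI τ hτI hτo.1, (hmono τ hτI b hbI hτo.2).trans_le hb⟩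
    obtain ⟨hd1, hd2⟩ := hd τ ⟨hτo, hτS⟩
    have hv := R.deriv ε hε (σ a) hs (ψ τ) hψI hsin
    have hvm := R.v_mem hε hs (ψ τ)
    have hvm' : v ε (ψ τ) (σ a) ∈ Set.Icc (c - 2 * ρ) (d + 2 * ρ) := ⟨hvm.1.le, hvm.2.le⟩
    have hw' := hd1.sub (HasDerivAt.comp τ hv hd2)
    rw [← R.slopeField_mul hε (ψ τ) (hσ τ hτI), ← sub_mul] at hw'
    have hsp := R.angularSpeed_mem hε (ψ τ) (hσ τ hτI)
    have hlip := R.lipschitz ε hε (ψ τ) _ (hσ τ hτI) _ hvm'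
    set w' := (slopeField m P ε (ψ τ) (σ τ) - slopeField m P ε (ψ τ) (v ε (ψ τ) (σ a))) *
      angularSpeed m P ε (ψ τ) (σ τ) with hw'def
    have hww : HasDerivAt w w' τ := hw'
    have hbound : |w'| ≤ L * |w τ| := by
      rw [hw'def, abs_mul]
      have e1 : |angularSpeed m P ε (ψ τ) (σ τ)| ≤ 3 / 2 := by
        rw [abs_of_nonneg (by linarith [hsp.1])]; exact hsp.2
      calc _ ≤ (Λ * |w τ|) * (3 / 2) := by
            apply mul_le_mul hlip e1 (abs_nonneg _)
            exact (abs_nonneg _).trans hlip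
        _ = _ := by rw [hL]; ring
    have hexp : HasDerivAt (fun τ => Real.exp (-(2 * L) * τ))
        (Real.exp (-(2 * L) * τ) * (-(2 * L) * 1)) τ :=
      ((hasDerivAt_id τ).const_mul _).exp
    refine ⟨_, ?_, (hexp.mul (hww.pow 2)).neg⟩
    have e2 : w τ * w' ≤ L * w τ ^ 2 := by
      calc w τ * w' ≤ |w τ * w'| := le_abs_self _
        _ = |w τ| * |w'| := abs_mul _ _
        _ ≤ |w τ| * (L * |w τ|) := by gcongr
        _ = L * (|w τ| * |w τ|) := by ring
        _ = L * w τ ^ 2 := by rw [abs_mul_abs_self]; ring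
    have e3 := Real.exp_pos (-(2 * L) * τ)
    have e4 : 0 ≤ Real.exp (-(2 * L) * τ) * (2 * (L * w τ ^ 2 - w τ * w')) := by
      apply mul_nonneg e3.le; linarith
    simp only [Pi.pow_apply]
    push_cast
    calc 0 ≤ _ := e4
      _ = _ := by ring

end Tracking

end PiecewiseCenter

namespace PiecewiseCenter

/-! ### The return map -/

variable {m n : ℕ} {P : Perturbation n} {ε : ℝ}

theorem continuous_ev (p : MvPolynomial (Fin 2) ℝ) : Continuous (ev p) := by
  unfold ev
  refine (MvPolynomial.continuous_eval _).comp (continuous_pi fun i => ?_)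
  fin_cases i
  · exact continuous_fst
  · exact continuous_snd

theorem continuous_flow : Continuous fun w : ℝ × ℝ => flow m w.2 w.1 := by
  unfold flow; fun_prop

theorem continuous_angular (p q : MvPolynomial (Fin 2) ℝ) :
    Continuous fun w : ℝ × ℝ => angular m p q w.1 w.2 := by
  have hp := (continuous_ev p).comp (continuous_flow (m := m))
  have hq := (continuous_ev q).comp (continuous_flow (m := m))
  exact (Continuous.mul (by fun_prop) hp).sub (Continuous.mul (by fun_prop) hq)

theorem continuous_jac : Continuous (jac m) := by unfold jac; fun_prop

theorem measurable_angularSpeed {w : ℝ → ℝ} (hw : Continuous w) :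
    Measurable fun t => angularSpeed m P ε t (w t) := by
  classical
  have hA : Measurable fun t => angular m (pAt P t) (qAt P t) t (w t) := by
    have h1 : Measurable fun t => angular m P.pMinus P.qMinus t (w t) :=
      ((continuous_angular P.pMinus P.qMinus).comp (continuous_id.prodMk hw)).measurable
    have h2 : Measurable fun t => angular m P.pPlus P.qPlus t (w t) :=
      ((continuous_angular P.pPlus P.qPlus).comp (continuous_id.prodMk hw)).measurable
    have h3 : Measurable fun t => if 0 < Real.sin t then angular m P.pMinus P.qMinus t (w t)
        else angular m P.pPlus P.qPlus t (w t) :=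
      Measurable.ite (measurableSet_lt measurable_const Real.measurable_sin) h1 h2
    convert h3 using 2 with t
    unfold pAt qAt
    split_ifs <;> rfl
  unfold angularSpeed
  exact measurable_const.add ((hA.const_mul ε).div (continuous_jac.comp hw).measurable)

theorem continuousAt_angularSpeed {w : ℝ → ℝ} (hw : Continuous w) {t : ℝ} (hpos : 0 < w t)
    (ht : Real.sin t ≠ 0) : ContinuousAt (fun t => angularSpeed m P ε t (w t)) t := by
  have hA : Continuous fun τ => angular m (pAt P t) (qAt P t) τ (w τ) := by
    generalize pAt P t = p
    generalize qAt P t = q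
    have h := (continuous_angular (m := m) p q).comp (continuous_id.prodMk hw)
    simpa only [Function.comp_def, id_eq] using h
  have hJ : Continuous fun τ => jac m (w τ) := continuous_jac.comp hw
  have h1 : ContinuousAt (fun τ => 1 + ε * angular m (pAt P t) (qAt P t) τ (w τ) / jac m (w τ)) t :=
    (ContinuousAt.div (continuousAt_const.mul hA.continuousAt) hJ.continuousAt
      (jac_pos m hpos).ne').const_add 1
  refine h1.congr ?_
  filter_upwards [eventually_pAt_eq P ht] with τ hτ
  simp only [angularSpeed, hτ.1, hτ.2]

variable {c d ρ ε₀ C Λ : ℝ} {v : ℝ → ℝ → ℝ → ℝ}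

theorem IsReturnFamily.inv_angularSpeed_mem (R : IsReturnFamily m P c d ρ ε₀ C Λ v)
    (hε : |ε| < ε₀) (t : ℝ) {x : ℝ} (hx : x ∈ Set.Icc (c - 2 * ρ) (d + 2 * ρ)) :
    2 / 3 ≤ (angularSpeed m P ε t x)⁻¹ ∧ (angularSpeed m P ε t x)⁻¹ ≤ 2 := by
  have hsp := R.angularSpeed_mem hε t hx
  have h0 : 0 < angularSpeed m P ε t x := by linarith [hsp.1]
  constructor
  · rw [le_inv_comm₀ (by norm_num) h0]; linarith [hsp.2]
  · rw [inv_le_comm₀ h0 (by norm_num)]; linarith [hsp.1]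

theorem IsReturnFamily.intervalIntegrable_inv_angularSpeed (R : IsReturnFamily m P c d ρ ε₀ C Λ v)
    (hε : |ε| < ε₀) {w : ℝ → ℝ} (hw : Continuous w)
    (hmem : ∀ t, w t ∈ Set.Icc (c - 2 * ρ) (d + 2 * ρ)) (a b : ℝ) :
    IntervalIntegrable (fun τ => (angularSpeed m P ε τ (w τ))⁻¹) volume a b := by
  have hmeas : Measurable fun τ => (angularSpeed m P ε τ (w τ))⁻¹ :=
    (measurable_angularSpeed hw).inv
  refine intervalIntegrable_of_bounded (B := 2) hmeas (fun τ => ?_) a b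
  have hbd := R.inv_angularSpeed_mem hε τ (hmem τ)
  rw [Real.norm_of_nonneg (by linarith [hbd.1])]
  exact hbd.2

/-- A curve `s = w t` with `dw/dt = slopeField` can be parametrized by the time. -/
theorem IsReturnFamily.exists_time {k : ℕ} (hm : m = 2 * k + 1)
    (R : IsReturnFamily m P c d ρ ε₀ C Λ v) (hε : |ε| < ε₀)
    {w : ℝ → ℝ} (hw : Continuous w) (hmem : ∀ t, w t ∈ Set.Icc (c - 2 * ρ) (d + 2 * ρ)) :
    ∃ θ : ℝ ≃o ℝ, (∀ t, θ t = ∫ τ in 0..t, (angularSpeed m P ε τ (w τ))⁻¹) ∧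
      ∀ t, Real.sin t ≠ 0 → HasDerivAt w (slopeField m P ε t (w t)) t →
        HasDerivAt (fun τ => flow m (w (θ.symm τ)) (θ.symm τ))
          (field m P ε (flow m (w t) t)) (θ t) := by
  have hpos : ∀ t, 0 < w t := fun t => by linarith [R.lower_pos, (hmem t).1]
  have hsp := fun t => R.angularSpeed_mem hε t (hmem t)
  have hmeas : Measurable fun τ => (angularSpeed m P ε τ (w τ))⁻¹ :=
    (measurable_angularSpeed hw).inv
  have hbd := fun τ => R.inv_angularSpeed_mem hε τ (hmem τ)
  have hint := R.intervalIntegrable_inv_angularSpeed hε hw hmem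
  -- Time as a function of the angle. The integrand is at least `2 / 3`, so `θ₀` is an increasing
  -- bijection of the line.
  set θ₀ : ℝ → ℝ := fun t => ∫ τ in 0..t, (angularSpeed m P ε τ (w τ))⁻¹ with hθ₀
  have hdiff : ∀ a b, a ≤ b → 2 / 3 * (b - a) ≤ θ₀ b - θ₀ a := by
    intro a b hab
    simp only [hθ₀]
    rw [intervalIntegral.integral_interval_sub_left (hint _ _) (hint _ _)]
    have := intervalIntegral.integral_mono_on hab (intervalIntegrable_const (c := (2 / 3 : ℝ)))
      (hint a b) fun τ _ => (hbd τ).1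
    rw [intervalIntegral.integral_const, smul_eq_mul] at this
    linarith
  have hmono : StrictMono θ₀ := fun a b hab => by
    have := hdiff a b hab.le
    linarith
  have hcont : Continuous θ₀ := intervalIntegral.continuous_primitive hint 0
  have h00 : θ₀ 0 = 0 := by simp [hθ₀]
  have hsurj : Function.Surjective θ₀ := by
    refine hcont.surjective ?_ ?_
    · refine tendsto_atTop_mono' atTop (f₁ := fun t => 2 / 3 * t) ?_
        ((tendsto_id (α := ℝ)).const_mul_atTop (by norm_num : (0 : ℝ) < 2 / 3))
      filter_upwards [eventually_ge_atTop 0] with t ht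
      have := hdiff 0 t ht
      linarith
    · refine tendsto_atBot_mono' atBot (f₁ := fun t => 2 / 3 * t) (f₂ := θ₀) ?_
        ((tendsto_id (α := ℝ)).const_mul_atBot (by norm_num : (0 : ℝ) < 2 / 3))
      filter_upwards [eventually_le_atBot 0] with t ht
      have := hdiff t 0 ht
      linarith
  set θ : ℝ ≃o ℝ := StrictMono.orderIsoOfSurjective θ₀ hmono hsurj with hθ
  have hθeq : ∀ t, θ t = θ₀ t := fun t => rfl
  refine ⟨θ, hθeq, fun t ht hd => ?_⟩
  have hθ' : HasDerivAt θ (angularSpeed m P ε t (w t))⁻¹ t := by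
    have h1 := intervalIntegral.integral_hasDerivAt_right (hint 0 t)
      hmeas.stronglyMeasurable.stronglyMeasurableAtFilter
      ((continuousAt_angularSpeed (P := P) (ε := ε) hw (hpos t) ht).inv₀
        (by linarith [(hsp t).1]))
    exact h1
  have hinv : HasDerivAt θ.symm (angularSpeed m P ε t (w t)) (θ t) := by
    have h1 := HasDerivAt.of_local_left_inverse (f := θ) (g := θ.symm) (a := θ t)
      (f' := (angularSpeed m P ε t (w t))⁻¹) θ.symm.continuous.continuousAt
      (by rw [OrderIso.symm_apply_apply]; exact hθ')
      (by linarith [(hbd t).1]) (Eventually.of_forall fun y => θ.apply_symm_apply y)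
    rwa [inv_inv] at h1
  have hw' : HasDerivAt (fun τ => w (θ.symm τ))
      (slopeField m P ε t (w t) * angularSpeed m P ε t (w t)) (θ t) := by
    refine HasDerivAt.comp (θ t) ?_ hinv
    rw [OrderIso.symm_apply_apply]
    exact hd
  have hfl := hasDerivAt_flow_comp (m := m) hw' hinv
  simp only [OrderIso.symm_apply_apply] at hfl
  rw [field_flow P hm ε (hpos t)]
  refine hfl.congr_deriv ?_
  have hJ := (jac_pos m (hpos t)).ne'
  have hj := jac_eq (m := m) (by omega) (w t) t
  -- The transformed equations multiplied by the Jacobian; combining them with `hj` recovers the two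
  -- components of the original field.
  have e1 : jac m (w t) * (slopeField m P ε t (w t) * angularSpeed m P ε t (w t)) =
      ε * radial m (pAt P t) (qAt P t) t (w t) := by
    rw [R.slopeField_mul hε t (hmem t), radialSpeed, mul_div_cancel₀ _ hJ]
  have e2 : jac m (w t) * angularSpeed m P ε t (w t) =
      jac m (w t) + ε * angular m (pAt P t) (qAt P t) t (w t) := by
    rw [angularSpeed, mul_add, mul_one, mul_div_cancel₀ _ hJ]
  unfold radial at e1
  unfold angular at e2
  ext
  · apply mul_left_cancel₀ hJ
    simp only
    linear_combination (Real.cos t + m * w t ^ (m - 1) * Real.sin t) * e1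
      + (flow m (w t) t).2 * e2 + ε * ev (pAt P t) (flow m (w t) t) * hj
  · apply mul_left_cancel₀ hJ
    simp only
    linear_combination (-Real.sin t + m * w t ^ (m - 1) * Real.cos t) * e1
      - (flow m (w t) t).1 * e2 + ε * ev (qAt P t) (flow m (w t) t) * hj

theorem not_branch_of_mem_Ioo {s t : ℝ} (hs : 0 < s) (ht : t ∈ Set.Ioo 0 (2 * Real.pi)) :
    ¬ (0 < (flow m s t).1 ∧ (flow m s t).2 = (flow m s t).1 ^ m) := by
  rintro ⟨h1, h2⟩
  obtain ⟨-, j, hj⟩ := flow_eq_branch (m := m) (t := t) hs h1 (Prod.ext rfl h2)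
  have hπ := Real.two_pi_pos
  rw [hj] at ht
  have h3 : (0 : ℝ) < j := by
    by_contra hc
    push Not at hc
    exact absurd ht.1 (not_lt.2 (mul_nonpos_of_nonpos_of_nonneg hc hπ.le))
  have h4 : (j : ℝ) < 1 := by
    by_contra hc
    push Not at hc
    have := ht.2
    nlinarith
  have h5 : (0 : ℤ) < j := by exact_mod_cast h3
  have h6 : j < (1 : ℤ) := by exact_mod_cast h4
  omega

theorem IsReturnFamily.isFirstReturn {k : ℕ} (hm : m = 2 * k + 1)
    (R : IsReturnFamily m P c d ρ ε₀ C Λ v) (hε : |ε| < ε₀) {s : ℝ}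
    (hs : s ∈ Set.Icc (c - ρ) (d + ρ)) : IsFirstReturn m P ε s (v ε (2 * Real.pi) s) := by
  have hπ := Real.two_pi_pos
  have hρ := R.ρ_pos
  have hlow := R.lower_pos
  have hv := R.continuous ε hε s hs
  have hmem : ∀ t, v ε t s ∈ Set.Icc (c - 2 * ρ) (d + 2 * ρ) := fun t =>
    ⟨(R.v_mem hε hs t).1.le, (R.v_mem hε hs t).2.le⟩
  have hpos : ∀ t, 0 < v ε t s := fun t => by linarith [(hmem t).1]
  obtain ⟨θ, hθ, hd⟩ := R.exists_time hm hε hv hmem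
  have hθ0 : θ 0 = 0 := by rw [hθ]; simp
  have hθs0 : θ.symm 0 = 0 := by rw [OrderIso.symm_apply_eq, hθ0]
  have hT : 0 < θ (2 * Real.pi) := by rw [← hθ0]; exact θ.strictMono hπ
  have hin : ∀ τ ∈ Set.Ioo 0 (θ (2 * Real.pi)), θ.symm τ ∈ Set.Ioo 0 (2 * Real.pi) := by
    intro τ hτ
    constructor
    · rw [← hθs0]; exact θ.symm.strictMono hτ.1
    · rw [← θ.symm_apply_apply (2 * Real.pi)]; exact θ.symm.strictMono hτ.2
  refine ⟨by linarith [hs.1], hpos _, fun τ => flow m (v ε (θ.symm τ) s) (θ.symm τ),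
    θ (2 * Real.pi), hT, ⟨?_, θ '' {t | Real.sin t = 0}, countable_sin_eq_zero.image _, ?_⟩,
    ?_, ?_, ?_⟩
  · have : Continuous fun τ => flow m (v ε (θ.symm τ) s) (θ.symm τ) :=
      continuous_flow.comp (θ.symm.continuous.prodMk (hv.comp θ.symm.continuous))
    exact this.continuousOn
  · intro τ hτ
    rw [interior_Icc] at hτ
    have hsin : Real.sin (θ.symm τ) ≠ 0 := fun h =>
      hτ.2 ⟨θ.symm τ, h, θ.apply_symm_apply τ⟩
    have := hd (θ.symm τ) hsin (R.deriv ε hε s hs _ (hin τ hτ.1) hsin)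
    rwa [OrderIso.apply_symm_apply] at this
  · simp only [hθs0, flow_zero, R.init ε hε s hs]
  · simp only [OrderIso.symm_apply_apply, flow_two_pi]
  · intro τ hτ
    exact not_branch_of_mem_Ioo (hpos _) (hin τ hτ)

/-- `returnMap` is an arbitrary choice among first return points, so uniqueness is required for
every solution, including one that might a priori leave the region where the equation is controlled.
-/
theorem IsReturnFamily.eq_of_isFirstReturn {k : ℕ} (hm : m = 2 * k + 1)
    (R : IsReturnFamily m P c d ρ ε₀ C Λ v) (hε : |ε| < ε₀) {s x : ℝ}
    (hs : s ∈ Set.Icc (c - ρ) (d + ρ)) (h : IsFirstReturn m P ε s x) :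
    x = v ε (2 * Real.pi) s := by
  obtain ⟨hs0, hx0, γ, T, hT, hγ, hγ0, hγT, hfirst⟩ := h
  have hm0 : 0 < m := by omega
  have hπ := Real.two_pi_pos
  have hρ := R.ρ_pos
  have hlow := R.lower_pos
  have hcd := R.c_lt_d
  -- the time up to which the solution stays in the annulus
  set lo := c - 2 * ρ with hlo
  set hi := d + 2 * ρ with hhi
  set r2 : ℝ → ℝ := fun τ => (γ τ).1 ^ 2 + (γ τ).2 ^ 2 with hr2
  have hr2c : ContinuousOn r2 (Set.Icc 0 T) :=
    (hγ.1.fst.pow 2).add (hγ.1.snd.pow 2)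
  have hr20 : r2 0 = sqRadius m s := by
    simp only [hr2, hγ0, sqRadius]; ring
  have hmonoR := strictMonoOn_sqRadius m
  have hstart : r2 0 ∈ Set.Ioo (sqRadius m lo) (sqRadius m hi) := by
    rw [hr20]
    exact ⟨hmonoR (Set.mem_Ici.2 hlow.le) (Set.mem_Ici.2 hs0.le) (by linarith [hs.1]),
      hmonoR (Set.mem_Ici.2 hs0.le) (Set.mem_Ici.2 (by linarith)) (by linarith [hs.2])⟩
  obtain ⟨τs, hτs0, hτsT, hin, hexit⟩ : ∃ τs, 0 < τs ∧ τs ≤ T ∧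
      (∀ τ ∈ Set.Icc 0 τs, r2 τ ∈ Set.Icc (sqRadius m lo) (sqRadius m hi)) ∧
      (r2 τs ∈ Set.Ioo (sqRadius m lo) (sqRadius m hi) → τs = T) := by
    by_cases hall : ∀ τ ∈ Set.Icc 0 T, r2 τ ∈ Set.Ioo (sqRadius m lo) (sqRadius m hi)
    · exact ⟨T, hT, le_rfl, fun τ hτ => Set.Ioo_subset_Icc_self (hall τ hτ), fun _ => rfl⟩
    · push Not at hall
      obtain ⟨τ₀, hτ₀, hτ₀out⟩ := hall
      set E := Set.Icc 0 T ∩ r2 ⁻¹' (Set.Ioo (sqRadius m lo) (sqRadius m hi))ᶜ with hE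
      have hEc : IsCompact E := isCompact_Icc.of_isClosed_subset
        (hr2c.preimage_isClosed_of_isClosed isClosed_Icc isOpen_Ioo.isClosed_compl)
        Set.inter_subset_left
      have hEne : E.Nonempty := ⟨τ₀, hτ₀, hτ₀out⟩
      obtain ⟨hI, hout⟩ := hEc.sInf_mem hEne
      set τs := sInf E with hτs
      have hbefore : ∀ τ ∈ Set.Ico 0 τs, r2 τ ∈ Set.Ioo (sqRadius m lo) (sqRadius m hi) := by
        intro τ hτ
        by_contra hc
        exact absurd (csInf_le hEc.bddBelow ⟨⟨hτ.1, hτ.2.le.trans hI.2⟩, hc⟩) (not_le.2 hτ.2)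
      have hτs0 : 0 < τs := by
        refine lt_of_le_of_ne hI.1 fun h => ?_
        rw [← h] at hout
        exact hout hstart
      refine ⟨τs, hτs0, hI.2, fun τ hτ => ?_, fun h => absurd h hout⟩
      rcases eq_or_lt_of_le hτ.2 with rfl | hlt
      · have h1 : ContinuousWithinAt r2 (Set.Ico 0 τs) τs :=
          (hr2c τs hI).mono fun x hx => ⟨hx.1, hx.2.le.trans hI.2⟩
        have h2 : τs ∈ closure (Set.Ico 0 τs) := by
          rw [closure_Ico hτs0.ne]; exact ⟨hτs0.le, le_rfl⟩
        have h3 := h1.mem_closure h2 hbefore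
        rwa [closure_Ioo (hstart.1.trans hstart.2).ne] at h3
      · exact Set.Ioo_subset_Icc_self (hbefore τ ⟨hτ.1, hlt⟩)
  -- coordinates along the solution
  have hcl : ∀ τ, clampTime τs τ ∈ Set.Icc 0 τs := fun τ =>
    ⟨le_max_left _ _, max_le hτs0.le (min_le_right _ _)⟩
  have hsubT : Set.Icc 0 τs ⊆ Set.Icc 0 T := Set.Icc_subset_Icc le_rfl hτsT
  have hγc : Continuous fun τ => γ (clampTime τs τ) :=
    hγ.1.comp_continuous (continuous_clampTime τs) fun τ => hsubT (hcl τ)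
  have hlopos : 0 < sqRadius m lo := sqRadius_pos m hlow
  obtain ⟨σ, ψ₀, hσc, hψ₀c, hσpos, hflow₀⟩ := exists_coordinates hm0 hγc (fun τ h0 => by
    have h1 := (hin _ (hcl τ)).1
    simp only [hr2] at h1
    rw [h0] at h1
    simp at h1
    linarith)
  have hflow₀' : ∀ τ ∈ Set.Icc 0 τs, γ τ = flow m (σ τ) (ψ₀ τ) := by
    intro τ hτ
    have := hflow₀ τ
    rwa [clampTime_eq hτ] at this
  have h0I : (0 : ℝ) ∈ Set.Icc 0 τs := ⟨le_rfl, hτs0.le⟩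
  obtain ⟨hσ0, j, hj⟩ := flow_eq_branch (hσpos 0) hs0 ((hflow₀' 0 h0I).symm.trans hγ0)
  set ψ : ℝ → ℝ := fun τ => ψ₀ τ + (-j : ℤ) * (2 * Real.pi) with hψ
  have hψ0 : ψ 0 = 0 := by simp only [hψ]; rw [hj]; push_cast; ring
  have hflow : ∀ τ ∈ Set.Icc 0 τs, γ τ = flow m (σ τ) (ψ τ) := fun τ hτ => by
    rw [hflow₀' τ hτ, hψ, flow_add_two_pi_mul]
  have hsol : IsCoordSolution m P ε σ ψ 0 τs :=
    isCoordSolution_of_solution hm hγ hsubT hσc (by fun_prop) hσpos hflow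
  have hσR : ∀ τ ∈ Set.Icc 0 τs, r2 τ = sqRadius m (σ τ) := fun τ hτ => by
    simp only [hr2]; rw [hflow τ hτ, flow_sq_add_sq]
  have hσmem : ∀ τ ∈ Set.Icc 0 τs, σ τ ∈ Set.Icc lo hi := by
    intro τ hτ
    have h1 := hin τ hτ
    rw [hσR τ hτ] at h1
    exact ⟨(hmonoR.le_iff_le (Set.mem_Ici.2 hlow.le) (Set.mem_Ici.2 (hσpos τ).le)).1 h1.1,
      (hmonoR.le_iff_le (Set.mem_Ici.2 (hσpos τ).le) (Set.mem_Ici.2 (by linarith))).1 h1.2⟩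
  have hσ0s : σ 0 ∈ Set.Icc (c - ρ) (d + ρ) := by rw [hσ0]; exact hs
  have hτsI : τs ∈ Set.Icc 0 τs := ⟨hτs0.le, le_rfl⟩
  -- Either a full turn is completed before the exit, and then the solution has hit the branch at `v
  -- ε (2 * π) s`; or it is not, and then `v_mem` shows that the solution never reached the
  -- boundary.
  rcases le_or_gt (2 * Real.pi) (ψ τs) with hcase | hcase
  · obtain ⟨τ₁, hτ₁, hψ₁⟩ := intermediate_value_Icc hτs0.le hsol.cont_angle
      (show 2 * Real.pi ∈ Set.Icc (ψ 0) (ψ τs) from ⟨by rw [hψ0]; exact hπ.le, hcase⟩)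
    have hτ₁0 : 0 < τ₁ := by
      refine lt_of_le_of_ne hτ₁.1 fun h => ?_
      rw [← h, hψ0] at hψ₁
      exact hπ.ne hψ₁
    have hst := R.eq_v hε (hsol.mono le_rfl hτ₁.2)
      (fun τ hτ => hσmem τ ⟨hτ.1, hτ.2.trans hτ₁.2⟩) hψ0 hψ₁.le hσ0s τ₁ ⟨hτ₁.1, le_rfl⟩
    rw [hψ₁, hσ0] at hst
    have hγ₁ : γ τ₁ = (σ τ₁, σ τ₁ ^ m) := by
      rw [hflow τ₁ hτ₁, hψ₁, flow_two_pi]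
    have hτ₁T : τ₁ = T := by
      by_contra hne
      refine hfirst τ₁ ⟨hτ₁0, lt_of_le_of_ne (hτ₁.2.trans hτsT) hne⟩ ?_
      rw [hγ₁]
      exact ⟨hσpos τ₁, rfl⟩
    rw [hτ₁T, hγT] at hγ₁
    rw [← hst, hτ₁T]
    exact congrArg Prod.fst hγ₁
  · exfalso
    have hst := R.eq_v hε hsol hσmem hψ0 hcase.le hσ0s τs hτsI
    have h1 := R.v_mem hε hσ0s (ψ τs)
    rw [← hst] at h1
    -- Without an exit the final point lies on the branch at an angle strictly between `0` and `2π`,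
    -- which is impossible.
    have h2 : τs = T := by
      apply hexit
      rw [hσR τs hτsI]
      exact ⟨hmonoR (Set.mem_Ici.2 hlow.le) (Set.mem_Ici.2 (hσpos τs).le) h1.1,
        hmonoR (Set.mem_Ici.2 (hσpos τs).le) (Set.mem_Ici.2 (by linarith)) h1.2⟩
    have h3 := R.half_sub_le hε hsol hσmem h0I hτsI hτs0.le
    rw [hψ0] at h3
    refine not_branch_of_mem_Ioo (m := m) (hσpos τs) (t := ψ τs) ⟨by linarith, hcase⟩ ?_
    rw [← hflow τs hτsI, h2, hγT]
    exact ⟨hx0, rfl⟩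

theorem IsReturnFamily.returnMap_eq {k : ℕ} (hm : m = 2 * k + 1)
    (R : IsReturnFamily m P c d ρ ε₀ C Λ v) (hε : |ε| < ε₀) {s : ℝ}
    (hs : s ∈ Set.Icc (c - ρ) (d + ρ)) : returnMap m P ε s = v ε (2 * Real.pi) s :=
  R.eq_of_isFirstReturn hm hε hs
    (Classical.epsilon_spec (p := fun x' => IsFirstReturn m P ε s x') ⟨_, R.isFirstReturn hm hε hs⟩)

end PiecewiseCenter

namespace PiecewiseCenter

/-! ### Periodic orbits in an annulus -/

variable {m n : ℕ} {P : Perturbation n} {ε : ℝ} {c d ρ ε₀ C Λ : ℝ} {v : ℝ → ℝ → ℝ → ℝ}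

/-- The curve `flow m (v ε t s) t`, `0 ≤ t ≤ 2π`. -/
def cycleOf (m : ℕ) (v : ℝ → ℝ → ℝ → ℝ) (ε s : ℝ) : Set (ℝ × ℝ) :=
  (fun t => flow m (v ε t s) t) '' Set.Icc 0 (2 * Real.pi)

/-- The annulus between the circles through `(c, c ^ m)` and `(d, d ^ m)`. -/
def annulus (m : ℕ) (c d : ℝ) : Set (ℝ × ℝ) :=
  {z | sqRadius m c < z.1 ^ 2 + z.2 ^ 2 ∧ z.1 ^ 2 + z.2 ^ 2 < sqRadius m d}

theorem flow_mem_annulus_iff {s t : ℝ} (hc : 0 < c) (hd : 0 < d) (hs : 0 < s) :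
    flow m s t ∈ annulus m c d ↔ s ∈ Set.Ioo c d := by
  have h := strictMonoOn_sqRadius m
  unfold annulus
  rw [Set.mem_ofPred_eq, flow_sq_add_sq, h.lt_iff_lt (Set.mem_Ici.2 hc.le) (Set.mem_Ici.2 hs.le),
    h.lt_iff_lt (Set.mem_Ici.2 hs.le) (Set.mem_Ici.2 hd.le), Set.mem_Ioo]

/-- An orbit of a strictly increasing map is strictly monotone unless it starts at a fixed point.
Hence a periodic orbit that closes after `J` turns closes after one. -/
theorem eq_of_iterate_eq {F : ℝ → ℝ} {I : Set ℝ} (hF : StrictMonoOn F I) {s : ℕ → ℝ}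
    (hs : ∀ j, s j ∈ I) (hstep : ∀ j, s (j + 1) = F (s j)) {J : ℕ} (hJ : 0 < J)
    (h : s J = s 0) : s 1 = s 0 := by
  rcases lt_trichotomy (s 1) (s 0) with hlt | heq | hgt
  · have : ∀ j, s (j + 1) < s j := by
      intro j
      induction j with
      | zero => exact hlt
      | succ j ih => rw [hstep (j + 1), hstep j]; exact hF (by rw [← hstep]; exact hs _) (hs j)
                      (by rw [← hstep]; exact ih)
    exact absurd h (strictAnti_nat_of_succ_lt this hJ).ne
  · exact heq
  · have : ∀ j, s j < s (j + 1) := by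
      intro j
      induction j with
      | zero => exact hgt
      | succ j ih => rw [hstep (j + 1), hstep j]; exact hF (hs j) (by rw [← hstep]; exact hs _)
                      (by rw [← hstep]; exact ih)
    exact absurd h (strictMono_nat_of_lt_succ this hJ).ne'

/-- In the annulus the angle increases to infinity, so the orbit crosses the branch at successive
times, and between them it follows `v`. Periodicity and monotonicity of the return map force a fixed
point. -/
theorem IsReturnFamily.eq_cycleOf_of_isPeriodicOrbit {k : ℕ} (hm : m = 2 * k + 1)
    (R : IsReturnFamily m P c d ρ ε₀ C Λ v) (hε : |ε| < ε₀) {Γ : Set (ℝ × ℝ)}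
    (hΓ : IsPeriodicOrbit m P ε Γ) (hsub : Γ ⊆ annulus m c d) :
    ∃ s ∈ Set.Ioo c d, v ε (2 * Real.pi) s = s ∧ Γ = cycleOf m v ε s := by
  obtain ⟨γ, T, hT, hγ, hper, -, rfl⟩ := hΓ
  have hm0 : 0 < m := by omega
  have hπ := Real.two_pi_pos
  have hρ := R.ρ_pos
  have hlow := R.lower_pos
  have hcd := R.c_lt_d
  have hc0 : 0 < c := by linarith
  have hd0 : 0 < d := by linarith
  have hann : ∀ τ, γ τ ∈ annulus m c d := fun τ => hsub ⟨τ, rfl⟩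
  obtain ⟨σ, ψ, hσc, hψc, hσpos, hflow⟩ := exists_coordinates hm0 (continuousOn_univ.1 hγ.1)
    (fun τ h0 => by
      have h1 := (hann τ).1
      rw [h0] at h1
      simp only [Prod.fst_zero, Prod.snd_zero] at h1
      linarith [sqRadius_pos m hc0])
  have hσI : ∀ τ, σ τ ∈ Set.Ioo c d := fun τ => by
    have h1 := hann τ
    rwa [hflow τ, flow_mem_annulus_iff hc0 hd0 (hσpos τ)] at h1
  have hσR : ∀ τ, σ τ ∈ Set.Icc (c - ρ) (d + ρ) := fun τ =>
    ⟨by linarith [(hσI τ).1], by linarith [(hσI τ).2]⟩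
  have hσR' : ∀ τ, σ τ ∈ Set.Icc (c - 2 * ρ) (d + 2 * ρ) := fun τ =>
    ⟨by linarith [(hσI τ).1], by linarith [(hσI τ).2]⟩
  have hsol : ∀ a b, IsCoordSolution m P ε σ ψ a b := fun a b =>
    isCoordSolution_of_solution hm hγ (Set.subset_univ _) hσc hψc hσpos fun τ _ => hflow τ
  have hgrow : ∀ a b, a ≤ b → (b - a) / 2 ≤ ψ b - ψ a := fun a b hab =>
    R.half_sub_le hε (hsol a b) (fun τ _ => hσR' τ) ⟨le_rfl, hab⟩ ⟨hab, le_rfl⟩ hab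
  have hmono : StrictMono ψ := fun a b hab => by linarith [hgrow a b hab.le]
  have hsurj : Function.Surjective ψ := by
    refine hψc.surjective ?_ ?_
    · refine tendsto_atTop_mono' atTop (f₁ := fun t => 1 / 2 * t + ψ 0) ?_
        (tendsto_atTop_add_const_right _ _
          ((tendsto_id (α := ℝ)).const_mul_atTop (by norm_num : (0 : ℝ) < 1 / 2)))
      filter_upwards [eventually_ge_atTop 0] with t ht
      linarith [hgrow 0 t ht]
    · refine tendsto_atBot_mono' atBot (f₁ := fun t => 1 / 2 * t + ψ 0) (f₂ := ψ) ?_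
        (tendsto_atBot_add_const_right _ _
          ((tendsto_id (α := ℝ)).const_mul_atBot (by norm_num : (0 : ℝ) < 1 / 2)))
      filter_upwards [eventually_le_atBot 0] with t ht
      linarith [hgrow t 0 ht]
  -- The times at which the angle completes `j` turns, that is, the crossings of the branch `x > 0`.
  choose τ hτ using fun j : ℕ => hsurj (j * (2 * Real.pi))
  have hτle : ∀ j, τ j ≤ τ (j + 1) := fun j => by
    rw [← hmono.le_iff_le, hτ, hτ]; push_cast; nlinarith
  have hseg : ∀ (j : ℕ) (x : ℝ), x ∈ Set.Icc (τ j) (τ (j + 1)) →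
      σ x = v ε (ψ x + (-(j : ℤ) : ℤ) * (2 * Real.pi)) (σ (τ j)) := by
    intro j x hx
    refine R.eq_v hε ((hsol (τ j) (τ (j + 1))).shift (-(j : ℤ))) (fun y _ => hσR' y) ?_ ?_
      (hσR _) x hx
    · simp only [hτ]; push_cast; ring
    · simp only [hτ]; push_cast; linarith
  have hstep : ∀ j, σ (τ (j + 1)) = v ε (2 * Real.pi) (σ (τ j)) := by
    intro j
    rw [hseg j _ ⟨hτle j, le_rfl⟩, hτ]
    congr 1
    push_cast
    ring
  have hperτ : flow m (σ (τ 0 + T)) (ψ (τ 0 + T)) = flow m (σ (τ 0)) (ψ (τ 0)) := by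
    rw [← hflow, ← hflow]; exact hper _
  obtain ⟨hσT, J, hJ⟩ := flow_inj (hσpos _) (hσpos _) hperτ
  have hψ0 : ψ (τ 0) = 0 := by rw [hτ]; simp
  have hJpos : 0 < J := by
    have h1 : ψ (τ 0) < ψ (τ 0 + T) := hmono (by linarith)
    rw [hJ, hψ0, zero_add] at h1
    have h2 : (0 : ℝ) < J := by
      by_contra hcon
      push Not at hcon
      exact absurd h1 (not_lt.2 (mul_nonpos_of_nonpos_of_nonneg hcon hπ.le))
    exact_mod_cast h2
  lift J to ℕ using hJpos.le
  have hJτ : τ J = τ 0 + T := hmono.injective (by rw [hτ, hJ, hψ0]; push_cast; ring)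
  have hfix : σ (τ 1) = σ (τ 0) :=
    eq_of_iterate_eq (R.strictMono ε hε) (s := fun j => σ (τ j)) (fun j => hσR _) hstep
      (J := J) (by exact_mod_cast hJpos) (by simp only [hJτ, hσT])
  have hs0 : v ε (2 * Real.pi) (σ (τ 0)) = σ (τ 0) := by rw [← hstep 0, hfix]
  have hall : ∀ j, σ (τ j) = σ (τ 0) := by
    intro j
    induction j with
    | zero => rfl
    | succ j ih => rw [hstep, ih, hs0]
  refine ⟨σ (τ 0), hσI _, hs0, Set.Subset.antisymm ?_ ?_⟩
  · rintro _ ⟨x₀, rfl⟩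
    obtain ⟨N, hN⟩ := exists_nat_gt ((τ 0 - x₀) / T)
    rw [div_lt_iff₀ hT] at hN
    have hx : γ (x₀ + N * T) = γ x₀ := hper.nat_mul N x₀
    rw [← hx]
    set x := x₀ + N * T with hxdef
    have hxτ : τ 0 ≤ x := by linarith
    have hψx : 0 ≤ ψ x := by rw [← hψ0]; exact hmono.monotone hxτ
    set j := ⌊ψ x / (2 * Real.pi)⌋₊ with hj
    have h1 : j * (2 * Real.pi) ≤ ψ x := by
      rw [← le_div_iff₀ hπ]; exact Nat.floor_le (div_nonneg hψx hπ.le)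
    have h2 : ψ x ≤ (j + 1) * (2 * Real.pi) := by
      rw [← div_le_iff₀ hπ]; exact (Nat.lt_floor_add_one _).le
    have hxI : x ∈ Set.Icc (τ j) (τ (j + 1)) := by
      constructor
      · rw [← hmono.le_iff_le, hτ]; exact h1
      · rw [← hmono.le_iff_le, hτ]; push_cast; exact h2
    refine ⟨ψ x + (-(j : ℤ) : ℤ) * (2 * Real.pi), ⟨by push_cast; linarith, by push_cast; linarith⟩,
      ?_⟩
    simp only
    rw [← hall j, ← hseg j x hxI, flow_add_two_pi_mul, hflow]
  · rintro _ ⟨t, ht, rfl⟩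
    obtain ⟨x, hx⟩ := hsurj t
    refine ⟨x, ?_⟩
    have hxI : x ∈ Set.Icc (τ 0) (τ (0 + 1)) := by
      constructor
      · rw [← hmono.le_iff_le, hψ0, hx]; exact ht.1
      · rw [← hmono.le_iff_le, hτ, hx]; push_cast; linarith [ht.2]
    have h1 := hseg 0 x hxI
    rw [hx] at h1
    rw [hflow, hx, h1]
    simp

/-- At a fixed point of the return map, `v` closes up to a `2π`-periodic function of the angle;
reparametrized by time it is a periodic solution. Injectivity over a period is injectivity of the
angle modulo `2π`. -/
theorem IsReturnFamily.isPeriodicOrbit_cycleOf {k : ℕ} (hm : m = 2 * k + 1)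
    (R : IsReturnFamily m P c d ρ ε₀ C Λ v) (hε : |ε| < ε₀) {s : ℝ}
    (hs : s ∈ Set.Icc (c - ρ) (d + ρ)) (hfix : v ε (2 * Real.pi) s = s) :
    IsPeriodicOrbit m P ε (cycleOf m v ε s) := by
  have hπ := Real.two_pi_pos
  have hlow := R.lower_pos
  have hvc := R.continuous ε hε s hs
  have hinit := R.init ε hε s hs
  set f : ℝ → ℝ := fun x => v ε (2 * Real.pi * x) s with hf
  -- Periodic extension through the fractional part; the fixed point condition makes it continuous
  -- at the joints.
  set w : ℝ → ℝ := fun t => f (Int.fract (t / (2 * Real.pi))) with hw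
  have hwc : Continuous w := by
    have h1 : Continuous f := hvc.comp (by fun_prop)
    have h2 : Continuous (f ∘ Int.fract) :=
      h1.continuousOn.comp_fract'' (by simp only [hf]; rw [mul_zero, mul_one, hinit, hfix])
    exact h2.comp (by fun_prop)
  have hmem : ∀ t, w t ∈ Set.Icc (c - 2 * ρ) (d + 2 * ρ) := fun t =>
    ⟨(R.v_mem hε hs _).1.le, (R.v_mem hε hs _).2.le⟩
  have hpos : ∀ t, 0 < w t := fun t => by linarith [(hmem t).1]
  have hwper : ∀ t, w (t + 2 * Real.pi) = w t := fun t => by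
    simp only [hw]
    rw [add_div, div_self hπ.ne', Int.fract_add_one]
  have hwloc : ∀ (j : ℤ) (t : ℝ), t ∈ Set.Ico (j * (2 * Real.pi)) ((j + 1) * (2 * Real.pi)) →
      w t = v ε (t + (-j : ℤ) * (2 * Real.pi)) s := by
    intro j t ht
    have : Int.fract (t / (2 * Real.pi)) = t / (2 * Real.pi) - j := by
      rw [Int.fract, Int.floor_eq_iff.2 ⟨by rw [le_div_iff₀ hπ]; exact ht.1,
        by rw [div_lt_iff₀ hπ]; exact ht.2⟩]
    simp only [hw, hf, this]
    congr 1
    push_cast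
    field_simp
    ring
  have hwd : ∀ t, Real.sin t ≠ 0 → HasDerivAt w (slopeField m P ε t (w t)) t := by
    intro t ht
    set j := ⌊t / (2 * Real.pi)⌋ with hj
    have h1 : (j : ℝ) * (2 * Real.pi) ≤ t := by rw [← le_div_iff₀ hπ]; exact Int.floor_le _
    have h2 : t < (j + 1) * (2 * Real.pi) := by rw [← div_lt_iff₀ hπ]; exact Int.lt_floor_add_one _
    have h3 : (j : ℝ) * (2 * Real.pi) ≠ t := by
      rintro h
      rw [← h] at ht
      apply ht
      have : (j : ℝ) * (2 * Real.pi) = ((2 * j : ℤ) : ℝ) * Real.pi := by push_cast; ring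
      rw [this]
      exact Real.sin_int_mul_pi _
    have h4 := lt_of_le_of_ne h1 h3
    have h5 := R.deriv ε hε s hs (t + (-j : ℤ) * (2 * Real.pi))
      ⟨by push_cast; linarith, by push_cast; linarith⟩ (by rwa [Real.sin_add_int_mul_two_pi])
    rw [slopeField_add_int_mul, ← hwloc j t ⟨h1, h2⟩] at h5
    have h6 := HasDerivAt.comp_add_const t ((-j : ℤ) * (2 * Real.pi)) h5
    refine h6.congr_of_eventuallyEq ?_
    filter_upwards [Ioo_mem_nhds h4 h2] with x hx
    exact hwloc j x ⟨hx.1.le, hx.2⟩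
  obtain ⟨θ, hθ, hd⟩ := R.exists_time hm hε hwc hmem
  have hθ0 : θ 0 = 0 := by rw [hθ]; simp
  have hθs0 : θ.symm 0 = 0 := by rw [OrderIso.symm_apply_eq, hθ0]
  have hT : 0 < θ (2 * Real.pi) := by rw [← hθ0]; exact θ.strictMono hπ
  have hθper : ∀ t, θ (t + 2 * Real.pi) = θ t + θ (2 * Real.pi) := by
    intro t
    have hp : Function.Periodic (fun τ => (angularSpeed m P ε τ (w τ))⁻¹) (2 * Real.pi) := by
      intro x
      have := angularSpeed_add_int_mul (m := m) (P := P) (ε := ε) x (w x) 1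
      simp only [hwper]
      rw [Int.cast_one, one_mul] at this
      rw [this]
    have := hp.intervalIntegral_add_eq_add 0 t
      (R.intervalIntegrable_inv_angularSpeed hε hwc hmem)
    rw [hθ, hθ, hθ, this, zero_add]
  have hθsper : ∀ τ, θ.symm (τ + θ (2 * Real.pi)) = θ.symm τ + 2 * Real.pi := by
    intro τ
    rw [OrderIso.symm_apply_eq, hθper, θ.apply_symm_apply]
  have hflper : ∀ x t, flow m x (t + 2 * Real.pi) = flow m x t := fun x t => by
    have := flow_add_two_pi_mul m x t 1
    rwa [Int.cast_one, one_mul] at this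
  refine ⟨fun τ => flow m (w (θ.symm τ)) (θ.symm τ), θ (2 * Real.pi), hT, ⟨?_,
    θ '' {t | Real.sin t = 0}, countable_sin_eq_zero.image _, ?_⟩, ?_, ?_, ?_⟩
  · have : Continuous fun τ => flow m (w (θ.symm τ)) (θ.symm τ) :=
      continuous_flow.comp (θ.symm.continuous.prodMk (hwc.comp θ.symm.continuous))
    exact this.continuousOn
  · intro τ hτ
    have hsin : Real.sin (θ.symm τ) ≠ 0 := fun h => hτ.2 ⟨θ.symm τ, h, θ.apply_symm_apply τ⟩
    have := hd (θ.symm τ) hsin (hwd _ hsin)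
    rwa [OrderIso.apply_symm_apply] at this
  · intro τ
    simp only [hθsper, hwper, hflper]
  · intro x hx y hy hxy
    have hin : ∀ τ ∈ Set.Ico 0 (θ (2 * Real.pi)), θ.symm τ ∈ Set.Ico 0 (2 * Real.pi) := by
      intro τ hτ
      constructor
      · rw [← hθs0]; exact θ.symm.monotone hτ.1
      · rw [← θ.symm_apply_apply (2 * Real.pi)]; exact θ.symm.strictMono hτ.2
    obtain ⟨-, j, hj⟩ := flow_inj (hpos _) (hpos _) hxy
    have h1 := hin x hx
    have h2 := hin y hy
    have h3 : (j : ℝ) * (2 * Real.pi) < 1 * (2 * Real.pi) := by linarith [h1.2, h2.1]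
    have h4 : (-1 : ℝ) * (2 * Real.pi) < j * (2 * Real.pi) := by linarith [h1.1, h2.2]
    have h5 := lt_of_mul_lt_mul_right h3 hπ.le
    have h6 := lt_of_mul_lt_mul_right h4 hπ.le
    have h7 : j = 0 := by
      have h8 : j < 1 := by exact_mod_cast h5
      have h9 : -1 < j := by exact_mod_cast h6
      omega
    rw [h7] at hj
    exact θ.symm.injective (by simpa using hj)
  · have hval : ∀ t ∈ Set.Icc 0 (2 * Real.pi), w t = v ε t s := by
      intro t ht
      rcases eq_or_lt_of_le ht.2 with h | h
      · rw [h, hfix]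
        have := hwper 0
        rw [zero_add] at this
        rw [this]
        simp only [hw, hf, zero_div, Int.fract_zero, mul_zero, hinit]
      · have := hwloc 0 t ⟨by simpa using ht.1, by simpa using h⟩
        simpa using this
    ext z
    constructor
    · rintro ⟨t, ht, rfl⟩
      refine ⟨θ t, ?_⟩
      simp only [OrderIso.symm_apply_apply, hval t ht]
    · rintro ⟨τ, rfl⟩
      set t := θ.symm τ with htdef
      have h1 := Int.fract_nonneg (t / (2 * Real.pi))
      have h2 := Int.fract_lt_one (t / (2 * Real.pi))
      refine ⟨2 * Real.pi * Int.fract (t / (2 * Real.pi)), ⟨by positivity, by nlinarith⟩, ?_⟩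
      simp only
      have h3 : 2 * Real.pi * Int.fract (t / (2 * Real.pi)) =
          t + (-⌊t / (2 * Real.pi)⌋ : ℤ) * (2 * Real.pi) := by
        rw [Int.fract]
        push_cast
        field_simp
        ring
      conv_lhs => rw [h3, flow_add_two_pi_mul, ← h3]

theorem IsReturnFamily.branch_mem_cycleOf (R : IsReturnFamily m P c d ρ ε₀ C Λ v) (hε : |ε| < ε₀)
    {s : ℝ} (hs : s ∈ Set.Icc (c - ρ) (d + ρ)) : (s, s ^ m) ∈ cycleOf m v ε s := by
  refine ⟨0, ⟨le_rfl, Real.two_pi_pos.le⟩, ?_⟩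
  simp only [R.init ε hε s hs, flow_zero]

theorem IsReturnFamily.eq_of_branch_mem_cycleOf (R : IsReturnFamily m P c d ρ ε₀ C Λ v)
    (hε : |ε| < ε₀) {s x : ℝ} (hs : s ∈ Set.Icc (c - ρ) (d + ρ))
    (hfix : v ε (2 * Real.pi) s = s) (hx : 0 < x) (h : (x, x ^ m) ∈ cycleOf m v ε s) : x = s := by
  obtain ⟨t, ht, hxt⟩ := h
  have hpos : 0 < v ε t s := by linarith [(R.v_mem hε hs t).1, R.lower_pos]
  have hbr : 0 < (flow m (v ε t s) t).1 ∧ (flow m (v ε t s) t).2 = (flow m (v ε t s) t).1 ^ m := by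
    simp only at hxt
    rw [hxt]
    exact ⟨hx, rfl⟩
  obtain ⟨h1, -⟩ := flow_eq_branch hpos hx hxt
  rcases eq_or_lt_of_le ht.1 with h0 | h0
  · rw [← h1, ← h0, R.init ε hε s hs]
  rcases eq_or_lt_of_le ht.2 with h2 | h2
  · rw [← h1, h2, hfix]
  · exact absurd hbr (not_branch_of_mem_Ioo hpos ⟨h0, h2⟩)

/-- The cycle meets the branch only at `s`, so the supremum defining the multiplicity has a single
term. -/
theorem IsReturnFamily.cycleMultiplicity_cycleOf {k : ℕ} (hm : m = 2 * k + 1)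
    (R : IsReturnFamily m P c d ρ ε₀ C Λ v) (hε : |ε| < ε₀) {s : ℝ} (hs : s ∈ Set.Icc c d)
    (hfix : v ε (2 * Real.pi) s = s) :
    cycleMultiplicity m P ε (cycleOf m v ε s) =
      vanishingOrder (fun x => v ε (2 * Real.pi) x - x) s := by
  have hρ := R.ρ_pos
  have hs' : s ∈ Set.Icc (c - ρ) (d + ρ) := ⟨by linarith [hs.1], by linarith [hs.2]⟩
  have hs0 : 0 < s := by linarith [hs.1, R.lower_pos]
  have hcongr : vanishingOrder (fun x => returnMap m P ε x - x) s =
      vanishingOrder (fun x => v ε (2 * Real.pi) x - x) s := by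
    refine vanishingOrder_congr ?_
    filter_upwards [Icc_mem_nhds (show c - ρ < s by linarith [hs.1])
      (show s < d + ρ by linarith [hs.2])] with x hx
    rw [R.returnMap_eq hm hε hx]
  unfold cycleMultiplicity
  refine le_antisymm (iSup₂_le fun x hx => ?_) ?_
  · rw [R.eq_of_branch_mem_cycleOf hε hs' hfix hx.1 hx.2, hcongr]
  · rw [← hcongr]
    exact le_iSup₂_of_le s ⟨hs0, R.branch_mem_cycleOf hε hs'⟩ le_rfl

theorem isOpen_annulus (m : ℕ) (c d : ℝ) : IsOpen (annulus m c d) := by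
  have hr : Continuous fun z : ℝ × ℝ => z.1 ^ 2 + z.2 ^ 2 := by fun_prop
  exact (isOpen_lt continuous_const hr).inter (isOpen_lt hr continuous_const)

theorem IsReturnFamily.isLimitCycle_cycleOf {k : ℕ} (hm : m = 2 * k + 1)
    (R : IsReturnFamily m P c d ρ ε₀ C Λ v) (hε : |ε| < ε₀) {s η : ℝ} (hs : s ∈ Set.Ioo c d)
    (hfix : v ε (2 * Real.pi) s = s) (hη : 0 < η)
    (hiso : ∀ x ∈ Set.Ioo c d, |x - s| < η → v ε (2 * Real.pi) x = x → x = s)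
    (hsub : cycleOf m v ε s ⊆ annulus m c d) : IsLimitCycle m P ε (cycleOf m v ε s) := by
  have hρ := R.ρ_pos
  have hlow := R.lower_pos
  have hs' : s ∈ Set.Icc (c - ρ) (d + ρ) := ⟨by linarith [hs.1], by linarith [hs.2]⟩
  have hc0 : 0 < c := by linarith
  -- The branch outside an `η`-neighbourhood of `s`, a set the isolating neighbourhood must avoid.
  -- Admitting `x = 0` makes it closed, at no cost because the annulus excludes the origin.
  set F : Set (ℝ × ℝ) := {z | 0 ≤ z.1 ∧ z.2 = z.1 ^ m ∧ η ≤ |z.1 - s|} with hF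
  have hFc : IsClosed F := by
    have h1 : Continuous fun z : ℝ × ℝ => z.1 ^ m := by fun_prop
    have h2 : Continuous fun z : ℝ × ℝ => |z.1 - s| := by fun_prop
    exact (isClosed_le continuous_const continuous_fst).inter
      ((isClosed_eq continuous_snd h1).inter (isClosed_le continuous_const h2))
  refine ⟨R.isPeriodicOrbit_cycleOf hm hε hs' hfix, annulus m c d ∩ Fᶜ,
    (isOpen_annulus m c d).inter hFc.isOpen_compl, fun z hz => ⟨hsub hz, fun hzF => ?_⟩,
    fun Γ' hΓ' hΓ'U => ?_⟩
  · obtain ⟨h1, h2, h3⟩ := hzF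
    rcases eq_or_lt_of_le h1 with h0 | h0
    · have h4 := (hsub hz).1
      rw [h2, ← h0, zero_pow (by omega : m ≠ 0)] at h4
      have := sqRadius_pos m hc0
      norm_num at h4
      linarith
    · have hzz : (z.1, z.1 ^ m) ∈ cycleOf m v ε s := by rw [← h2]; exact hz
      rw [R.eq_of_branch_mem_cycleOf hε hs' hfix h0 hzz, sub_self, abs_zero] at h3
      linarith
  · obtain ⟨x, hx, hxfix, rfl⟩ := R.eq_cycleOf_of_isPeriodicOrbit hm hε hΓ'
      (hΓ'U.trans Set.inter_subset_left)
    have hx' : x ∈ Set.Icc (c - ρ) (d + ρ) := ⟨by linarith [hx.1], by linarith [hx.2]⟩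
    have h1 := (hΓ'U (R.branch_mem_cycleOf hε hx')).2
    rw [hiso x hx ?_ hxfix]
    by_contra hcon
    exact h1 ⟨by simp only; linarith [hx.1], rfl, not_lt.1 hcon⟩

end PiecewiseCenter

namespace PiecewiseCenter

/-! ### Bifurcating limit cycles and zeros of the Melnikov polynomial -/

/-- The positive roots of a polynomial. -/
noncomputable def posRoots (Q : Polynomial ℝ) : Finset ℝ := Q.roots.toFinset.filter (0 < ·)

/-- The number of positive roots, counted with multiplicity. -/
noncomputable def posRootCount (Q : Polynomial ℝ) : ℕ := ∑ z ∈ posRoots Q, Q.rootMultiplicity z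

theorem mem_posRoots {Q : Polynomial ℝ} (hQ : Q ≠ 0) {z : ℝ} :
    z ∈ posRoots Q ↔ 0 < z ∧ Q.eval z = 0 := by
  simp [posRoots, hQ, and_comm]

theorem analyticAt_eval (Q : Polynomial ℝ) (z : ℝ) : AnalyticAt ℝ (fun x => Q.eval x) z :=
  AnalyticOnNhd.eval_polynomial Q z (Set.mem_univ z)

theorem analyticOrderAt_mul_eval {Q : Polynomial ℝ} (hQ : Q ≠ 0) {u : ℝ → ℝ} {z : ℝ}
    (hu : AnalyticAt ℝ u z) (hu0 : u z ≠ 0) :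
    analyticOrderAt (fun x => u x * Q.eval x) z = Q.rootMultiplicity z := by
  obtain ⟨R, hR, hnd⟩ := Polynomial.exists_eq_pow_rootMultiplicity_mul_and_not_dvd Q hQ z
  rw [AnalyticAt.analyticOrderAt_eq_natCast (hu.fun_mul (analyticAt_eval Q z))]
  refine ⟨fun x => u x * R.eval x, hu.mul (analyticAt_eval R z), mul_ne_zero hu0 fun h => ?_,
    Eventually.of_forall fun x => ?_⟩
  · exact hnd (Polynomial.dvd_iff_isRoot.2 h)
  · conv_lhs => rw [hR]
    simp only [Polynomial.eval_mul, Polynomial.eval_pow, Polynomial.eval_sub, Polynomial.eval_X,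
      Polynomial.eval_C, smul_eq_mul]
    ring

theorem analyticOrderAt_eval {Q : Polynomial ℝ} (hQ : Q ≠ 0) (z : ℝ) :
    analyticOrderAt (fun x => Q.eval x) z = Q.rootMultiplicity z := by
  simpa using analyticOrderAt_mul_eval hQ (u := fun _ => 1) (z := z) analyticAt_const one_ne_zero

theorem iteratedDeriv_ne_zero_of_analyticOrderAt {f : ℝ → ℝ} {z : ℝ} {N : ℕ}
    (hf : AnalyticAt ℝ f z) (h : analyticOrderAt f z = N) : iteratedDeriv N f z ≠ 0 := by
  intro h0
  have h1 := (natCast_le_analyticOrderAt_iff_iteratedDeriv_eq_zero hf (n := N)).1 h.ge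
  have h2 := (natCast_le_analyticOrderAt_iff_iteratedDeriv_eq_zero hf (n := N + 1)).2
    (fun i hi => by
      rcases Nat.lt_succ_iff_lt_or_eq.1 hi with hi | rfl
      · exact h1 i hi
      · exact h0)
  rw [h] at h2
  have : N + 1 ≤ N := by exact_mod_cast h2
  omega

/-- A function with a simple zero takes opposite signs near it. -/
theorem exists_mul_neg_of_hasDerivAt {g : ℝ → ℝ} {g' z r : ℝ} (hg : HasDerivAt g g' z)
    (hg' : g' ≠ 0) (h0 : g z = 0) (hr : 0 < r) :
    ∃ x ∈ Set.Ioo (z - r) z, ∃ y ∈ Set.Ioo z (z + r), g x * g y < 0 := by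
  wlog hpos : 0 < g' generalizing g g'
  · obtain ⟨x, hx, y, hy, hxy⟩ := this (g := fun t => -g t) (g' := -g') hg.fun_neg
      (neg_ne_zero.2 hg') (by simp [h0])
      (neg_pos.2 (lt_of_le_of_ne (not_lt.1 hpos) hg'))
    exact ⟨x, hx, y, hy, by simpa using hxy⟩
  have hs := (hasDerivAt_iff_tendsto_slope.1 hg).eventually (lt_mem_nhds hpos)
  have hl : ∀ᶠ x in 𝓝[<] z, 0 < slope g z x :=
    (nhdsWithin_mono z fun x hx => ne_of_lt hx) hs
  have hr' : ∀ᶠ x in 𝓝[>] z, 0 < slope g z x :=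
    (nhdsWithin_mono z fun x hx => ne_of_gt hx) hs
  obtain ⟨x, hx1, hx2⟩ := (hl.and (Ioo_mem_nhdsLT (show z - r < z by linarith))).exists
  obtain ⟨y, hy1, hy2⟩ := (hr'.and (Ioo_mem_nhdsGT (show z < z + r by linarith))).exists
  rw [slope_def_field, h0, sub_zero] at hx1 hy1
  refine ⟨x, hx2, y, hy2, mul_neg_of_neg_of_pos ?_ ?_⟩
  · by_contra hc
    exact absurd hx1 (not_lt.2 (div_nonpos_of_nonneg_of_nonpos (not_lt.1 hc)
      (by linarith [hx2.2])))
  · by_contra hc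
    exact absurd hy1 (not_lt.2 (div_nonpos_of_nonpos_of_nonneg (not_lt.1 hc)
      (by linarith [hy2.1])))

theorem exists_zero_of_mul_neg {f : ℝ → ℝ} {x y : ℝ} (hxy : x ≤ y)
    (hf : ContinuousOn f (Set.Icc x y)) (h : f x * f y < 0) : ∃ t ∈ Set.Icc x y, f t = 0 := by
  rcases mul_neg_iff.1 h with ⟨h1, h2⟩ | ⟨h1, h2⟩
  · exact intermediate_value_Icc' hxy hf ⟨h2.le, h1.le⟩
  · exact intermediate_value_Icc hxy hf ⟨h1.le, h2.le⟩

/-- Simple zeros persist under perturbations. -/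
theorem eventually_exists_zeros {ι : Type*} {l : Filter ι} {g : ι → ℝ → ℝ} {g₀ : ℝ → ℝ} {c d : ℝ}
    (hconv : ∀ x ∈ Set.Ioo c d, Tendsto (fun i => g i x) l (𝓝 (g₀ x)))
    (hcont : ∀ᶠ i in l, ContinuousOn (g i) (Set.Ioo c d))
    (S : Finset ℝ) (hSI : (S : Set ℝ) ⊆ Set.Ioo c d) (h0 : ∀ z ∈ S, g₀ z = 0)
    (hd : ∀ z ∈ S, ∃ g', g' ≠ 0 ∧ HasDerivAt g₀ g' z) {r : ℝ} (hr : 0 < r) :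
    ∀ᶠ i in l, ∀ z ∈ S, ∃ x, |x - z| < r ∧ g i x = 0 := by
  rw [Finset.eventually_all]
  intro z hz
  have hzI := hSI hz
  obtain ⟨g', hg', hgd⟩ := hd z hz
  obtain ⟨x, hx, y, hy, hxy⟩ := exists_mul_neg_of_hasDerivAt hgd hg' (h0 z hz)
    (r := min r (min (z - c) (d - z))) (lt_min hr (lt_min (by linarith [hzI.1]) (by linarith [hzI.2])))
  have e1 := min_le_left r (min (z - c) (d - z))
  have e2 := (min_le_right r (min (z - c) (d - z))).trans (min_le_left _ _)
  have e3 := (min_le_right r (min (z - c) (d - z))).trans (min_le_right _ _)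
  have hxI : x ∈ Set.Ioo c d := ⟨by linarith [hx.1], by linarith [hx.2, hzI.2]⟩
  have hyI : y ∈ Set.Ioo c d := ⟨by linarith [hy.1, hzI.1], by linarith [hy.2]⟩
  have hlim := ((hconv x hxI).mul (hconv y hyI)).eventually (gt_mem_nhds hxy)
  filter_upwards [hlim, hcont] with i hi hic
  obtain ⟨t, ht, hti⟩ := exists_zero_of_mul_neg (hx.2.trans hy.1).le
    (hic.mono fun u hu => ⟨hxI.1.trans_le hu.1, hu.2.trans_lt hyI.2⟩) hi
  refine ⟨t, ?_, hti⟩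
  rw [abs_lt]
  constructor <;> linarith [ht.1, ht.2, hx.1, hy.2]

/-- A radius that separates the points of a finite set. -/
theorem exists_separating_radius (S : Finset ℝ) :
    ∃ r > 0, ∀ x ∈ S, ∀ y ∈ S, ∀ u, |u - x| < r → |u - y| < r → x = y := by
  obtain ⟨r, hr, h⟩ : ∃ r > 0, ∀ p ∈ S.offDiag, 2 * r ≤ |p.1 - p.2| := by
    rcases S.offDiag.eq_empty_or_nonempty with he | hne
    · exact ⟨1, one_pos, by simp [he]⟩
    · obtain ⟨p, hp, hmin⟩ := S.offDiag.exists_min_image (fun p => |p.1 - p.2|) hne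
      have hpos : 0 < |p.1 - p.2| := abs_pos.2 (sub_ne_zero.2 (Finset.mem_offDiag.1 hp).2.2)
      exact ⟨|p.1 - p.2| / 2, by linarith, fun q hq => by linarith [hmin q hq]⟩
  refine ⟨r, hr, fun x hx y hy u h1 h2 => ?_⟩
  by_contra hne
  have h3 := h (x, y) (Finset.mem_offDiag.2 ⟨hx, hy, hne⟩)
  have h4 := abs_sub_le x u y
  rw [abs_sub_comm x u] at h4
  simp only at h3
  linarith

variable {m n : ℕ} {P : Perturbation n} {Q : Polynomial ℝ}

section MelnikovZeros

theorem melnikov_eq_eval (hm : 0 < m)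
    (hM : ∀ s, 0 < s → melnikov m P (sqRadius m s) = Q.eval s) {h : ℝ} (hh : 0 < h) :
    melnikov m P h = Q.eval (sqRadiusInv m h) := by
  rw [← hM _ (sqRadiusInv_pos hm hh), sqRadius_sqRadiusInv hm hh]

/-- Locally the Melnikov function is `Q` composed with the analytic local diffeomorphism
`sqRadiusInv`, and such a composition preserves the order. -/
theorem vanishingOrder_melnikov (hm : 0 < m) (hQ : Q ≠ 0)
    (hM : ∀ s, 0 < s → melnikov m P (sqRadius m s) = Q.eval s) {s : ℝ} (hs : 0 < s) :
    vanishingOrder (melnikov m P) (sqRadius m s) = Q.rootMultiplicity s := by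
  have hpos := sqRadius_pos m hs
  have h1 : melnikov m P =ᶠ[𝓝 (sqRadius m s)] (fun x => Q.eval x) ∘ sqRadiusInv m := by
    filter_upwards [lt_mem_nhds hpos] with h hh using melnikov_eq_eval hm hM hh
  have ha := analyticAt_sqRadiusInv hm hs
  have hinv := sqRadiusInv_sqRadius hm hs
  have hne : deriv (sqRadiusInv m) (sqRadius m s) ≠ 0 := by
    rw [(hasStrictDerivAt_sqRadiusInv hm hs).hasDerivAt.deriv]
    exact inv_ne_zero (mul_pos two_pos (jac_pos m hs)).ne'
  rw [vanishingOrder_congr h1, vanishingOrder_eq_analyticOrderAt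
    (AnalyticAt.comp (analyticAt_eval Q _) ha), analyticOrderAt_comp_of_deriv_ne_zero ha hne, hinv,
    analyticOrderAt_eval hQ]

theorem melnikovZeroCount_eq (hm : 0 < m) (hQ : Q ≠ 0)
    (hM : ∀ s, 0 < s → melnikov m P (sqRadius m s) = Q.eval s) :
    melnikovZeroCount m P = posRootCount Q := by
  classical
  unfold melnikovZeroCount countWithMult
  refine le_antisymm (iSup₂_le fun s hs => ?_) ?_
  · have h1 : ∑ h ∈ s, vanishingOrder (melnikov m P) h =
        ((∑ h ∈ s, Q.rootMultiplicity (sqRadiusInv m h) : ℕ) : ℕ∞) := by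
      rw [Nat.cast_sum]
      refine Finset.sum_congr rfl fun h hh => ?_
      have hpos := (hs hh).1
      rw [← vanishingOrder_melnikov hm hQ hM (sqRadiusInv_pos hm hpos), sqRadius_sqRadiusInv hm hpos]
    rw [h1, Nat.cast_le]
    have hinj : Set.InjOn (sqRadiusInv m) (s : Set ℝ) := fun x hx y hy hxy => by
      rw [← sqRadius_sqRadiusInv hm (hs hx).1, hxy, sqRadius_sqRadiusInv hm (hs hy).1]
    rw [← Finset.sum_image (f := fun z => Q.rootMultiplicity z) hinj]
    refine Finset.sum_le_sum_of_subset fun z hz => ?_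
    obtain ⟨h, hh, rfl⟩ := Finset.mem_image.1 hz
    refine (mem_posRoots hQ).2 ⟨sqRadiusInv_pos hm (hs hh).1, ?_⟩
    rw [← melnikov_eq_eval hm hM (hs hh).1]
    exact (hs hh).2
  · have hinj : Set.InjOn (sqRadius m) (posRoots Q : Set ℝ) := fun x hx y hy hxy =>
      sqRadius_injOn m ((mem_posRoots hQ).1 hx).1 ((mem_posRoots hQ).1 hy).1 hxy
    refine le_iSup₂_of_le ((posRoots Q).image (sqRadius m)) (fun h hh => ?_) ?_
    · obtain ⟨z, hz, rfl⟩ := Finset.mem_image.1 (Finset.mem_coe.1 hh)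
      obtain ⟨hz0, hz1⟩ := (mem_posRoots hQ).1 hz
      exact ⟨sqRadius_pos m hz0, by rw [hM z hz0, hz1]⟩
    · rw [Finset.sum_image hinj, posRootCount, Nat.cast_sum]
      refine Finset.sum_le_sum fun z hz => ?_
      rw [vanishingOrder_melnikov hm hQ hM ((mem_posRoots hQ).1 hz).1]

end MelnikovZeros

section Bifurcation

variable {k : ℕ} {c d ρ ε₀ C Λ : ℝ} {v : ℝ → ℝ → ℝ → ℝ}

/-- The displacement function divided by `ε`. -/
noncomputable def scaledDisplacement (v : ℝ → ℝ → ℝ → ℝ) (ε s : ℝ) : ℝ :=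
  ε⁻¹ * (v ε (2 * Real.pi) s - s)

theorem scaledDisplacement_eq_zero_iff {ε s : ℝ} (hε : ε ≠ 0) :
    scaledDisplacement v ε s = 0 ↔ v ε (2 * Real.pi) s = s := by
  simp [scaledDisplacement, hε, sub_eq_zero]

theorem IsReturnFamily.eventually_abs_lt (R : IsReturnFamily m P c d ρ ε₀ C Λ v) {δ : ℝ}
    (hδ : 0 < δ) : ∀ᶠ ε in 𝓝[≠] (0 : ℝ), |ε| < ε₀ ∧ ε ≠ 0 ∧ C * |ε| < δ := by
  have h1 : ∀ᶠ ε in 𝓝 (0 : ℝ), |ε| < ε₀ := by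
    have : Tendsto (fun ε : ℝ => |ε|) (𝓝 0) (𝓝 |(0 : ℝ)|) := continuous_abs.tendsto 0
    exact this.eventually (gt_mem_nhds (by rw [abs_zero]; exact R.ε₀_pos))
  have h2 : ∀ᶠ ε in 𝓝 (0 : ℝ), C * |ε| < δ := by
    have : Tendsto (fun ε : ℝ => C * |ε|) (𝓝 0) (𝓝 (C * |(0 : ℝ)|)) :=
      (continuous_const.mul continuous_abs).tendsto 0
    exact this.eventually (gt_mem_nhds (by simpa using hδ))
  filter_upwards [nhdsWithin_le_nhds h1, nhdsWithin_le_nhds h2, self_mem_nhdsWithin] with ε a b e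
  exact ⟨a, e, b⟩

theorem limit_eventuallyEq
    (hI : ∀ s, 0 < s → ∫ t in 0..2 * Real.pi, radial m (pAt P t) (qAt P t) t s = Q.eval s)
    {z : ℝ} (hz : 0 < z) :
    (fun s => (∫ t in 0..2 * Real.pi, radial m (pAt P t) (qAt P t) t s) / jac m s) =ᶠ[𝓝 z]
      fun s => (jac m s)⁻¹ * Q.eval s := by
  filter_upwards [lt_mem_nhds hz] with s hs
  rw [hI s hs, div_eq_inv_mul]

theorem analyticAt_inv_jac {z : ℝ} (hz : 0 < z) : AnalyticAt ℝ (fun s => (jac m s)⁻¹) z := by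
  refine AnalyticAt.inv ?_ (jac_pos m hz).ne'
  unfold jac
  fun_prop

/-- The zeros of the displacement function are controlled by those of the Melnikov polynomial. -/
theorem IsReturnFamily.eventually_sum_le (R : IsReturnFamily m P c d ρ ε₀ C Λ v) (hQ : Q ≠ 0)
    (hI : ∀ s, 0 < s → ∫ t in 0..2 * Real.pi, radial m (pAt P t) (qAt P t) t s = Q.eval s) :
    ∀ᶠ ε in 𝓝[≠] (0 : ℝ), ∀ s : Finset ℝ, (s : Set ℝ) ⊆ Set.Icc c d →
      ∑ x ∈ s, vanishingOrder (scaledDisplacement v ε) x ≤ posRootCount Q := by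
  classical
  have hc : 0 < c := by linarith [R.lower_pos, R.ρ_pos]
  set g₀ : ℝ → ℝ := fun s => (∫ t in 0..2 * Real.pi, radial m (pAt P t) (qAt P t) t s) / jac m s
    with hg₀
  set S := (posRoots Q).filter (· ∈ Set.Icc c d) with hS
  have h := eventually_sum_vanishingOrder_le (l := 𝓝[≠] (0 : ℝ)) (g := scaledDisplacement v)
    (g₀ := g₀) R.conv
    (by filter_upwards [R.eventually_abs_lt one_pos] with ε hε using R.cont_iteratedDeriv ε hε.1)
    R.cont_iteratedDeriv_limit S
    (fun x hx h0 => by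
      have hx0 : 0 < x := hc.trans_le hx.1
      refine Finset.mem_filter.2 ⟨(mem_posRoots hQ).2 ⟨hx0, ?_⟩, hx⟩
      simp only [hg₀, hI x hx0, div_eq_zero_iff, (jac_pos m hx0).ne', or_false] at h0
      exact h0)
    (fun x hx => (Finset.mem_filter.1 hx).2) (fun z => Q.rootMultiplicity z)
    (fun z hz => by
      have hz0 := ((mem_posRoots hQ).1 (Finset.mem_filter.1 hz).1).1
      rw [(limit_eventuallyEq hI hz0).iteratedDeriv_eq]
      exact iteratedDeriv_ne_zero_of_analyticOrderAt
        ((analyticAt_inv_jac hz0).mul (analyticAt_eval Q z))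
        (analyticOrderAt_mul_eval hQ (analyticAt_inv_jac hz0) (inv_ne_zero (jac_pos m hz0).ne')))
  filter_upwards [h] with ε hε s hs
  refine (hε s hs).trans ?_
  rw [Nat.cast_le]
  exact Finset.sum_le_sum_of_subset (Finset.filter_subset _ _)

theorem IsReturnFamily.cycleMultiplicity_eq (hm : m = 2 * k + 1)
    (R : IsReturnFamily m P c d ρ ε₀ C Λ v) {ε : ℝ} (hε : |ε| < ε₀) (hε0 : ε ≠ 0) {s : ℝ}
    (hs : s ∈ Set.Icc c d) (hfix : v ε (2 * Real.pi) s = s) :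
    cycleMultiplicity m P ε (cycleOf m v ε s) = vanishingOrder (scaledDisplacement v ε) s := by
  rw [R.cycleMultiplicity_cycleOf hm hε hs hfix]
  exact (vanishingOrder_const_mul (inv_ne_zero hε0)).symm

theorem limitCyclesIn_eq (ε : ℝ) (c d : ℝ) :
    limitCyclesIn m P ε (sqRadius m c) (sqRadius m d) =
      {Γ | IsLimitCycle m P ε Γ ∧ Γ ⊆ annulus m c d} := rfl

/-- At most as many limit cycles bifurcate as the Melnikov polynomial has positive zeros. -/
theorem IsReturnFamily.eventually_countWithMult_le (hm : m = 2 * k + 1)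
    (R : IsReturnFamily m P c d ρ ε₀ C Λ v) (hQ : Q ≠ 0)
    (hI : ∀ s, 0 < s → ∫ t in 0..2 * Real.pi, radial m (pAt P t) (qAt P t) t s = Q.eval s) :
    ∀ᶠ ε in 𝓝[≠] (0 : ℝ),
      countWithMult (limitCyclesIn m P ε (sqRadius m c) (sqRadius m d)) (cycleMultiplicity m P ε) ≤
        posRootCount Q := by
  classical
  filter_upwards [R.eventually_sum_le hQ hI, R.eventually_abs_lt one_pos] with ε hsum hε
  refine iSup₂_le fun A hA => ?_
  have h1 : ∀ Γ ∈ A, ∃ s ∈ Set.Ioo c d, v ε (2 * Real.pi) s = s ∧ Γ = cycleOf m v ε s := by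
    intro Γ hΓ
    have := hA hΓ
    rw [limitCyclesIn_eq] at this
    exact R.eq_cycleOf_of_isPeriodicOrbit hm hε.1 this.1.1 this.2
  choose! x hx hfix hΓx using h1
  have hinj : Set.InjOn x (A : Set (Set (ℝ × ℝ))) := fun Γ hΓ Γ' hΓ' h => by
    rw [hΓx Γ hΓ, hΓx Γ' hΓ', h]
  calc ∑ Γ ∈ A, cycleMultiplicity m P ε Γ
      = ∑ Γ ∈ A, vanishingOrder (scaledDisplacement v ε) (x Γ) := by
        refine Finset.sum_congr rfl fun Γ hΓ => ?_
        conv_lhs => rw [hΓx Γ hΓ]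
        exact R.cycleMultiplicity_eq hm hε.1 hε.2.1 (Set.Ioo_subset_Icc_self (hx Γ hΓ)) (hfix Γ hΓ)
    _ = ∑ y ∈ A.image x, vanishingOrder (scaledDisplacement v ε) y := by
        rw [Finset.sum_image hinj]
    _ ≤ _ := by
        refine hsum _ fun y hy => ?_
        obtain ⟨Γ, hΓ, rfl⟩ := Finset.mem_image.1 (Finset.mem_coe.1 hy)
        exact Set.Ioo_subset_Icc_self (hx Γ hΓ)

/-- Any annulus `a < x² + y² < b` is one between circles through branch points, to which the return
family applies. The bound does not depend on `a` and `b`. -/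
theorem bifurcatingCount_le (hm : m = 2 * k + 1) (hQ : Q ≠ 0)
    (hI : ∀ s, 0 < s → ∫ t in 0..2 * Real.pi, radial m (pAt P t) (qAt P t) t s = Q.eval s) :
    bifurcatingCount m P ≤ posRootCount Q := by
  have hm0 : 0 < m := by omega
  refine iSup_le fun a => iSup_le fun b => iSup_le fun hab => ?_
  have hb : 0 < b := hab.1.trans hab.2
  have hcd : sqRadiusInv m a < sqRadiusInv m b := by
    rw [← (strictMonoOn_sqRadius m).lt_iff_lt (Set.mem_Ici.2 (sqRadiusInv_pos hm0 hab.1).le)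
      (Set.mem_Ici.2 (sqRadiusInv_pos hm0 hb).le), sqRadius_sqRadiusInv hm0 hab.1,
      sqRadius_sqRadiusInv hm0 hb]
    exact hab.2
  obtain ⟨ρ, ε₀, C, Λ, v, R⟩ := exists_returnFamily (m := m) (P := P) (sqRadiusInv_pos hm0 hab.1) hcd
  have h := R.eventually_countWithMult_le hm hQ hI
  rw [sqRadius_sqRadiusInv hm0 hab.1, sqRadius_sqRadiusInv hm0 hb] at h
  exact limsup_le_of_le (by isBoundedDefault) h

/-- If all positive zeros are simple and lie in `(c, d)`, exactly one cycle bifurcates from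
each of them. -/
theorem IsReturnFamily.eventually_encard_eq (hm : m = 2 * k + 1)
    (R : IsReturnFamily m P c d ρ ε₀ C Λ v) (hQ : Q ≠ 0)
    (hI : ∀ s, 0 < s → ∫ t in 0..2 * Real.pi, radial m (pAt P t) (qAt P t) t s = Q.eval s)
    (hsimple : ∀ z ∈ posRoots Q, Q.rootMultiplicity z = 1)
    (hloc : ∀ z ∈ posRoots Q, z ∈ Set.Ioo c d) :
    ∀ᶠ ε in 𝓝[≠] (0 : ℝ),
      (limitCyclesIn m P ε (sqRadius m c) (sqRadius m d)).encard = posRootCount Q ∧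
      ∀ Γ ∈ limitCyclesIn m P ε (sqRadius m c) (sqRadius m d), 1 ≤ cycleMultiplicity m P ε Γ := by
  classical
  have hρ := R.ρ_pos
  have hc : 0 < c := by linarith [R.lower_pos]
  have hd : 0 < d := hc.trans R.c_lt_d
  have hcard : posRootCount Q = (posRoots Q).card := by
    rw [posRootCount, Finset.sum_congr rfl hsimple]; simp
  obtain ⟨r₀, hr₀, hsep⟩ := exists_separating_radius (posRoots Q)
  -- A margin larger than the oscillation `C * |ε|` of a cycle, so that cycles near the roots lie
  -- wholly inside the annulus.
  obtain ⟨r₁, hr₁, hmargin⟩ : ∃ r₁ > 0, ∀ z ∈ posRoots Q, c + 2 * r₁ ≤ z ∧ z + 2 * r₁ ≤ d := by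
    rcases (posRoots Q).eq_empty_or_nonempty with he | hne
    · exact ⟨1, one_pos, by simp [he]⟩
    · obtain ⟨z, hz, hmin⟩ := (posRoots Q).exists_min_image (fun z => min (z - c) (d - z)) hne
      have hpos : 0 < min (z - c) (d - z) :=
        lt_min (by linarith [(hloc z hz).1]) (by linarith [(hloc z hz).2])
      refine ⟨min (z - c) (d - z) / 2, by linarith, fun y hy => ?_⟩
      have h1 := (hmin y hy).trans (min_le_left _ _)
      have h2 := (hmin y hy).trans (min_le_right _ _)
      constructor <;> linarith
  set g₀ : ℝ → ℝ := fun s => (∫ t in 0..2 * Real.pi, radial m (pAt P t) (qAt P t) t s) / jac m s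
    with hg₀
  have hzeros := eventually_exists_zeros (l := 𝓝[≠] (0 : ℝ)) (g := scaledDisplacement v)
    (g₀ := g₀) (c := c) (d := d)
    (fun x hx => by
      have := (R.conv 0).tendsto_at (Set.Ioo_subset_Icc_self hx)
      simp only [iteratedDeriv_zero] at this
      exact this)
    (by
      filter_upwards [R.eventually_abs_lt one_pos] with ε hε
      have := R.cont_iteratedDeriv ε hε.1 0
      rw [iteratedDeriv_zero] at this
      exact this.mono Set.Ioo_subset_Icc_self)
    (posRoots Q) hloc
    (fun z hz => by
      obtain ⟨h1, h2⟩ := (mem_posRoots hQ).1 hz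
      simp only [hg₀, hI z h1, h2, zero_div])
    (fun z hz => by
      obtain ⟨h1, h2⟩ := (mem_posRoots hQ).1 hz
      have ha := (analyticAt_inv_jac (m := m) h1).mul (analyticAt_eval Q z)
      have ho := analyticOrderAt_mul_eval hQ (analyticAt_inv_jac (m := m) h1)
        (inv_ne_zero (jac_pos m h1).ne')
      rw [hsimple z hz] at ho
      have hne := iteratedDeriv_ne_zero_of_analyticOrderAt ha ho
      rw [iteratedDeriv_one] at hne
      refine ⟨_, hne, ?_⟩
      exact ha.differentiableAt.hasDerivAt.congr_of_eventuallyEq (limit_eventuallyEq hI h1))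
    (r := min r₀ r₁) (lt_min hr₀ hr₁)
  filter_upwards [R.eventually_sum_le hQ hI, R.eventually_abs_lt hr₁, hzeros] with ε hsum hε hz
  obtain ⟨hε1, hε0, hε2⟩ := hε
  rw [limitCyclesIn_eq]
  set F : Set ℝ := {x ∈ Set.Ioo c d | v ε (2 * Real.pi) x = x} with hF
  have hone : ∀ x ∈ F, 1 ≤ vanishingOrder (scaledDisplacement v ε) x := fun x hx =>
    one_le_vanishingOrder ((scaledDisplacement_eq_zero_iff hε0).2 hx.2)
  have hFcard : ∀ s : Finset ℝ, (s : Set ℝ) ⊆ F → s.card ≤ posRootCount Q := by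
    intro s hs
    have h1 := hsum s (fun x hx => Set.Ioo_subset_Icc_self (hs hx).1)
    have h2 : ((s.card : ℕ) : ℕ∞) ≤ ∑ x ∈ s, vanishingOrder (scaledDisplacement v ε) x := by
      have := Finset.card_nsmul_le_sum s (vanishingOrder (scaledDisplacement v ε)) 1
        fun x hx => hone x (hs hx)
      simpa using this
    exact_mod_cast h2.trans h1
  -- Fixed points are finite in number, hence isolated; this makes the corresponding cycles limit
  -- cycles.
  have hFenc : F.encard ≤ posRootCount Q := by
    by_contra hlt
    push Not at hlt
    obtain ⟨t, htF, ht⟩ := Set.exists_subset_encard_eq (s := F) (k := (posRootCount Q + 1 : ℕ))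
      (by rw [Nat.cast_add, Nat.cast_one]; exact Order.add_one_le_of_lt hlt)
    have hfin : t.Finite := Set.finite_of_encard_eq_coe ht
    have h1 := hFcard hfin.toFinset (by simpa using htF)
    rw [hfin.encard_eq_coe_toFinset_card] at ht
    have h2 : hfin.toFinset.card = posRootCount Q + 1 := by exact_mod_cast ht
    omega
  have hFfin : F.Finite := Set.finite_of_encard_le_coe hFenc
  have hsubF : {Γ | IsLimitCycle m P ε Γ ∧ Γ ⊆ annulus m c d} ⊆ cycleOf m v ε '' F := by
    rintro Γ ⟨h1, h2⟩
    obtain ⟨x, hx, hfix, rfl⟩ := R.eq_cycleOf_of_isPeriodicOrbit hm hε1 h1.1 h2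
    exact ⟨x, ⟨hx, hfix⟩, rfl⟩
  refine ⟨le_antisymm (((Set.encard_le_encard hsubF).trans (Set.encard_image_le _ _)).trans hFenc)
    ?_, ?_⟩
  · choose! y hy hy0 using hz
    have hyI : ∀ z ∈ posRoots Q, c + r₁ < y z ∧ y z < d - r₁ := fun z hz => by
      have h1 := abs_lt.1 ((hy z hz).trans_le (min_le_right _ _))
      have h2 := hmargin z hz
      constructor <;> linarith [h1.1, h1.2, h2.1, h2.2]
    have hyF : ∀ z ∈ posRoots Q, y z ∈ F := fun z hz =>
      ⟨⟨by linarith [(hyI z hz).1], by linarith [(hyI z hz).2]⟩,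
        (scaledDisplacement_eq_zero_iff hε0).1 (hy0 z hz)⟩
    have hyinj : Set.InjOn y (posRoots Q : Set ℝ) := fun z hz z' hz' h =>
      hsep z hz z' hz' (y z) ((hy z hz).trans_le (min_le_left _ _))
        (by rw [h]; exact (hy z' hz').trans_le (min_le_left _ _))
    have hFR : ∀ x ∈ F, x ∈ Set.Icc (c - ρ) (d + ρ) := fun x hx =>
      ⟨by linarith [hx.1.1], by linarith [hx.1.2]⟩
    have hcinj : Set.InjOn (cycleOf m v ε) F := fun x hx x' hx' h => by
      have h1 := R.branch_mem_cycleOf hε1 (hFR x hx)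
      rw [h] at h1
      exact R.eq_of_branch_mem_cycleOf hε1 (hFR x' hx') hx'.2 (hc.trans hx.1.1) h1
    have himg : cycleOf m v ε '' (y '' (posRoots Q : Set ℝ)) ⊆
        {Γ | IsLimitCycle m P ε Γ ∧ Γ ⊆ annulus m c d} := by
      rintro _ ⟨_, ⟨z, hz, rfl⟩, rfl⟩
      have hzF := hyF z hz
      have hsub : cycleOf m v ε (y z) ⊆ annulus m c d := by
        rintro _ ⟨t, ht, rfl⟩
        have h1 := abs_le.1 (R.near ε hε1 (y z) (hFR _ hzF) t)
        have h2 : v ε t (y z) ∈ Set.Ioo c d :=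
          ⟨by linarith [(hyI z hz).1], by linarith [(hyI z hz).2]⟩
        exact (flow_mem_annulus_iff hc hd (hc.trans h2.1)).2 h2
      obtain ⟨η, hη, hηsep⟩ := exists_separating_radius hFfin.toFinset
      refine ⟨R.isLimitCycle_cycleOf hm hε1 hzF.1 hzF.2 hη (fun x hx hxη hfix => ?_) hsub, hsub⟩
      exact hηsep x (hFfin.mem_toFinset.2 ⟨hx, hfix⟩) (y z) (hFfin.mem_toFinset.2 hzF) x
        (by simpa using hη) hxη
    have henc := Set.encard_le_encard himg
    rw [(hcinj.mono (by rintro _ ⟨z, hz, rfl⟩; exact hyF z hz)).encard_image, hyinj.encard_image,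
      Set.encard_coe_eq_coe_finsetCard, ← hcard] at henc
    exact henc
  · intro Γ hΓ
    obtain ⟨x, hx, rfl⟩ := hsubF hΓ
    rw [R.cycleMultiplicity_eq hm hε1 hε0 (Set.Ioo_subset_Icc_self hx.1) hx.2]
    exact hone x hx

/-- All positive roots lie in one window `(c₀, d₀)`, so every larger annulus yields the same number
of cycles. Each has multiplicity at least one, which also bounds `bifurcatingCount` from below. -/
theorem exactlyBifurcating_of_simple (hm : m = 2 * k + 1) (hQ : Q ≠ 0)
    (hI : ∀ s, 0 < s → ∫ t in 0..2 * Real.pi, radial m (pAt P t) (qAt P t) t s = Q.eval s)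
    (hsimple : ∀ z ∈ posRoots Q, Q.rootMultiplicity z = 1) :
    ExactlyBifurcating m P (posRootCount Q) ∧ (posRootCount Q : ℕ∞) ≤ bifurcatingCount m P := by
  classical
  have hm0 : 0 < m := by omega
  obtain ⟨c₀, d₀, hc₀, hcd₀, hloc⟩ : ∃ c₀ d₀ : ℝ, 0 < c₀ ∧ c₀ < d₀ ∧
      ∀ z ∈ posRoots Q, z ∈ Set.Ioo c₀ d₀ := by
    rcases (posRoots Q).eq_empty_or_nonempty with he | hne
    · exact ⟨1, 2, one_pos, one_lt_two, by simp [he]⟩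
    · obtain ⟨z, hz, hmin⟩ := (posRoots Q).exists_min_image id hne
      obtain ⟨z', hz', hmax⟩ := (posRoots Q).exists_max_image id hne
      have h0 := ((mem_posRoots hQ).1 hz).1
      have h1 : z ≤ z' := hmin z' hz'
      refine ⟨z / 2, z' + 1, by linarith, by linarith, fun y hy => ⟨?_, ?_⟩⟩
      · have : z ≤ y := hmin y hy
        linarith
      · have : y ≤ z' := hmax y hy
        linarith
  have hmono := strictMonoOn_sqRadius m
  have hd₀ : 0 < d₀ := hc₀.trans hcd₀
  have key : ∀ a b : ℝ, 0 < a → a ≤ sqRadius m c₀ → sqRadius m d₀ ≤ b →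
      ∀ᶠ ε in 𝓝[≠] (0 : ℝ), (limitCyclesIn m P ε a b).encard = posRootCount Q ∧
        ∀ Γ ∈ limitCyclesIn m P ε a b, 1 ≤ cycleMultiplicity m P ε Γ := by
    intro a b ha hac hbd
    have hb : 0 < b := (sqRadius_pos m hd₀).trans_le hbd
    have ha' := sqRadiusInv_pos hm0 ha
    have hb' := sqRadiusInv_pos hm0 hb
    have h1 : sqRadiusInv m a ≤ c₀ := by
      rw [← hmono.le_iff_le (Set.mem_Ici.2 ha'.le) (Set.mem_Ici.2 hc₀.le),
        sqRadius_sqRadiusInv hm0 ha]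
      exact hac
    have h2 : d₀ ≤ sqRadiusInv m b := by
      rw [← hmono.le_iff_le (Set.mem_Ici.2 hd₀.le) (Set.mem_Ici.2 hb'.le),
        sqRadius_sqRadiusInv hm0 hb]
      exact hbd
    obtain ⟨ρ, ε₀, C, Λ, v, R⟩ := exists_returnFamily (m := m) (P := P) ha'
      (h1.trans_lt (hcd₀.trans_le h2))
    have h := R.eventually_encard_eq hm hQ hI hsimple fun z hz =>
      ⟨h1.trans_lt (hloc z hz).1, (hloc z hz).2.trans_le h2⟩
    rwa [sqRadius_sqRadiusInv hm0 ha, sqRadius_sqRadiusInv hm0 hb] at h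
  have hab : sqRadius m c₀ < sqRadius m d₀ := hmono (Set.mem_Ici.2 hc₀.le) (Set.mem_Ici.2 hd₀.le) hcd₀
  refine ⟨⟨sqRadius m c₀, sqRadius m d₀, sqRadius_pos m hc₀, hab, fun a b ha hac hbd => ?_⟩, ?_⟩
  · filter_upwards [key a b ha hac hbd] with ε hε using hε.1
  · refine le_iSup_of_le (sqRadius m c₀) (le_iSup_of_le (sqRadius m d₀)
      (le_iSup_of_le ⟨sqRadius_pos m hc₀, hab⟩ ?_))
    refine le_limsup_of_frequently_le (Eventually.frequently ?_) (by isBoundedDefault)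
    filter_upwards [key _ _ (sqRadius_pos m hc₀) le_rfl le_rfl] with ε hε
    have hfin := Set.finite_of_encard_eq_coe hε.1
    refine le_iSup₂_of_le hfin.toFinset (by simp) ?_
    rw [← hε.1, hfin.encard_eq_coe_toFinset_card]
    have := Finset.card_nsmul_le_sum hfin.toFinset (cycleMultiplicity m P ε) 1
      fun Γ hΓ => hε.2 Γ (by simpa using hΓ)
    simpa using this

end Bifurcation

end PiecewiseCenter

namespace PiecewiseCenter

/-! ### The Melnikov function as an integral over half turns -/

variable {m n : ℕ}

theorem continuous_flow_angle (m : ℕ) (s : ℝ) : Continuous fun t => flow m s t := by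
  unfold flow; fun_prop

theorem continuous_radial_angle (p q : MvPolynomial (Fin 2) ℝ) (s : ℝ) :
    Continuous fun t => radial m p q t s := by
  have h := continuous_flow_angle m s
  exact (h.fst.mul ((continuous_ev p).comp h)).add (h.snd.mul ((continuous_ev q).comp h))

/-- The two parametrizations of the circle differ by the argument of `s + i s ^ m`. -/
theorem exists_flow_eq_circ (m : ℕ) {s : ℝ} (hs : 0 < s) :
    ∃ α : ℝ, ∀ t, flow m s t = circ (sqRadius m s) (t - α) := by
  set z : ℂ := ⟨s, s ^ m⟩ with hz
  have hnorm : ‖z‖ = √(sqRadius m s) := by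
    rw [Complex.norm_def, Complex.normSq_apply, sqRadius]
    congr 1
    simp only [hz]
    ring
  have hz0 : z ≠ 0 := fun h => hs.ne' (congrArg Complex.re h)
  have hc : √(sqRadius m s) * Real.cos z.arg = s := by
    rw [← hnorm, Complex.norm_mul_cos_arg]
  have hsn : √(sqRadius m s) * Real.sin z.arg = s ^ m := by
    rw [← hnorm, Complex.norm_mul_sin_arg]
  refine ⟨z.arg, fun t => ?_⟩
  unfold flow circ
  rw [Real.cos_sub, Real.sin_sub]
  refine Prod.ext ?_ ?_
  · simp only
    linear_combination -Real.cos t * hc - Real.sin t * hsn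
  · simp only
    linear_combination Real.sin t * hc - Real.cos t * hsn

/-- On the orbit `dx = y dt` and `dy = -x dt`, so `q dx - p dy` is `(x p + y q) dt`. The shift of
the parameter is harmless, since the integrand, with the indicator of the region, is `2π`-periodic.
-/
theorem arcIntegral_eq (p q : MvPolynomial (Fin 2) ℝ) {R : Set (ℝ × ℝ)} (hR : MeasurableSet R)
    {s : ℝ} (hs : 0 < s) :
    arcIntegral p q R (sqRadius m s) =
      ∫ t in Set.Ioc 0 (2 * Real.pi) ∩ {t | flow m s t ∈ R}, radial m p q t s := by
  obtain ⟨α, hα⟩ := exists_flow_eq_circ m hs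
  set h := sqRadius m s
  have hcirc : Continuous (circ h) := by unfold circ; fun_prop
  set G : ℝ × ℝ → ℝ := R.indicator fun z => z.1 * ev p z + z.2 * ev q z with hG
  have hd1 : ∀ t, deriv (fun s => (circ h s).1) t = (circ h t).2 := fun t => by
    have : HasDerivAt (fun s => (circ h s).1) (√h * -Real.sin t) t :=
      (Real.hasDerivAt_cos t).const_mul _
    rw [this.deriv]
    simp [circ]
  have hd2 : ∀ t, deriv (fun s => (circ h s).2) t = -(circ h t).1 := fun t => by
    have : HasDerivAt (fun s => (circ h s).2) (-(√h * Real.cos t)) t :=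
      ((Real.hasDerivAt_sin t).const_mul _).neg
    rw [this.deriv]
    simp [circ]
  have h1 : arcIntegral p q R h = ∫ t in 0..2 * Real.pi, G (circ h t) := by
    rw [intervalIntegral.integral_of_le Real.two_pi_pos.le]
    have e1 : ∀ t, G (circ h t) = {t | circ h t ∈ R}.indicator
        (fun t => (circ h t).1 * ev p (circ h t) + (circ h t).2 * ev q (circ h t)) t := by
      intro t
      by_cases ht : circ h t ∈ R
      · simp [hG, ht]
      · simp [hG, ht]
    have hmeas : MeasurableSet {t | circ h t ∈ R} := hcirc.measurable hR
    simp only [e1]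
    rw [setIntegral_indicator hmeas]
    unfold arcIntegral
    congr 1
    ext t
    rw [hd1, hd2]
    ring
  have h2 : ∫ t in 0..2 * Real.pi, G (circ h t) = ∫ t in 0..2 * Real.pi, G (circ h (t - α)) := by
    rw [intervalIntegral.integral_comp_sub_right (fun t => G (circ h t))]
    have hper : Function.Periodic (fun t => G (circ h t)) (2 * Real.pi) := by
      intro t
      simp [circ]
    have := hper.intervalIntegral_add_eq 0 (0 - α)
    rw [zero_add] at this
    rw [this]
    congr 1
    ring
  rw [h1, h2]
  simp only [← hα]
  rw [intervalIntegral.integral_of_le Real.two_pi_pos.le]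
  have e1 : ∀ t, G (flow m s t) = {t | flow m s t ∈ R}.indicator (fun t => radial m p q t s) t := by
    intro t
    by_cases ht : flow m s t ∈ R
    · simp [hG, ht, radial]
    · simp [hG, ht]
  have hmeas : MeasurableSet {t | flow m s t ∈ R} := (continuous_flow_angle m s).measurable hR
  simp only [e1]
  rw [setIntegral_indicator hmeas]

theorem Ioc_inter_sin_pos :
    Set.Ioc 0 (2 * Real.pi) ∩ {t | 0 < Real.sin t} = Set.Ioo 0 Real.pi := by
  ext t
  constructor
  · rintro ⟨⟨h1, h2⟩, h3⟩
    refine ⟨h1, ?_⟩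
    by_contra hc
    push Not at hc
    have h4 := Real.sin_nonneg_of_nonneg_of_le_pi (x := t - Real.pi) (by linarith) (by linarith)
    rw [Real.sin_sub_pi] at h4
    have h3 : 0 < Real.sin t := h3
    linarith
  · rintro ⟨h1, h2⟩
    exact ⟨⟨h1, by linarith [Real.pi_pos]⟩, Real.sin_pos_of_pos_of_lt_pi h1 h2⟩

theorem Ioc_inter_sin_nonpos :
    Set.Ioc 0 (2 * Real.pi) ∩ {t | Real.sin t ≤ 0} = Set.Icc Real.pi (2 * Real.pi) := by
  ext t
  constructor
  · rintro ⟨⟨h1, h2⟩, h3⟩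
    refine ⟨?_, h2⟩
    by_contra hc
    push Not at hc
    exact absurd (Real.sin_pos_of_pos_of_lt_pi h1 hc) (not_lt.2 h3)
  · rintro ⟨h1, h2⟩
    refine ⟨⟨by linarith [Real.pi_pos], h2⟩, ?_⟩
    have h4 := Real.sin_nonneg_of_nonneg_of_le_pi (x := t - Real.pi) (by linarith) (by linarith)
    rw [Real.sin_sub_pi] at h4
    show Real.sin t ≤ 0
    linarith

variable (P : Perturbation n)

theorem melnikov_sqRadius {k : ℕ} (hm : m = 2 * k + 1) {s : ℝ} (hs : 0 < s) :
    melnikov m P (sqRadius m s) = (∫ t in 0..Real.pi, radial m P.pMinus P.qMinus t s)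
      + ∫ t in Real.pi..2 * Real.pi, radial m P.pPlus P.qPlus t s := by
  have hpow : Measurable fun z : ℝ × ℝ => z.1 ^ m := by fun_prop
  unfold melnikov
  rw [arcIntegral_eq _ _ (measurableSet_le hpow measurable_snd) hs,
    arcIntegral_eq _ _ (measurableSet_lt measurable_snd hpow) hs]
  have e1 : {t | flow m s t ∈ {z : ℝ × ℝ | z.1 ^ m ≤ z.2}} = {t | Real.sin t ≤ 0} := by
    ext t; exact flow_above_iff hm hs t
  have e2 : {t | flow m s t ∈ {z : ℝ × ℝ | z.2 < z.1 ^ m}} = {t | 0 < Real.sin t} := by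
    ext t
    have := flow_above_iff hm hs t
    rw [Set.mem_ofPred_eq, Set.mem_ofPred_eq, Set.mem_ofPred_eq, ← not_le, this, not_le]
  rw [e1, e2, Ioc_inter_sin_pos, Ioc_inter_sin_nonpos, integral_Icc_eq_integral_Ioc,
    ← integral_Ioc_eq_integral_Ioo, ← intervalIntegral.integral_of_le Real.pi_pos.le,
    ← intervalIntegral.integral_of_le (by linarith [Real.pi_pos]), add_comm]

/-- The right-hand side is the same as in `melnikov_sqRadius`: the first order term of the
displacement is the Melnikov function divided by `jac`. -/
theorem integral_radial_eq (s : ℝ) :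
    ∫ t in 0..2 * Real.pi, radial m (pAt P t) (qAt P t) t s =
      (∫ t in 0..Real.pi, radial m P.pMinus P.qMinus t s)
      + ∫ t in Real.pi..2 * Real.pi, radial m P.pPlus P.qPlus t s := by
  have e : ∀ t, radial m (pAt P t) (qAt P t) t s =
      {t | 0 < Real.sin t}.indicator (fun t => radial m P.pMinus P.qMinus t s) t
      + {t | Real.sin t ≤ 0}.indicator (fun t => radial m P.pPlus P.qPlus t s) t := by
    intro t
    unfold pAt qAt
    by_cases ht : 0 < Real.sin t
    · simp [ht]
    · simp [ht, not_lt.1 ht]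
  have hm1 : MeasurableSet {t | 0 < Real.sin t} := measurableSet_lt measurable_const Real.measurable_sin
  have hm2 : MeasurableSet {t | Real.sin t ≤ 0} := measurableSet_le Real.measurable_sin measurable_const
  simp only [e]
  rw [intervalIntegral.integral_of_le Real.two_pi_pos.le, integral_add, setIntegral_indicator hm1,
    setIntegral_indicator hm2, Ioc_inter_sin_pos, Ioc_inter_sin_nonpos,
    integral_Icc_eq_integral_Ioc, ← integral_Ioc_eq_integral_Ioo,
    ← intervalIntegral.integral_of_le Real.pi_pos.le,
    ← intervalIntegral.integral_of_le (by linarith [Real.pi_pos])]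
  · exact ((continuous_radial_angle _ _ s).integrableOn_Ioc).indicator hm1
  · exact ((continuous_radial_angle _ _ s).integrableOn_Ioc).indicator hm2

/-! ### Integrals of monomials -/

open Polynomial in
/-- The polynomial `s ^ 2 + s ^ (2 * m)`. -/
noncomputable def hPoly (m : ℕ) : ℝ[X] := X ^ 2 + X ^ (2 * m)

open Polynomial in
/-- The space of all Melnikov polynomials. -/
noncomputable def melnikovSpace (m n : ℕ) : Submodule ℝ ℝ[X] :=
  Submodule.span ℝ ({Q | ∃ r e, r + e ≤ n / 2 ∧ Q = X ^ (2 * r + 1) * hPoly m ^ e} ∪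
    {Q | ∃ r e, r + e ≤ n / 2 ∧ Q = X ^ (m * (2 * r + 1)) * hPoly m ^ e} ∪
    {Q | ∃ l, 1 ≤ l ∧ l ≤ (n + 1) / 2 ∧ Q = hPoly m ^ l})

theorem eval_hPoly (m : ℕ) (s : ℝ) : (hPoly m).eval s = sqRadius m s := by
  simp [hPoly, sqRadius]

theorem flow_add_pi (m : ℕ) (s t : ℝ) : flow m s (t + Real.pi) = -flow m s t := by
  unfold flow
  rw [Real.cos_add_pi, Real.sin_add_pi]
  ext
  · simp only [Prod.fst_neg]; ring
  · simp only [Prod.snd_neg]; ring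

theorem flow_pi (m : ℕ) (s : ℝ) : flow m s Real.pi = (-s, -s ^ m) := by simp [flow]

theorem hasDerivAt_flow_fst (m : ℕ) (s t : ℝ) :
    HasDerivAt (fun t => (flow m s t).1) (flow m s t).2 t := by
  have := ((Real.hasDerivAt_cos t).const_mul s).fun_add ((Real.hasDerivAt_sin t).const_mul (s ^ m))
  refine this.congr_deriv ?_
  simp only [flow]; ring

theorem hasDerivAt_flow_snd (m : ℕ) (s t : ℝ) :
    HasDerivAt (fun t => (flow m s t).2) (-(flow m s t).1) t := by
  have := ((Real.hasDerivAt_sin t).const_mul s).fun_neg.fun_add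
    ((Real.hasDerivAt_cos t).const_mul (s ^ m))
  refine this.congr_deriv ?_
  simp only [flow]; ring

/-- The integral of `x ^ i * y ^ j` over the half turn. -/
noncomputable def halfMoment (m i j : ℕ) (s : ℝ) : ℝ :=
  ∫ t in 0..Real.pi, (flow m s t).1 ^ i * (flow m s t).2 ^ j

/-- Along the rotation `x' = y`, so the integrand is an exact derivative and only the antipodal
endpoints contribute. The next lemma uses `y' = -x`. -/
theorem halfMoment_even_one (m r : ℕ) (s : ℝ) :
    halfMoment m (2 * r) 1 s = -(2 / (2 * r + 1)) * s ^ (2 * r + 1) := by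
  have hne : (2 * (r : ℝ) + 1) ≠ 0 := by positivity
  have hc := continuous_flow_angle m s
  unfold halfMoment
  rw [intervalIntegral.integral_eq_sub_of_hasDerivAt
    (f := fun t => (flow m s t).1 ^ (2 * r + 1) / (2 * r + 1))]
  · simp only [flow_pi, flow_zero]
    rw [Odd.neg_pow ⟨r, rfl⟩]
    ring
  · intro t _
    refine (((hasDerivAt_flow_fst m s t).fun_pow (2 * r + 1)).div_const _).congr_deriv ?_
    push_cast
    field_simp
  · exact ((hc.fst.pow _).mul (hc.snd.pow _)).intervalIntegrable _ _

theorem halfMoment_one_even (m r : ℕ) (s : ℝ) :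
    halfMoment m 1 (2 * r) s = 2 / (2 * r + 1) * s ^ (m * (2 * r + 1)) := by
  have hne : (2 * (r : ℝ) + 1) ≠ 0 := by positivity
  have hc := continuous_flow_angle m s
  unfold halfMoment
  rw [intervalIntegral.integral_eq_sub_of_hasDerivAt
    (f := fun t => -((flow m s t).2 ^ (2 * r + 1) / (2 * r + 1)))]
  · simp only [flow_pi, flow_zero]
    rw [Odd.neg_pow ⟨r, rfl⟩, pow_mul]
    ring
  · intro t _
    refine (((hasDerivAt_flow_snd m s t).fun_pow (2 * r + 1)).div_const _).fun_neg.congr_deriv ?_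
    push_cast
    field_simp
  · exact ((hc.fst.pow _).mul (hc.snd.pow _)).intervalIntegrable _ _

theorem halfMoment_add_two_right (m i j : ℕ) (s : ℝ) :
    halfMoment m i (j + 2) s = sqRadius m s * halfMoment m i j s - halfMoment m (i + 2) j s := by
  have hc := continuous_flow_angle m s
  have hi : ∀ i j, IntervalIntegrable (fun t => (flow m s t).1 ^ i * (flow m s t).2 ^ j) volume 0
      Real.pi := fun i j => ((hc.fst.pow _).mul (hc.snd.pow _)).intervalIntegrable _ _
  unfold halfMoment
  rw [← intervalIntegral.integral_const_mul, ← intervalIntegral.integral_sub ((hi i j).const_mul _)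
    (hi _ _)]
  congr 1
  ext t
  rw [← flow_sq_add_sq m s t]
  ring

theorem halfMoment_add_two_left (m i j : ℕ) (s : ℝ) :
    halfMoment m (i + 2) j s = sqRadius m s * halfMoment m i j s - halfMoment m i (j + 2) s := by
  rw [halfMoment_add_two_right]; ring

/-- A monomial of even degree is `π`-periodic along the circle, so its integral over a half turn
does not depend on the starting angle; only the scaling by the radius remains. -/
theorem exists_halfMoment_of_even (m : ℕ) {i j l : ℕ} (h : i + j = 2 * l) :
    ∃ c : ℝ, ∀ s, 0 < s → halfMoment m i j s = c * sqRadius m s ^ l := by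
  set F : ℝ → ℝ := fun t => Real.cos t ^ i * (-Real.sin t) ^ j with hF
  refine ⟨∫ t in 0..Real.pi, F t, fun s hs => ?_⟩
  obtain ⟨α, hα⟩ := exists_flow_eq_circ m hs
  have hper : Function.Periodic F Real.pi := by
    intro t
    simp only [hF, Real.cos_add_pi, Real.sin_add_pi]
    have : ((-1 : ℝ)) ^ (i + j) = 1 := by rw [h, pow_mul]; simp
    calc (-Real.cos t) ^ i * (- -Real.sin t) ^ j
        = (-1) ^ (i + j) * (Real.cos t ^ i * (-Real.sin t) ^ j) := by
          rw [neg_pow (Real.cos t), neg_pow (-Real.sin t), pow_add]; ring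
      _ = _ := by rw [this, one_mul]
  have h1 : ∀ t, (flow m s t).1 ^ i * (flow m s t).2 ^ j = sqRadius m s ^ l * F (t - α) := by
    intro t
    have hsq : √(sqRadius m s) ^ (i + j) = sqRadius m s ^ l := by
      rw [h, pow_mul, Real.sq_sqrt (sqRadius_pos m hs).le]
    rw [hα, ← hsq, pow_add]
    simp only [circ, hF]
    rw [← mul_neg, mul_pow, mul_pow]
    ring
  unfold halfMoment
  simp only [h1]
  rw [intervalIntegral.integral_const_mul, intervalIntegral.integral_comp_sub_right F, mul_comm]
  congr 1
  have := hper.intervalIntegral_add_eq 0 (0 - α)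
  rw [zero_add] at this
  rw [this]
  congr 1
  ring

-- Induction trading `y ^ 2` for `h - x ^ 2`. The factor `h ^ e` is carried along so that `r + u +
-- e` does not grow. The companion lemma exchanges `x` and `y`.
open Polynomial in
theorem exists_halfMoment_even_odd (m n : ℕ) (u : ℕ) : ∀ r e, r + u + e ≤ n / 2 →
    ∃ Q ∈ melnikovSpace m n, ∀ s, halfMoment m (2 * r) (2 * u + 1) s * sqRadius m s ^ e = Q.eval s := by
  induction u with
  | zero =>
    intro r e h
    refine ⟨-(2 / (2 * r + 1) : ℝ) • (X ^ (2 * r + 1) * hPoly m ^ e), Submodule.smul_mem _ _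
      (Submodule.subset_span (Or.inl (Or.inl ⟨r, e, by omega, rfl⟩))), fun s => ?_⟩
    rw [mul_zero, zero_add, halfMoment_even_one]
    simp [eval_hPoly]
    ring
  | succ u ih =>
    intro r e h
    obtain ⟨Q₁, h₁, e₁⟩ := ih r (e + 1) (by omega)
    obtain ⟨Q₂, h₂, e₂⟩ := ih (r + 1) e (by omega)
    refine ⟨Q₁ - Q₂, Submodule.sub_mem _ h₁ h₂, fun s => ?_⟩
    rw [eval_sub, ← e₁, ← e₂, show 2 * (u + 1) + 1 = 2 * u + 1 + 2 by ring, halfMoment_add_two_right]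
    ring_nf

open Polynomial in
theorem exists_halfMoment_odd_even (m n : ℕ) (u : ℕ) : ∀ r e, r + u + e ≤ n / 2 →
    ∃ Q ∈ melnikovSpace m n, ∀ s, halfMoment m (2 * u + 1) (2 * r) s * sqRadius m s ^ e = Q.eval s := by
  induction u with
  | zero =>
    intro r e h
    refine ⟨(2 / (2 * r + 1) : ℝ) • (X ^ (m * (2 * r + 1)) * hPoly m ^ e), Submodule.smul_mem _ _
      (Submodule.subset_span (Or.inl (Or.inr ⟨r, e, by omega, rfl⟩))), fun s => ?_⟩
    rw [mul_zero, zero_add, halfMoment_one_even]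
    simp [eval_hPoly]
    ring
  | succ u ih =>
    intro r e h
    obtain ⟨Q₁, h₁, e₁⟩ := ih r (e + 1) (by omega)
    obtain ⟨Q₂, h₂, e₂⟩ := ih (r + 1) e (by omega)
    refine ⟨Q₁ - Q₂, Submodule.sub_mem _ h₁ h₂, fun s => ?_⟩
    rw [eval_sub, ← e₁, ← e₂, show 2 * (u + 1) + 1 = 2 * u + 1 + 2 by ring, halfMoment_add_two_left]
    ring_nf

open Polynomial in
theorem exists_halfMoment (m n : ℕ) {i j : ℕ} (h1 : 1 ≤ i + j) (h2 : i + j ≤ n + 1) :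
    ∃ Q ∈ melnikovSpace m n, ∀ s, 0 < s → halfMoment m i j s = Q.eval s := by
  rcases Nat.even_or_odd' (i + j) with ⟨l, hl | hl⟩
  · obtain ⟨c, hc⟩ := exists_halfMoment_of_even m hl
    refine ⟨c • hPoly m ^ l, Submodule.smul_mem _ _ (Submodule.subset_span
      (Or.inr ⟨l, by omega, by omega, rfl⟩)), fun s hs => ?_⟩
    rw [hc s hs]
    simp [eval_hPoly]
  · rcases Nat.even_or_odd' i with ⟨r, hr | hr⟩
    · obtain ⟨Q, hQ, he⟩ := exists_halfMoment_even_odd m n (l - r) r 0 (by omega)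
      refine ⟨Q, hQ, fun s _ => ?_⟩
      rw [← he s, hr, show j = 2 * (l - r) + 1 by omega, pow_zero, mul_one]
    · obtain ⟨Q, hQ, he⟩ := exists_halfMoment_odd_even m n r (l - r) 0 (by omega)
      refine ⟨Q, hQ, fun s _ => ?_⟩
      rw [← he s, hr, show j = 2 * (l - r) by omega, pow_zero, mul_one]

/-- The second half turn is the antipode of the first, so moments change only by a sign. -/
theorem integral_second_half (m i j : ℕ) (s : ℝ) :
    ∫ t in Real.pi..2 * Real.pi, (flow m s t).1 ^ i * (flow m s t).2 ^ j =
      (-1) ^ (i + j) * halfMoment m i j s := by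
  have h := intervalIntegral.integral_comp_add_right (a := 0) (b := Real.pi)
    (fun t => (flow m s t).1 ^ i * (flow m s t).2 ^ j) Real.pi
  rw [zero_add, ← two_mul] at h
  rw [← h, halfMoment, ← intervalIntegral.integral_const_mul]
  congr 1
  ext t
  rw [flow_add_pi, Prod.fst_neg, Prod.snd_neg, neg_pow (flow m s t).1, neg_pow (flow m s t).2, pow_add]
  ring

theorem ev_eq_sum (p : MvPolynomial (Fin 2) ℝ) (z : ℝ × ℝ) :
    ev p z = ∑ d ∈ p.support, p.coeff d * (z.1 ^ d 0 * z.2 ^ d 1) := by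
  unfold ev
  rw [MvPolynomial.eval_eq']
  simp [Fin.prod_univ_two]

theorem add_le_of_mem_support {p : MvPolynomial (Fin 2) ℝ} (hp : p.totalDegree ≤ n)
    {d : Fin 2 →₀ ℕ} (hd : d ∈ p.support) : d 0 + d 1 ≤ n := by
  have h := (MvPolynomial.le_totalDegree hd).trans hp
  rwa [Finsupp.sum_fintype _ _ (fun _ => rfl), Fin.sum_univ_two] at h

/-- If the moments over an interval are in the space, so are the integrals of `radial`. -/
theorem exists_integral_radial {a b : ℝ} (hmom : ∀ i j, 1 ≤ i + j → i + j ≤ n + 1 →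
      ∃ Q ∈ melnikovSpace m n, ∀ s, 0 < s →
        ∫ t in a..b, (flow m s t).1 ^ i * (flow m s t).2 ^ j = Q.eval s)
    {p q : MvPolynomial (Fin 2) ℝ} (hp : p.totalDegree ≤ n) (hq : q.totalDegree ≤ n) :
    ∃ Q ∈ melnikovSpace m n, ∀ s, 0 < s → ∫ t in a..b, radial m p q t s = Q.eval s := by
  have h1 : ∀ d ∈ p.support, ∃ Q ∈ melnikovSpace m n, ∀ s, 0 < s →
      ∫ t in a..b, (flow m s t).1 ^ (d 0 + 1) * (flow m s t).2 ^ (d 1) = Q.eval s := fun d hd =>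
    hmom _ _ (by omega) (by have := add_le_of_mem_support hp hd; omega)
  have h2 : ∀ d ∈ q.support, ∃ Q ∈ melnikovSpace m n, ∀ s, 0 < s →
      ∫ t in a..b, (flow m s t).1 ^ (d 0) * (flow m s t).2 ^ (d 1 + 1) = Q.eval s := fun d hd =>
    hmom _ _ (by omega) (by have := add_le_of_mem_support hq hd; omega)
  choose! Q₁ hQ₁ e₁ using h1
  choose! Q₂ hQ₂ e₂ using h2
  refine ⟨∑ d ∈ p.support, p.coeff d • Q₁ d + ∑ d ∈ q.support, q.coeff d • Q₂ d,
    Submodule.add_mem _ (Submodule.sum_mem _ fun d hd => Submodule.smul_mem _ _ (hQ₁ d hd))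
      (Submodule.sum_mem _ fun d hd => Submodule.smul_mem _ _ (hQ₂ d hd)), fun s hs => ?_⟩
  have hc := continuous_flow_angle m s
  have hi : ∀ (c : ℝ) i j, IntervalIntegrable
      (fun t => c * ((flow m s t).1 ^ i * (flow m s t).2 ^ j)) volume a b :=
    fun c i j => (((hc.fst.pow _).mul (hc.snd.pow _)).const_mul c).intervalIntegrable _ _
  have e : ∀ t, radial m p q t s =
      ∑ d ∈ p.support, p.coeff d * ((flow m s t).1 ^ (d 0 + 1) * (flow m s t).2 ^ (d 1))
      + ∑ d ∈ q.support, q.coeff d * ((flow m s t).1 ^ (d 0) * (flow m s t).2 ^ (d 1 + 1)) := by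
    intro t
    unfold radial
    rw [ev_eq_sum, ev_eq_sum, Finset.mul_sum, Finset.mul_sum]
    congr 1 <;> exact Finset.sum_congr rfl fun d _ => by ring
  simp only [e]
  have hsum : ∀ (r : MvPolynomial (Fin 2) ℝ) (i j : (Fin 2 →₀ ℕ) → ℕ), IntervalIntegrable
      (fun t => ∑ d ∈ r.support, r.coeff d * ((flow m s t).1 ^ i d * (flow m s t).2 ^ j d))
      volume a b := fun r i j => (continuous_finsetSum _ fun d _ =>
    ((hc.fst.pow _).mul (hc.snd.pow _)).const_mul _).intervalIntegrable _ _
  rw [intervalIntegral.integral_add (hsum p _ _) (hsum q _ _),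
    intervalIntegral.integral_finsetSum fun d _ => hi _ _ _,
    intervalIntegral.integral_finsetSum fun d _ => hi _ _ _, Polynomial.eval_add,
    Polynomial.eval_finsetSum, Polynomial.eval_finsetSum]
  congr 1
  · refine Finset.sum_congr rfl fun d hd => ?_
    rw [intervalIntegral.integral_const_mul, e₁ d hd s hs, Polynomial.eval_smul, smul_eq_mul]
  · refine Finset.sum_congr rfl fun d hd => ?_
    rw [intervalIntegral.integral_const_mul, e₂ d hd s hs, Polynomial.eval_smul, smul_eq_mul]

/-- The Melnikov function is a polynomial of the space `melnikovSpace m n` in `s`. -/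
theorem exists_melnikovPolynomial (m : ℕ) (P : Perturbation n) : ∃ Q ∈ melnikovSpace m n,
    ∀ s, 0 < s → (∫ t in 0..Real.pi, radial m P.pMinus P.qMinus t s)
      + ∫ t in Real.pi..2 * Real.pi, radial m P.pPlus P.qPlus t s = Q.eval s := by
  obtain ⟨Q₁, h₁, e₁⟩ := exists_integral_radial (m := m) (a := 0) (b := Real.pi)
    (fun i j => exists_halfMoment m n) P.pMinus_deg P.qMinus_deg
  obtain ⟨Q₂, h₂, e₂⟩ := exists_integral_radial (m := m) (a := Real.pi) (b := 2 * Real.pi)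
    (fun i j hij hij' => by
      obtain ⟨Q, hQ, e⟩ := exists_halfMoment m n hij hij'
      refine ⟨(-1 : ℝ) ^ (i + j) • Q, Submodule.smul_mem _ _ hQ, fun s hs => ?_⟩
      rw [integral_second_half, e s hs, Polynomial.eval_smul, smul_eq_mul]) P.pPlus_deg P.qPlus_deg
  refine ⟨Q₁ + Q₂, Submodule.add_mem _ h₁ h₂, fun s hs => ?_⟩
  rw [e₁ s hs, e₂ s hs, Polynomial.eval_add]

/-! ### Every element of the space is a Melnikov polynomial -/

theorem ev_hMul (r l : ℕ) (c : ℝ) (i : Fin 2) (z : ℝ × ℝ) :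
    ev (MvPolynomial.C c * MvPolynomial.X i ^ r
      * (MvPolynomial.X 0 ^ 2 + MvPolynomial.X 1 ^ 2) ^ l) z =
      c * (![z.1, z.2] i) ^ r * (z.1 ^ 2 + z.2 ^ 2) ^ l := by
  simp [ev]

theorem totalDegree_hMul_le (r l : ℕ) (c : ℝ) (i : Fin 2) :
    (MvPolynomial.C c * MvPolynomial.X i ^ r
      * (MvPolynomial.X 0 ^ 2 + MvPolynomial.X 1 ^ 2) ^ l : MvPolynomial (Fin 2) ℝ).totalDegree
      ≤ r + 2 * l := by
  refine (MvPolynomial.totalDegree_mul _ _).trans (add_le_add ?_ ?_)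
  · refine (MvPolynomial.totalDegree_mul _ _).trans ?_
    rw [MvPolynomial.totalDegree_C, zero_add, MvPolynomial.totalDegree_X_pow]
  · refine (MvPolynomial.totalDegree_pow _ _).trans ?_
    rw [mul_comm]
    refine Nat.mul_le_mul_right _ ((MvPolynomial.totalDegree_add _ _).trans ?_)
    rw [MvPolynomial.totalDegree_X_pow, MvPolynomial.totalDegree_X_pow, max_self]

theorem ev_zero (z : ℝ × ℝ) : ev 0 z = 0 := by simp [ev]

/-- Every element of the space is the Melnikov polynomial of some perturbation. -/
theorem exists_integral_radial_eq {Q : Polynomial ℝ} (hQ : Q ∈ melnikovSpace m n) :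
    ∃ p q : MvPolynomial (Fin 2) ℝ, p.totalDegree ≤ n ∧ q.totalDegree ≤ n ∧
      ∀ s, ∫ t in 0..Real.pi, radial m p q t s = Q.eval s := by
  have hscale : ∀ (i j l : ℕ) (c s : ℝ), ∫ t in 0..Real.pi,
      c * sqRadius m s ^ l * ((flow m s t).1 ^ i * (flow m s t).2 ^ j) =
      c * sqRadius m s ^ l * halfMoment m i j s := fun i j l c s => by
    rw [intervalIntegral.integral_const_mul, halfMoment]
  refine Submodule.span_induction (p := fun Q _ => ∃ p q : MvPolynomial (Fin 2) ℝ,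
    p.totalDegree ≤ n ∧ q.totalDegree ≤ n ∧
      ∀ s, ∫ t in 0..Real.pi, radial m p q t s = Q.eval s) ?_ ?_ ?_ ?_ hQ
  · rintro Q ((⟨r, e, hre, rfl⟩ | ⟨r, e, hre, rfl⟩) | ⟨l, hl1, hl2, rfl⟩)
    -- `q` is a multiple of `x ^ (2 * r) * (x ^ 2 + y ^ 2) ^ e`; its constant inverts the one in
    -- `halfMoment_even_one`. The next case uses `p` in the same way.
    · refine ⟨0, _, by simp, (totalDegree_hMul_le (2 * r) e (-(2 * r + 1) / 2) 0).trans (by omega),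
        fun s => ?_⟩
      have hne : (2 * (r : ℝ) + 1) ≠ 0 := by positivity
      calc _ = ∫ t in 0..Real.pi, -(2 * (r : ℝ) + 1) / 2 * sqRadius m s ^ e *
            ((flow m s t).1 ^ (2 * r) * (flow m s t).2 ^ 1) := by
            congr 1
            ext t
            rw [radial, ev_zero, ev_hMul, flow_sq_add_sq]
            simp only [Matrix.cons_val_zero]
            ring
        _ = _ := by
            rw [hscale, halfMoment_even_one]
            simp only [Polynomial.eval_mul, Polynomial.eval_pow, Polynomial.eval_X, eval_hPoly]
            field_simp
    · refine ⟨_, 0, (totalDegree_hMul_le (2 * r) e ((2 * r + 1) / 2) 1).trans (by omega), by simp,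
        fun s => ?_⟩
      have hne : (2 * (r : ℝ) + 1) ≠ 0 := by positivity
      calc _ = ∫ t in 0..Real.pi, (2 * (r : ℝ) + 1) / 2 * sqRadius m s ^ e *
            ((flow m s t).1 ^ 1 * (flow m s t).2 ^ (2 * r)) := by
            congr 1
            ext t
            rw [radial, ev_zero, ev_hMul, flow_sq_add_sq]
            simp only [Matrix.cons_val_one, Matrix.cons_val_fin_one]
            ring
        _ = _ := by
            rw [hscale, halfMoment_one_even]
            simp only [Polynomial.eval_mul, Polynomial.eval_pow, Polynomial.eval_X, eval_hPoly]
            field_simp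
    -- A purely radial field `(x, y)` times a power of `x ^ 2 + y ^ 2` has constant `radial` part on
    -- the circle; `1 / π` normalizes the length of the half turn.
    · obtain ⟨l, rfl⟩ : ∃ l', l = l' + 1 := ⟨l - 1, by omega⟩
      refine ⟨_, _, (totalDegree_hMul_le 1 l Real.pi⁻¹ 0).trans (by omega),
        (totalDegree_hMul_le 1 l Real.pi⁻¹ 1).trans (by omega), fun s => ?_⟩
      have e : ∀ t, radial m (MvPolynomial.C Real.pi⁻¹ * MvPolynomial.X 0 ^ 1
          * (MvPolynomial.X 0 ^ 2 + MvPolynomial.X 1 ^ 2) ^ l) (MvPolynomial.C Real.pi⁻¹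
          * MvPolynomial.X 1 ^ 1 * (MvPolynomial.X 0 ^ 2 + MvPolynomial.X 1 ^ 2) ^ l) t s =
          Real.pi⁻¹ * sqRadius m s ^ (l + 1) := by
        intro t
        rw [radial, ev_hMul, ev_hMul, flow_sq_add_sq, pow_succ (sqRadius m s)]
        simp only [Matrix.cons_val_zero, Matrix.cons_val_one, Matrix.cons_val_fin_one]
        conv_rhs => rw [← flow_sq_add_sq m s t]
        rw [← flow_sq_add_sq m s t]
        ring
      simp only [e]
      rw [intervalIntegral.integral_const, Polynomial.eval_pow, eval_hPoly, smul_eq_mul, sub_zero,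
        mul_inv_cancel_left₀ Real.pi_ne_zero]
  · exact ⟨0, 0, by simp, by simp, fun s => by simp [radial, ev_zero]⟩
  · rintro Q₁ Q₂ - - ⟨p₁, q₁, hp₁, hq₁, e₁⟩ ⟨p₂, q₂, hp₂, hq₂, e₂⟩
    refine ⟨p₁ + p₂, q₁ + q₂, (MvPolynomial.totalDegree_add _ _).trans (max_le hp₁ hp₂),
      (MvPolynomial.totalDegree_add _ _).trans (max_le hq₁ hq₂), fun s => ?_⟩
    rw [Polynomial.eval_add, ← e₁, ← e₂, ← intervalIntegral.integral_add
      ((continuous_radial_angle _ _ s).intervalIntegrable _ _)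
      ((continuous_radial_angle _ _ s).intervalIntegrable _ _)]
    congr 1
    ext t
    simp only [radial, ev, map_add]
    ring
  · rintro a Q - ⟨p, q, hp, hq, e⟩
    refine ⟨a • p, a • q, (MvPolynomial.totalDegree_smul_le _ _).trans hp,
      (MvPolynomial.totalDegree_smul_le _ _).trans hq, fun s => ?_⟩
    rw [Polynomial.eval_smul, ← e, smul_eq_mul, ← intervalIntegral.integral_const_mul]
    congr 1
    ext t
    simp only [radial, ev, MvPolynomial.smul_eval]
    ring

/-- A perturbation of the lower zone alone already realizes the whole space. -/
theorem exists_perturbation_of_mem {Q : Polynomial ℝ} (hQ : Q ∈ melnikovSpace m n) :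
    ∃ P : Perturbation n, ∀ s, (∫ t in 0..Real.pi, radial m P.pMinus P.qMinus t s)
      + ∫ t in Real.pi..2 * Real.pi, radial m P.pPlus P.qPlus t s = Q.eval s := by
  obtain ⟨p, q, hp, hq, e⟩ := exists_integral_radial_eq hQ
  refine ⟨⟨0, 0, p, q, by simp, by simp, hp, hq⟩, fun s => ?_⟩
  rw [e]
  simp [radial, ev_zero]

end PiecewiseCenter

namespace PiecewiseCenter

/-! ### Counting positive roots -/

open Polynomial

theorem posRootCount_eq_countP (Q : ℝ[X]) : posRootCount Q = Q.roots.countP (0 < ·) := by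
  classical
  rw [Multiset.countP_eq_card_filter, ← Multiset.toFinset_sum_count_eq, Multiset.toFinset_filter]
  refine Finset.sum_congr rfl fun z hz => ?_
  rw [Multiset.count_filter_of_pos (Finset.mem_filter.1 hz).2, count_roots]

/-- Erasing the leading term removes one monomial and at most one sign variation; a single monomial
has none. -/
theorem signVariations_lt_card_support (Q : ℝ[X]) (hQ : Q ≠ 0) :
    Q.signVariations < Q.support.card := by
  induction h : Q.support.card using Nat.strong_induction_on generalizing Q with
  | _ N ih =>
    have h1 := signVariations_le_eraseLead_succ Q
    have h2 := card_support_eraseLead_add_one hQ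
    by_cases h0 : Q.eraseLead = 0
    · have hmon : Q.support.card = 1 := by rw [← h2, h0]; simp
      obtain ⟨d, c, hc, rfl⟩ := card_support_eq_one.1 hmon
      rw [C_mul_X_pow_eq_monomial, signVariations_monomial]
      omega
    · have h3 := ih Q.eraseLead.support.card (by omega) Q.eraseLead h0 rfl
      omega

/-- Descartes' rule of signs, weakened to a count of monomials. -/
theorem posRootCount_lt_card_support {Q : ℝ[X]} (hQ : Q ≠ 0) :
    posRootCount Q < Q.support.card := by
  rw [posRootCount_eq_countP]
  exact (roots_countP_pos_le_signVariations Q).trans_lt (signVariations_lt_card_support Q hQ)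

theorem one_le_rootMultiplicity_of_mem_posRoots {Q : ℝ[X]} (hQ : Q ≠ 0) {z : ℝ}
    (hz : z ∈ posRoots Q) : 1 ≤ Q.rootMultiplicity z :=
  (rootMultiplicity_pos hQ).2 ((mem_posRoots hQ).1 hz).2

theorem card_posRoots_le {Q : ℝ[X]} (hQ : Q ≠ 0) : (posRoots Q).card ≤ posRootCount Q := by
  have := Finset.card_nsmul_le_sum (posRoots Q) (fun z => Q.rootMultiplicity z) 1
    fun z hz => one_le_rootMultiplicity_of_mem_posRoots hQ hz
  simpa [posRootCount] using this

theorem simple_of_posRootCount_le_card {Q : ℝ[X]} (hQ : Q ≠ 0)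
    (h : posRootCount Q ≤ (posRoots Q).card) : ∀ z ∈ posRoots Q, Q.rootMultiplicity z = 1 := by
  have h1 := fun z hz => one_le_rootMultiplicity_of_mem_posRoots hQ (z := z) hz
  have h2 : ∑ z ∈ posRoots Q, 1 = ∑ z ∈ posRoots Q, Q.rootMultiplicity z := by
    refine le_antisymm (Finset.sum_le_sum h1) ?_
    simpa [posRootCount] using h
  exact fun z hz => ((Finset.sum_eq_sum_iff_of_le h1).1 h2 z hz).symm

theorem posRootCount_eq_card_of_simple {Q : ℝ[X]}
    (h : ∀ z ∈ posRoots Q, Q.rootMultiplicity z = 1) : posRootCount Q = (posRoots Q).card := by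
  rw [posRootCount, Finset.sum_congr rfl h]; simp

/-- For every finite set of exponents there is a polynomial with the maximal number of positive
roots. -/
theorem exists_maximal_posRoots (E : Finset ℕ) {D : ℕ} (hE : E.card = D + 1) :
    ∃ p : ℝ[X], p ≠ 0 ∧ p.support = E ∧ posRootCount p = D ∧
      ∀ z ∈ posRoots p, p.rootMultiplicity z = 1 := by
  classical
  -- Evaluation at `1, …, D` on the `D + 1` free coefficients; a kernel element is a nonzero
  -- polynomial with these `D` roots.
  set f : (E → ℝ) →ₗ[ℝ] (Fin D → ℝ) :=
    { toFun := fun a i => ∑ e : E, a e * ((i : ℝ) + 1) ^ (e : ℕ)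
      map_add' := fun a b => by ext i; simp [add_mul, Finset.sum_add_distrib]
      map_smul' := fun c a => by ext i; simp [Finset.mul_sum, mul_assoc] } with hf
  have hker : f.ker ≠ ⊥ := LinearMap.ker_ne_bot_of_finrank_lt (by simp [hE])
  obtain ⟨a, ha, ha0⟩ := Submodule.exists_mem_ne_zero_of_ne_bot hker
  set p : ℝ[X] := ∑ e : E, C (a e) * X ^ (e : ℕ) with hp
  have hcoeff : ∀ e : E, p.coeff e = a e := by
    intro e
    rw [hp, finsetSum_coeff, Finset.sum_eq_single e]
    · simp
    · intro e' _ hne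
      rw [coeff_C_mul_X_pow, if_neg]
      exact fun h => hne (Subtype.ext h.symm)
    · simp
  have hcoeff' : ∀ e, e ∉ E → p.coeff e = 0 := by
    intro e he
    rw [hp, finsetSum_coeff]
    refine Finset.sum_eq_zero fun e' _ => ?_
    rw [coeff_C_mul_X_pow, if_neg]
    rintro rfl
    exact he e'.2
  have hp0 : p ≠ 0 := by
    intro h
    apply ha0
    ext e
    rw [← hcoeff e, h]
    simp
  have hsupp : p.support ⊆ E := fun e he => by
    by_contra hc
    exact mem_support_iff.1 he (hcoeff' e hc)
  have hroots : (Finset.univ : Finset (Fin D)).image (fun i : Fin D => ((i : ℕ) : ℝ) + 1) ⊆ posRoots p := by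
    intro z hz
    obtain ⟨i, -, rfl⟩ := Finset.mem_image.1 hz
    refine (mem_posRoots hp0).2 ⟨by positivity, ?_⟩
    have := congrFun (LinearMap.mem_ker.1 ha) i
    simp only [hf, LinearMap.coe_mk, AddHom.coe_mk, Pi.zero_apply] at this
    rw [hp, eval_finsetSum]
    simpa using this
  have hD : D ≤ (posRoots p).card := by
    have h1 := Finset.card_le_card hroots
    rw [Finset.card_image_of_injective _ (fun (i j : Fin D) h => by
      have h2 : ((i : ℕ) : ℝ) = ((j : ℕ) : ℝ) := by linarith [show ((i : ℕ) : ℝ) + 1 = (j : ℕ) + 1 from h]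
      exact Fin.ext (by exact_mod_cast h2))] at h1
    simpa using h1
  -- At least `D` distinct roots against at most `D + 1` monomials: Descartes forces full support,
  -- exactly `D` roots, and simplicity.
  have h1 := posRootCount_lt_card_support hp0
  have h2 := Finset.card_le_card hsupp
  have h3 := card_posRoots_le hp0
  exact ⟨p, hp0, Finset.eq_of_subset_of_card_le hsupp (by omega), by omega,
    simple_of_posRootCount_le_card hp0 (by omega)⟩

/-! ### Perturbation of the maximal polynomial -/

theorem iteratedDeriv_eval (q : ℝ[X]) (k : ℕ) :
    iteratedDeriv k (fun x => q.eval x) = fun x => (derivative^[k] q).eval x := by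
  induction k with
  | zero => simp
  | succ k ih =>
    rw [iteratedDeriv_succ, ih]
    ext x
    rw [Function.iterate_succ_apply', Polynomial.deriv]

theorem continuous_iterate_derivative_family {ι : Type*} (s : Finset ι) (f : ι → ℝ → ℝ)
    (hf : ∀ i, Continuous (f i)) (p : ι → ℝ[X]) (k : ℕ) :
    Continuous fun w : ℝ × ℝ => (derivative^[k] (∑ i ∈ s, C (f i w.1) * p i)).eval w.2 := by
  simp only [iterate_derivative_sum, iterate_derivative_C_mul, eval_finsetSum, eval_mul, eval_C]
  refine continuous_finsetSum _ fun i _ => ?_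
  exact ((hf i).comp continuous_fst).mul ((Polynomial.continuous _).comp continuous_snd)

theorem tendstoUniformlyOn_iteratedDeriv_family {ι : Type*} (s : Finset ι) (f : ι → ℝ → ℝ)
    (hf : ∀ i, Continuous (f i)) (p : ι → ℝ[X]) (k : ℕ) (c d ν₀ : ℝ) :
    TendstoUniformlyOn (fun ν => iteratedDeriv k fun x => (∑ i ∈ s, C (f i ν) * p i).eval x)
      (iteratedDeriv k fun x => (∑ i ∈ s, C (f i ν₀) * p i).eval x) (𝓝 ν₀) (Set.Icc c d) := by
  rw [tendstoUniformlyOn_iff_tendstoUniformly_comp_coe]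
  have h := continuous_iterate_derivative_family s f hf p k
  have h2 := Continuous.tendstoUniformly (α := ℝ) (β := Set.Icc c d)
    (fun ν x => (derivative^[k] (∑ i ∈ s, C (f i ν) * p i)).eval (x : ℝ))
    (h.comp (continuous_fst.prodMk (continuous_subtype_val.comp continuous_snd))) ν₀
  simp only [iteratedDeriv_eval]
  exact h2

/-- The deformation of `p` in which `X ^ e` is replaced by
`X ^ (e - M * w e) * (X ^ M + ν ^ M) ^ w e`. -/
noncomputable def deform (p : ℝ[X]) (M : ℕ) (w : ℕ → ℕ) (ν : ℝ) : ℝ[X] :=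
  ∑ e ∈ p.support, C (p.coeff e) * (X ^ (e - M * w e) * (X ^ M + C (ν ^ M)) ^ w e)

section Deform

variable {p : ℝ[X]} {M : ℕ} {w : ℕ → ℕ}

theorem deform_zero (hM : 0 < M) (hw : ∀ e ∈ p.support, M * w e + 1 ≤ e) : deform p M w 0 = p := by
  conv_rhs => rw [p.as_sum_support_C_mul_X_pow]
  refine Finset.sum_congr rfl fun e he => ?_
  rw [zero_pow hM.ne', C_0, add_zero, ← pow_mul, ← pow_add, Nat.sub_add_cancel (by
    have := hw e he; omega)]

/-- The expansion shows coefficients that are continuous in `ν`, as needed for convergence of all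
derivatives. -/
theorem deform_eq_sum (p : ℝ[X]) (M : ℕ) (w : ℕ → ℕ) (ν : ℝ) :
    deform p M w ν = ∑ x ∈ p.support.sigma fun e => Finset.range (w e + 1),
      C (p.coeff x.1 * (ν ^ M) ^ (w x.1 - x.2) * (w x.1).choose x.2) *
        X ^ (x.1 - M * w x.1 + M * x.2) := by
  rw [Finset.sum_sigma, deform]
  refine Finset.sum_congr rfl fun e _ => ?_
  rw [add_pow, Finset.mul_sum, Finset.mul_sum]
  refine Finset.sum_congr rfl fun j _ => ?_
  simp only [C_mul, C_pow, pow_add, pow_mul, C_eq_natCast]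
  ring

theorem eval_deform (ν s : ℝ) : (deform p M w ν).eval s =
    ∑ e ∈ p.support, p.coeff e * (s ^ (e - M * w e) * (s ^ M + ν ^ M) ^ w e) := by
  simp [deform, eval_finsetSum]

/-- After division by `s` the expression is jointly continuous in `(ν, s)`, and at the origin only
the term of exponent `1` survives. No root can escape to `0`. -/
theorem eventually_eval_deform_ne_zero_near_zero (hM : 0 < M) (h1 : 1 ∈ p.support)
    (hw : ∀ e ∈ p.support, M * w e + 1 ≤ e) :
    ∃ η > 0, ∀ ν s : ℝ, |ν| < η → 0 < s → s < η → (deform p M w ν).eval s ≠ 0 := by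
  set R : ℝ × ℝ → ℝ := fun z =>
    ∑ e ∈ p.support, p.coeff e * (z.2 ^ (e - M * w e - 1) * (z.2 ^ M + z.1 ^ M) ^ w e) with hR
  have hRc : Continuous R := by
    refine continuous_finsetSum _ fun e _ => ?_
    fun_prop
  have hR0 : R (0, 0) = p.coeff 1 := by
    simp only [hR]
    rw [Finset.sum_eq_single_of_mem 1 h1]
    · have : w 1 = 0 := by
        have := hw 1 h1
        rcases Nat.eq_zero_or_pos (w 1) with h | h
        · exact h
        · have := Nat.mul_pos hM h; omega
      simp [this]
    · intro e he hne
      have h2 := hw e he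
      rcases Nat.eq_zero_or_pos (w e) with h | h
      · rw [h, mul_zero, zero_pow (by omega), zero_mul, mul_zero]
      · rw [zero_pow hM.ne', add_zero, zero_pow h.ne', mul_zero, mul_zero]
  have hne : R (0, 0) ≠ 0 := by rw [hR0]; exact mem_support_iff.1 h1
  have hev := hRc.continuousAt.eventually_ne hne
  obtain ⟨η, hη, hball⟩ := Metric.eventually_nhds_iff.1 hev
  refine ⟨η, hη, fun ν s hν hs hsη h0 => ?_⟩
  have h3 : dist ((ν, s) : ℝ × ℝ) (0, 0) < η := by
    rw [Prod.dist_eq, max_lt_iff]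
    simp only [Real.dist_eq, sub_zero]
    exact ⟨hν, by rwa [abs_of_pos hs]⟩
  apply hball h3
  have h4 : (deform p M w ν).eval s = s * R (ν, s) := by
    rw [eval_deform, hR, Finset.mul_sum]
    refine Finset.sum_congr rfl fun e he => ?_
    have h5 : e - M * w e = (e - M * w e - 1) + 1 := by have := hw e he; omega
    conv_lhs => rw [h5, pow_succ]
    ring
  rw [h4] at h0
  exact (mul_eq_zero.1 h0).resolve_left hs.ne'

/-- The same argument in the variable `1 / s` after division by the top power; at the origin only
the leading coefficient remains. No root comes from infinity. -/
theorem eventually_eval_deform_ne_zero_near_top (hM : 0 < M) (hp : p ≠ 0)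
    (hw : ∀ e ∈ p.support, M * w e + 1 ≤ e) :
    ∃ η > 0, ∀ ν s : ℝ, |ν| < η → η⁻¹ < s → (deform p M w ν).eval s ≠ 0 := by
  set T : ℝ × ℝ → ℝ := fun z =>
    ∑ e ∈ p.support, p.coeff e * (z.2 ^ (p.natDegree - e) * (1 + z.1 ^ M * z.2 ^ M) ^ w e) with hT
  have hTc : Continuous T := by
    refine continuous_finsetSum _ fun e _ => ?_
    fun_prop
  have hT0 : T (0, 0) = p.leadingCoeff := by
    simp only [hT]
    rw [Finset.sum_eq_single_of_mem p.natDegree (natDegree_mem_support_of_nonzero hp)]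
    · simp [hM.ne']
    · intro e he hne
      have h2 := le_natDegree_of_mem_supp e he
      rw [zero_pow (by omega), zero_mul, mul_zero]
  have hne : T (0, 0) ≠ 0 := by rw [hT0]; exact leadingCoeff_ne_zero.2 hp
  have hev := hTc.continuousAt.eventually_ne hne
  obtain ⟨η, hη, hball⟩ := Metric.eventually_nhds_iff.1 hev
  refine ⟨η, hη, fun ν s hν hsη h0 => ?_⟩
  have hs : 0 < s := (inv_pos.2 hη).trans hsη
  have h3 : dist ((ν, s⁻¹) : ℝ × ℝ) (0, 0) < η := by
    rw [Prod.dist_eq, max_lt_iff]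
    simp only [Real.dist_eq, sub_zero]
    exact ⟨hν, by rw [abs_of_pos (inv_pos.2 hs)]; exact inv_lt_of_inv_lt₀ hη hsη⟩
  apply hball h3
  have h4 : (deform p M w ν).eval s = s ^ p.natDegree * T (ν, s⁻¹) := by
    rw [eval_deform, hT, Finset.mul_sum]
    refine Finset.sum_congr rfl fun e he => ?_
    have h5 := le_natDegree_of_mem_supp e he
    have h6 : s ^ p.natDegree * s⁻¹ ^ (p.natDegree - e) = s ^ e := by
      rw [inv_pow, ← div_eq_mul_inv, div_eq_iff (pow_pos hs _).ne', ← pow_add]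
      congr 1
      omega
    have h7 : s ^ e = s ^ (e - M * w e) * (s ^ M) ^ w e := by
      rw [← pow_mul, ← pow_add]
      congr 1
      have := hw e he
      omega
    have h8 : s ^ M * (1 + ν ^ M * s⁻¹ ^ M) = s ^ M + ν ^ M := by
      have := (pow_pos hs M).ne'
      rw [inv_pow]
      field_simp
    calc _ = p.coeff e * (s ^ (e - M * w e) * (s ^ M * (1 + ν ^ M * s⁻¹ ^ M)) ^ w e) := by rw [h8]
      _ = p.coeff e * (s ^ (e - M * w e) * (s ^ M) ^ w e * (1 + ν ^ M * s⁻¹ ^ M) ^ w e) := by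
          rw [mul_pow]; ring
      _ = _ := by rw [← h7, ← h6]; ring
  rw [h4] at h0
  exact (mul_eq_zero.1 h0).resolve_left (ne_of_gt (pow_pos hs _))

/-- Small deformations have the same number of positive roots, all simple. -/
theorem eventually_deform (hM : 0 < M) (hp : p ≠ 0) (h1 : 1 ∈ p.support)
    (hw : ∀ e ∈ p.support, M * w e + 1 ≤ e)
    (hsimple : ∀ z ∈ posRoots p, p.rootMultiplicity z = 1) :
    ∀ᶠ ν in 𝓝 (0 : ℝ), deform p M w ν ≠ 0 ∧ posRootCount (deform p M w ν) = posRootCount p ∧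
      ∀ z ∈ posRoots (deform p M w ν), (deform p M w ν).rootMultiplicity z = 1 := by
  classical
  obtain ⟨η₁, hη₁, hzero⟩ := eventually_eval_deform_ne_zero_near_zero hM h1 hw
  obtain ⟨η₂, hη₂, htop⟩ := eventually_eval_deform_ne_zero_near_top hM hp hw
  have hd0 := deform_zero hM hw
  set c := η₁ / 2 with hc
  set d := η₂⁻¹ + 1 with hd
  have hη₂' : 0 < η₂⁻¹ := inv_pos.2 hη₂
  have hne : ∀ᶠ ν in 𝓝 (0 : ℝ), |ν| < η₁ ∧ |ν| < η₂ := by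
    have ht : Tendsto (fun ν : ℝ => |ν|) (𝓝 0) (𝓝 0) := by
      simpa using continuous_abs.tendsto (0 : ℝ)
    exact (ht.eventually (gt_mem_nhds hη₁)).and (ht.eventually (gt_mem_nhds hη₂))
  -- All positive roots stay in a fixed window, where Rolle semicontinuity bounds their number from
  -- above and persistence of simple zeros from below.
  have hloc : ∀ ν, |ν| < η₁ → |ν| < η₂ → ∀ s, 0 < s → (deform p M w ν).eval s = 0 →
      s ∈ Set.Ioo c d := by
    intro ν hν1 hν2 s hs h0
    constructor
    · by_contra hlt
      push Not at hlt
      exact hzero ν s hν1 hs (by linarith) h0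
    · by_contra hlt
      push Not at hlt
      exact htop ν s hν2 (by linarith) h0
  have hSI : (posRoots p : Set ℝ) ⊆ Set.Ioo c d := fun z hz => by
    obtain ⟨hz0, hz1⟩ := (mem_posRoots hp).1 hz
    exact hloc 0 (by simpa using hη₁) (by simpa using hη₂) z hz0 (by rw [hd0]; exact hz1)
  set g : ℝ → ℝ → ℝ := fun ν x => (deform p M w ν).eval x with hg
  have hg0 : g 0 = fun x => p.eval x := by simp only [hg, hd0]
  have hconv : ∀ k, TendstoUniformlyOn (fun ν => iteratedDeriv k (g ν)) (iteratedDeriv k (g 0))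
      (𝓝 0) (Set.Icc c d) := by
    intro k
    simp only [hg, deform_eq_sum]
    exact tendstoUniformlyOn_iteratedDeriv_family _
      (fun (x : (_ : ℕ) × ℕ) ν => p.coeff x.1 * (ν ^ M) ^ (w x.1 - x.2) * (w x.1).choose x.2)
      (fun x => by fun_prop) _ k c d 0
  have hcont : ∀ ν k, Continuous (iteratedDeriv k (g ν)) := fun ν k => by
    simp only [hg, iteratedDeriv_eval]
    exact Polynomial.continuous _
  have hupper := eventually_sum_vanishingOrder_le (l := 𝓝 (0 : ℝ)) (g := g) (g₀ := g 0)
    (c := c) (d := d) hconv (Eventually.of_forall fun ν k => (hcont ν k).continuousOn)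
    (fun k => (hcont 0 k).continuousOn) (posRoots p)
    (fun x hx h0 => by
      rw [hg0] at h0
      exact (mem_posRoots hp).2 ⟨by linarith [hx.1], h0⟩)
    (fun x hx => Set.Ioo_subset_Icc_self (hSI hx)) (fun z => p.rootMultiplicity z)
    (fun z hz => by
      rw [hg0]
      exact iteratedDeriv_ne_zero_of_analyticOrderAt (analyticAt_eval p z) (analyticOrderAt_eval hp z))
  obtain ⟨r, hr, hsep⟩ := exists_separating_radius (posRoots p)
  have hlower := eventually_exists_zeros (l := 𝓝 (0 : ℝ)) (g := g) (g₀ := g 0) (c := c) (d := d)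
    (fun x hx => by
      have := (hconv 0).tendsto_at (Set.Ioo_subset_Icc_self hx)
      simpa only [iteratedDeriv_zero] using this)
    (Eventually.of_forall fun ν => (Polynomial.continuous _).continuousOn) (posRoots p) hSI
    (fun z hz => by rw [hg0]; exact ((mem_posRoots hp).1 hz).2)
    (fun z hz => by
      have h2 := iteratedDeriv_ne_zero_of_analyticOrderAt (analyticAt_eval p z)
        (analyticOrderAt_eval hp z)
      rw [hsimple z hz, iteratedDeriv_one] at h2
      rw [hg0]
      exact ⟨_, h2, (analyticAt_eval p z).differentiableAt.hasDerivAt⟩)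
    -- The bound `c` keeps the displaced roots positive, since the original ones exceed `c`.
    (r := min r c) (lt_min hr (by linarith))
  filter_upwards [hne, hupper, hlower] with ν hν hup hlow
  have hq0 : deform p M w ν ≠ 0 := by
    intro h
    exact hzero ν c hν.1 (by linarith) (by linarith) (by rw [h, eval_zero])
  have hmem : ∀ z ∈ posRoots (deform p M w ν), z ∈ Set.Ioo c d := fun z hz => by
    obtain ⟨hz0, hz1⟩ := (mem_posRoots hq0).1 hz
    exact hloc ν hν.1 hν.2 z hz0 hz1
  have hle : posRootCount (deform p M w ν) ≤ posRootCount p := by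
    have h2 := hup (posRoots (deform p M w ν)) fun z hz => Set.Ioo_subset_Icc_self (hmem z hz)
    have h3 : ∑ z ∈ posRoots (deform p M w ν), vanishingOrder (g ν) z =
        (posRootCount (deform p M w ν) : ℕ∞) := by
      rw [posRootCount, Nat.cast_sum]
      refine Finset.sum_congr rfl fun z _ => ?_
      rw [vanishingOrder_eq_analyticOrderAt (analyticAt_eval _ z), analyticOrderAt_eval hq0]
    rw [h3] at h2
    exact_mod_cast h2
  have hge : posRootCount p ≤ (posRoots (deform p M w ν)).card := by
    rw [posRootCount_eq_card_of_simple hsimple]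
    choose! y hy hy0 using hlow
    refine Finset.card_le_card_of_injOn y (fun z hz => ?_) fun z hz z' hz' h =>
      hsep z hz z' hz' (y z) ((hy z hz).trans_le (min_le_left _ _))
        (by rw [h]; exact (hy z' hz').trans_le (min_le_left _ _))
    have h2 := abs_lt.1 ((hy z hz).trans_le (min_le_right _ _))
    have h3 := (hSI hz).1
    exact (mem_posRoots hq0).2 ⟨by linarith [h2.1], hy0 z hz⟩
  have h4 := card_posRoots_le hq0
  exact ⟨hq0, by omega, simple_of_posRootCount_le_card hq0 (by omega)⟩

end Deform

/-! ### Scaling of the variable -/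

theorem rootMultiplicity_comp_mul {q : ℝ[X]} (hq : q ≠ 0) {ν : ℝ} (hν : ν ≠ 0) (z : ℝ) :
    q.comp (C ν * X) ≠ 0 ∧ (q.comp (C ν * X)).rootMultiplicity z = q.rootMultiplicity (ν * z) := by
  have h0 : q.comp (C ν * X) ≠ 0 := by
    intro h
    apply hq
    have : (q.comp (C ν * X)).comp (C ν⁻¹ * X) = q := by
      rw [comp_assoc]
      simp only [mul_comp, C_comp, X_comp]
      rw [← mul_assoc, ← C_mul, mul_inv_cancel₀ hν, C_1, one_mul, comp_X]
    rw [← this, h, zero_comp]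
  refine ⟨h0, ?_⟩
  have h1 := analyticOrderAt_eval h0 z
  have h2 : (fun x => (q.comp (C ν * X)).eval x) = (fun x => q.eval x) ∘ fun x => ν * x := by
    ext x; simp
  have h3 : HasDerivAt (fun x : ℝ => ν * x) (ν * 1) z := (hasDerivAt_id z).const_mul ν
  rw [h2, analyticOrderAt_comp_of_deriv_ne_zero (by fun_prop)
    (by rw [h3.deriv, mul_one]; exact hν), analyticOrderAt_eval hq] at h1
  exact_mod_cast h1.symm

theorem posRoots_comp_mul {q : ℝ[X]} (hq : q ≠ 0) {ν : ℝ} (hν : 0 < ν)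
    (hsimple : ∀ z ∈ posRoots q, q.rootMultiplicity z = 1) :
    posRootCount (q.comp (C ν * X)) = posRootCount q ∧
      ∀ z ∈ posRoots (q.comp (C ν * X)), (q.comp (C ν * X)).rootMultiplicity z = 1 := by
  have h0 := (rootMultiplicity_comp_mul hq hν.ne' 0).1
  have hmem : ∀ z, z ∈ posRoots (q.comp (C ν * X)) ↔ ν * z ∈ posRoots q := fun z => by
    rw [mem_posRoots h0, mem_posRoots hq]
    simp [hν]
  have hs : ∀ z ∈ posRoots (q.comp (C ν * X)), (q.comp (C ν * X)).rootMultiplicity z = 1 :=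
    fun z hz => by
      rw [(rootMultiplicity_comp_mul hq hν.ne' z).2]
      exact hsimple _ ((hmem z).1 hz)
  refine ⟨?_, hs⟩
  rw [posRootCount_eq_card_of_simple hsimple, posRootCount_eq_card_of_simple hs]
  refine Finset.card_bij (fun z _ => ν * z) (fun z hz => (hmem z).1 hz)
    (fun z _ z' _ h => mul_left_cancel₀ hν.ne' h) fun y hy => ⟨ν⁻¹ * y, ?_, ?_⟩
  · rw [hmem, mul_inv_cancel_left₀ hν.ne']; exact hy
  · rw [mul_inv_cancel_left₀ hν.ne']

end PiecewiseCenter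

namespace PiecewiseCenter

/-! ### The exponents of the Melnikov polynomials -/

open Polynomial

/-- The indices `(j, i)` with `i < 2 * k + 1` for which `2 * (i + (2 * k + 1) * j) + 1` occurs. -/
def oddIndices (k N : ℕ) : Finset ((_ : ℕ) × ℕ) :=
  (Finset.range (N + 1)).sigma fun j =>
    (Finset.range (2 * k + 1)).filter fun i => i + j ≤ N ∨ (k ≤ i ∧ i + j ≤ k + N)

/-- The odd exponents of the Melnikov polynomials. -/
def oddExponents (k N : ℕ) : Finset ℕ :=
  (oddIndices k N).image fun x => 2 * (x.2 + (2 * k + 1) * x.1) + 1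

/-- The indices `(j, i)` with `i < m` for which `2 * (i + m * j)` may occur. -/
def evenIndices (m L : ℕ) : Finset ((_ : ℕ) × ℕ) :=
  (Finset.range (L + 1)).sigma fun j => (Finset.range m).filter fun i => i + j ≤ L

/-- The even exponents of the Melnikov polynomials. -/
def evenExponents (m L : ℕ) : Finset ℕ :=
  ((evenIndices m L).image fun x => 2 * (x.2 + m * x.1)).erase 0

theorem eq_and_eq_of_add_mul_eq {m i j i' j' : ℕ} (hi : i < m) (hi' : i' < m)
    (h : i + m * j = i' + m * j') : i = i' ∧ j = j' := by
  have h1 : (i + m * j) % m = i := by rw [Nat.add_mul_mod_self_left, Nat.mod_eq_of_lt hi]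
  have h2 : (i' + m * j') % m = i' := by rw [Nat.add_mul_mod_self_left, Nat.mod_eq_of_lt hi']
  have h3 : i = i' := by rw [← h1, h, h2]
  subst h3
  have hm : 0 < m := by omega
  exact ⟨rfl, Nat.eq_of_mul_eq_mul_left hm (by omega)⟩

/-- For `t ≤ k` the two intervals of length `t` are disjoint inside the range; for `t > k` they
cover it. In `card_oddExponents` the index `j` corresponds to `t = N - j + 1`. -/
theorem card_oddIndices_fiber (k t : ℕ) :
    ((Finset.range (2 * k + 1)).filter fun i => i < t ∨ (k ≤ i ∧ i < k + t)).card =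
      min (2 * t) (2 * k + 1) := by
  rcases le_or_gt t k with h | h
  · have : ((Finset.range (2 * k + 1)).filter fun i => i < t ∨ (k ≤ i ∧ i < k + t)) =
        Finset.range t ∪ Finset.Ico k (k + t) := by
      ext i
      simp only [Finset.mem_filter, Finset.mem_range, Finset.mem_union, Finset.mem_Ico]
      omega
    rw [this, Finset.card_union_of_disjoint, Finset.card_range, Nat.card_Ico, min_eq_left (by omega)]
    · omega
    · rw [Finset.disjoint_left]
      intro i hi hi'
      simp only [Finset.mem_range, Finset.mem_Ico] at hi hi'
      omega
  · rw [Finset.filter_true_of_mem, Finset.card_range, min_eq_right (by omega)]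
    intro i hi
    rw [Finset.mem_range] at hi
    omega

theorem card_oddExponents (k N : ℕ) :
    (oddExponents k N).card = ∑ t ∈ Finset.range (N + 1), min (2 * (t + 1)) (2 * k + 1) := by
  unfold oddExponents
  rw [Finset.card_image_of_injOn, oddIndices, Finset.card_sigma,
    ← Finset.sum_range_reflect]
  · refine Finset.sum_congr rfl fun j hj => ?_
    rw [Finset.mem_range] at hj
    rw [← card_oddIndices_fiber]
    congr 1
    ext i
    simp only [Finset.mem_filter, Finset.mem_range]
    omega
  · rintro ⟨j, i⟩ hx ⟨j', i'⟩ hx' h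
    simp only [oddIndices, Finset.coe_sigma, Set.mem_sigma_iff, Finset.mem_coe, Finset.mem_filter,
      Finset.mem_range] at hx hx'
    have h' : i + (2 * k + 1) * j = i' + (2 * k + 1) * j' := by simp only at h; omega
    obtain ⟨rfl, rfl⟩ := eq_and_eq_of_add_mul_eq hx.2.1 hx'.2.1 h'
    rfl

theorem sum_min_odd_le {k M : ℕ} (h : M ≤ k) :
    ∑ t ∈ Finset.range M, min (2 * (t + 1)) (2 * k + 1) = M * (M + 1) := by
  induction M with
  | zero => simp
  | succ M ih =>
    rw [Finset.sum_range_succ, ih (by omega), min_eq_left (by omega)]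
    ring

theorem sum_min_odd_add (k j : ℕ) :
    ∑ t ∈ Finset.range (k + j), min (2 * (t + 1)) (2 * k + 1) = k * (k + 1) + j * (2 * k + 1) := by
  induction j with
  | zero => rw [Nat.add_zero, sum_min_odd_le le_rfl]; ring
  | succ j ih =>
    rw [← Nat.add_assoc, Finset.sum_range_succ, ih, min_eq_right (by omega)]
    ring

theorem card_oddExponents_of_lt {k N : ℕ} (h : N + 1 ≤ k) :
    (oddExponents k N).card = (N + 1) * (N + 2) := by
  rw [card_oddExponents, sum_min_odd_le h]

theorem card_oddExponents_of_le {k N : ℕ} (h : k ≤ N) :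
    (oddExponents k N).card + k ^ 2 = (2 * k + 1) * (N + 1) := by
  obtain ⟨j, rfl⟩ := Nat.exists_eq_add_of_le h
  rw [card_oddExponents, Nat.add_assoc, sum_min_odd_add]
  ring

/-- The `+ 1` accounts for the exponent `0` of the index `(0, 0)`, which is erased because only
powers `h ^ l` with `l ≥ 1` occur. -/
theorem card_evenExponents_add_one_le {m L : ℕ} (hm : 0 < m) :
    (evenExponents m L).card + 1 ≤ ∑ t ∈ Finset.range (L + 1), min (t + 1) m := by
  unfold evenExponents
  rw [Finset.card_erase_add_one]
  · refine Finset.card_image_le.trans ?_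
    rw [evenIndices, Finset.card_sigma, ← Finset.sum_range_reflect]
    refine Finset.sum_le_sum fun j hj => ?_
    rw [Finset.mem_range] at hj
    refine le_min ?_ ((Finset.card_filter_le _ _).trans (by simp))
    have : (Finset.range m).filter (fun i => i + (L + 1 - 1 - j) ≤ L) ⊆ Finset.range (j + 1) := by
      intro i hi
      simp only [Finset.mem_filter, Finset.mem_range] at hi ⊢
      omega
    exact (Finset.card_le_card this).trans_eq (Finset.card_range _)
  · refine Finset.mem_image.2 ⟨⟨0, 0⟩, ?_, by simp⟩
    simp [evenIndices, hm]

theorem two_mul_sum_min_le (m M : ℕ) :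
    2 * ∑ t ∈ Finset.range M, min (t + 1) m ≤ M * (M + 1) := by
  induction M with
  | zero => simp
  | succ M ih =>
    rw [Finset.sum_range_succ, mul_add]
    have := min_le_left (M + 1) m
    nlinarith

theorem two_mul_sum_min_add_le (m j : ℕ) :
    2 * ∑ t ∈ Finset.range (m + j), min (t + 1) m ≤ m * (m + 1) + 2 * j * m := by
  induction j with
  | zero => simpa using two_mul_sum_min_le m m
  | succ j ih =>
    rw [← Nat.add_assoc, Finset.sum_range_succ, mul_add]
    have := min_le_right (m + j + 1) m
    nlinarith

theorem div_add_mod_le {m i : ℕ} (hm : 0 < m) : i % m + i / m ≤ i := by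
  have h1 := Nat.mod_add_div i m
  have h2 : 1 * (i / m) ≤ m * (i / m) := Nat.mul_le_mul_right _ hm
  omega

/-- If `i` exceeds the digit range, its quotient by `2 * k + 1` is carried to `j`; the carry does
not increase the digit sum. -/
theorem mem_oddExponents_left {k N i j : ℕ} (h : i + j ≤ N) :
    2 * (i + (2 * k + 1) * j) + 1 ∈ oddExponents k N := by
  have h1 := div_add_mod_le (m := 2 * k + 1) (i := i) (by omega)
  have h2 := Nat.mod_lt i (show 0 < 2 * k + 1 by omega)
  have h3 := Nat.mod_add_div i (2 * k + 1)
  refine Finset.mem_image.2 ⟨⟨j + i / (2 * k + 1), i % (2 * k + 1)⟩, ?_, ?_⟩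
  · simp only [oddIndices, Finset.mem_sigma, Finset.mem_range, Finset.mem_filter]
    omega
  · have := Nat.mul_add (2 * k + 1) j (i / (2 * k + 1))
    simp only
    omega

/-- The shift by `k` overflows only when `i ≥ k + 1`. Then one carry brings the index into the first
family with the same digit sum bound. -/
theorem mem_oddExponents_right {k N i j : ℕ} (h : i + j ≤ N) :
    2 * (i + k + (2 * k + 1) * j) + 1 ∈ oddExponents k N := by
  rcases lt_or_ge i (k + 1) with hi | hi
  · refine Finset.mem_image.2 ⟨⟨j, i + k⟩, ?_, rfl⟩
    simp only [oddIndices, Finset.mem_sigma, Finset.mem_range, Finset.mem_filter]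
    omega
  · have := mem_oddExponents_left (k := k) (N := N) (i := i - (k + 1)) (j := j + 1) (by omega)
    convert this using 2
    have := Nat.mul_add (2 * k + 1) j 1
    omega

theorem mem_evenExponents {m L i j : ℕ} (hm : 0 < m) (h1 : 1 ≤ i + j) (h : i + j ≤ L) :
    2 * (i + m * j) ∈ evenExponents m L := by
  have h2 := div_add_mod_le (m := m) (i := i) hm
  have h3 := Nat.mod_lt i hm
  have h4 := Nat.mod_add_div i m
  refine Finset.mem_erase.2 ⟨?_, Finset.mem_image.2 ⟨⟨j + i / m, i % m⟩, ?_, ?_⟩⟩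
  · rcases Nat.eq_zero_or_pos i with hi | hi
    · have := Nat.mul_pos hm (show 0 < j by omega)
      omega
    · omega
  · simp only [evenIndices, Finset.mem_sigma, Finset.mem_range, Finset.mem_filter]
    omega
  · have := Nat.mul_add m j (i / m)
    simp only
    omega

theorem odd_of_mem_oddExponents {k N e : ℕ} (h : e ∈ oddExponents k N) : Odd e := by
  obtain ⟨x, -, rfl⟩ := Finset.mem_image.1 h
  exact ⟨_, rfl⟩

/-! ### Upper bound for the number of exponents -/

/-- The polynomials all of whose exponents lie in `E`. -/
def supportedIn (E : Finset ℕ) : Submodule ℝ ℝ[X] where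
  carrier := {Q | Q.support ⊆ E}
  add_mem' := fun {p q} hp hq => support_add.trans (Finset.union_subset hp hq)
  zero_mem' := by simp
  smul_mem' := fun c p hp => (support_smul c p).trans hp

theorem X_pow_mem_supportedIn {E : Finset ℕ} {e : ℕ} (he : e ∈ E) :
    (X ^ e : ℝ[X]) ∈ supportedIn E := by
  show (X ^ e : ℝ[X]).support ⊆ E
  rw [support_X_pow]
  simpa using he

theorem mul_hPoly_pow_mem_supportedIn {E : Finset ℕ} {m a l : ℕ}
    (h : ∀ j ≤ l, a + 2 * j + 2 * m * (l - j) ∈ E) : X ^ a * hPoly m ^ l ∈ supportedIn E := by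
  rw [hPoly, add_pow, Finset.mul_sum]
  refine Submodule.sum_mem _ fun j hj => ?_
  rw [Finset.mem_range] at hj
  have e : (X ^ a * ((X ^ 2) ^ j * (X ^ (2 * m)) ^ (l - j) * (l.choose j : ℝ[X]))) =
      (l.choose j : ℝ) • (X ^ (a + 2 * j + 2 * m * (l - j)) : ℝ[X]) := by
    rw [smul_eq_C_mul, C_eq_natCast, ← pow_mul, ← pow_mul, pow_add, pow_add]
    ring
  rw [e]
  exact Submodule.smul_mem _ _ (X_pow_mem_supportedIn (h j (by omega)))

/-- Binomial expansion of the generators; the second family falls into the shifted indices because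
`m * (2 * r + 1) = 2 * (k + m * r) + 1`. -/
theorem support_subset_of_mem_melnikovSpace {k m n : ℕ} (hm : m = 2 * k + 1) {Q : ℝ[X]}
    (hQ : Q ∈ melnikovSpace m n) :
    Q.support ⊆ oddExponents k (n / 2) ∪ evenExponents m ((n + 1) / 2) := by
  have hle : melnikovSpace m n ≤
      supportedIn (oddExponents k (n / 2) ∪ evenExponents m ((n + 1) / 2)) := by
    refine Submodule.span_le.2 ?_
    rintro Q ((⟨r, e, hre, rfl⟩ | ⟨r, e, hre, rfl⟩) | ⟨l, hl1, hl2, rfl⟩)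
    · refine mul_hPoly_pow_mem_supportedIn fun j hj => Finset.mem_union_left _ ?_
      have := mem_oddExponents_left (k := k) (N := n / 2) (i := r + j) (j := e - j) (by omega)
      convert this using 1
      rw [hm]; ring
    · refine mul_hPoly_pow_mem_supportedIn fun j hj => Finset.mem_union_left _ ?_
      have := mem_oddExponents_right (k := k) (N := n / 2) (i := j) (j := r + (e - j)) (by omega)
      convert this using 1
      rw [hm]; ring
    · have : hPoly m ^ l = X ^ 0 * hPoly m ^ l := by rw [pow_zero, one_mul]
      rw [this]
      refine mul_hPoly_pow_mem_supportedIn fun j hj => Finset.mem_union_right _ ?_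
      have := mem_evenExponents (m := m) (L := (n + 1) / 2) (i := j) (j := l - j) (by omega)
        (by omega) (by omega)
      convert this using 1
      ring
  exact hle hQ

theorem posRootCount_lt_of_mem_melnikovSpace {k m n : ℕ} (hm : m = 2 * k + 1) {Q : ℝ[X]}
    (hQ : Q ∈ melnikovSpace m n) (h0 : Q ≠ 0) :
    posRootCount Q < (oddExponents k (n / 2)).card + (evenExponents m ((n + 1) / 2)).card :=
  (posRootCount_lt_card_support h0).trans_le
    ((Finset.card_le_card (support_subset_of_mem_melnikovSpace hm hQ)).trans
      (Finset.card_union_le _ _))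

/-! ### A Melnikov polynomial with many simple positive roots -/

/-- Induction through `X ^ (2 * m) = h - X ^ 2`, the converse of the binomial expansion. The lemma
after it uses `X ^ 2 = h - X ^ (2 * m)`. -/
theorem X_pow_mul_mem_left (m n : ℕ) (j : ℕ) : ∀ i e, i + j + e ≤ n / 2 →
    X ^ (2 * i + 1) * X ^ (2 * m * j) * hPoly m ^ e ∈ melnikovSpace m n := by
  induction j with
  | zero =>
    intro i e h
    rw [mul_zero, pow_zero, mul_one]
    exact Submodule.subset_span (Or.inl (Or.inl ⟨i, e, by omega, rfl⟩))
  | succ j ih =>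
    intro i e h
    have h1 := ih i (e + 1) (by omega)
    have h2 := ih (i + 1) e (by omega)
    convert Submodule.sub_mem _ h1 h2 using 1
    rw [pow_succ (hPoly m)]
    conv_rhs => rw [show hPoly m ^ e * hPoly m = hPoly m ^ e * (X ^ 2 + X ^ (2 * m)) from rfl]
    ring

theorem X_pow_mul_mem_right (m n : ℕ) (i : ℕ) : ∀ j e, i + j + e ≤ n / 2 →
    X ^ (m * (2 * j + 1)) * X ^ (2 * i) * hPoly m ^ e ∈ melnikovSpace m n := by
  induction i with
  | zero =>
    intro j e h
    rw [mul_zero, pow_zero, mul_one]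
    exact Submodule.subset_span (Or.inl (Or.inr ⟨j, e, by omega, rfl⟩))
  | succ i ih =>
    intro j e h
    have h1 := ih j (e + 1) (by omega)
    have h2 := ih (j + 1) e (by omega)
    convert Submodule.sub_mem _ h1 h2 using 1
    rw [pow_succ (hPoly m)]
    conv_rhs => rw [show hPoly m ^ e * hPoly m = hPoly m ^ e * (X ^ 2 + X ^ (2 * m)) from rfl]
    ring

/-- Every admissible odd monomial is itself available, so the odd part of the polynomial can be
prescribed freely. -/
theorem X_pow_mem_melnikovSpace {k m n e : ℕ} (hm : m = 2 * k + 1)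
    (he : e ∈ oddExponents k (n / 2)) : (X ^ e : ℝ[X]) ∈ melnikovSpace m n := by
  obtain ⟨⟨j, i⟩, hx, rfl⟩ := Finset.mem_image.1 he
  simp only [oddIndices, Finset.mem_sigma, Finset.mem_range, Finset.mem_filter] at hx
  obtain ⟨hj, hi, h | ⟨h1, h2⟩⟩ := hx
  · have := X_pow_mul_mem_left m n j i 0 (by omega)
    rw [pow_zero, mul_one, ← pow_add] at this
    convert this using 2
    rw [hm]; ring
  · have := X_pow_mul_mem_right m n (i - k) j 0 (by omega)
    rw [pow_zero, mul_one, ← pow_add] at this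
    convert this using 2
    obtain ⟨i', rfl⟩ := Nat.exists_eq_add_of_le h1
    rw [Nat.add_sub_cancel_left, hm]; ring

/-- The exponents of the limit polynomial: the odd exponents and the multiples of `2 * m`. -/
def limitExponents (k m n : ℕ) : Finset ℕ :=
  oddExponents k (n / 2) ∪ (Finset.Icc 1 ((n + 1) / 2)).image fun l => 2 * m * l

theorem card_limitExponents (k n : ℕ) {m : ℕ} (hm : 0 < m) :
    (limitExponents k m n).card = (oddExponents k (n / 2)).card + (n + 1) / 2 := by
  rw [limitExponents, Finset.card_union_of_disjoint, Finset.card_image_of_injective]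
  · simp
  · exact fun a b h => Nat.eq_of_mul_eq_mul_left (by omega) h
  · rw [Finset.disjoint_left]
    intro e he he'
    obtain ⟨l, -, rfl⟩ := Finset.mem_image.1 he'
    have := odd_of_mem_oddExponents he
    rw [mul_assoc] at this
    exact absurd this (Nat.not_odd_iff_even.2 (even_two_mul _))

theorem one_mem_oddExponents (k N : ℕ) : 1 ∈ oddExponents k N := by
  simpa using mem_oddExponents_left (k := k) (N := N) (i := 0) (j := 0) (by omega)

/-- As many simple positive roots as the odd monomials and the powers `h ^ l` allow by count, minus
one. The powers are not monomials, so Descartes' extremal polynomial is reached by a limit: far from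
the origin `h ^ l` behaves like `X ^ (2 * m * l)`. -/
theorem exists_mem_melnikovSpace_simple {k m n : ℕ} (hm : m = 2 * k + 1) :
    ∃ Q ∈ melnikovSpace m n, Q ≠ 0 ∧ (∀ z ∈ posRoots Q, Q.rootMultiplicity z = 1) ∧
      posRootCount Q + 1 = (oddExponents k (n / 2)).card + (n + 1) / 2 := by
  classical
  have hm0 : 0 < m := by omega
  have h1 := one_mem_oddExponents k (n / 2)
  have hcard := card_limitExponents k n hm0
  have hpos : 0 < (oddExponents k (n / 2)).card := Finset.card_pos.2 ⟨1, h1⟩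
  obtain ⟨p, hp0, hsupp, hcount, hsimple⟩ := exists_maximal_posRoots (limitExponents k m n)
    (D := (oddExponents k (n / 2)).card + (n + 1) / 2 - 1) (by omega)
  have hmem : ∀ e ∈ p.support, e ∈ oddExponents k (n / 2) ∨
      ∃ l, 1 ≤ l ∧ l ≤ (n + 1) / 2 ∧ e = 2 * m * l := by
    intro e he
    rw [hsupp, limitExponents, Finset.mem_union] at he
    refine he.imp_right fun h => ?_
    obtain ⟨l, hl, rfl⟩ := Finset.mem_image.1 h
    exact ⟨l, (Finset.mem_Icc.1 hl).1, (Finset.mem_Icc.1 hl).2, rfl⟩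
  have hh : ∀ l, 1 ≤ l → l ≤ (n + 1) / 2 → hPoly m ^ l ∈ melnikovSpace m n := fun l h1 h2 =>
    Submodule.subset_span (Or.inr ⟨l, h1, h2, rfl⟩)
  rcases Nat.eq_zero_or_pos k with hk | hk
  -- For `m = 1` one has `h = 2 X ^ 2`, a monomial, and no deformation is needed.
  · refine ⟨p, ?_, hp0, hsimple, by omega⟩
    rw [p.as_sum_support_C_mul_X_pow]
    refine Submodule.sum_mem _ fun e he => ?_
    rw [← smul_eq_C_mul]
    refine Submodule.smul_mem _ _ ?_
    rcases hmem e he with h | ⟨l, hl1, hl2, rfl⟩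
    · exact X_pow_mem_melnikovSpace hm h
    · have h2 := Submodule.smul_mem _ ((2 : ℝ) ^ l)⁻¹ (hh l hl1 hl2)
      convert h2 using 1
      have hm1 : m = 1 := by omega
      have h3 : hPoly m = C (2 : ℝ) * X ^ 2 := by
        rw [hPoly, hm1, ← two_mul]
        rfl
      rw [h3, hm1, mul_pow, ← C_pow, smul_eq_C_mul, ← mul_assoc, ← C_mul,
        inv_mul_cancel₀ (by positivity), C_1, one_mul, ← pow_mul]
  -- `h = X ^ 2 * (X ^ M + 1)`. The weight `w` is `l` on the exponent `2 * m * l` and zero on odd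
  -- exponents, which stay undeformed.
  · set M := 2 * m - 2 with hM
    have hM0 : 0 < M := by omega
    set w : ℕ → ℕ := fun e => if Odd e then 0 else e / (2 * m) with hw
    have hw1 : ∀ e ∈ oddExponents k (n / 2), w e = 0 := fun e he =>
      if_pos (odd_of_mem_oddExponents he)
    have hw2 : ∀ l, w (2 * m * l) = l := fun l => by
      simp only [hw]
      rw [if_neg, Nat.mul_div_cancel_left _ (by omega)]
      rw [mul_assoc]
      exact Nat.not_odd_iff_even.2 (even_two_mul _)
    have hMl : ∀ l, M * l + 2 * l = 2 * m * l := fun l => by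
      rw [← add_mul]; congr 1; omega
    have hwle : ∀ e ∈ p.support, M * w e + 1 ≤ e := by
      intro e he
      rcases hmem e he with h | ⟨l, hl1, hl2, rfl⟩
      · rw [hw1 e h]
        have := (odd_of_mem_oddExponents h).pos
        omega
      · rw [hw2]
        have := hMl l
        omega
    have h1p : 1 ∈ p.support := by
      rw [hsupp, limitExponents]
      exact Finset.mem_union_left _ h1
    have hev := eventually_deform hM0 hp0 h1p hwle hsimple
    obtain ⟨ν, ⟨hq0, hqc, hqs⟩, hν⟩ :=
      ((hev.filter_mono (nhdsWithin_le_nhds (s := Set.Ioi (0 : ℝ)))).and self_mem_nhdsWithin).exists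
    have hν : 0 < ν := hν
    obtain ⟨hc1, hc2⟩ := posRoots_comp_mul hq0 hν hqs
    -- Rescaling by `ν` turns `X ^ M + ν ^ M` into a multiple of `X ^ M + 1`, so each deformed term
    -- becomes a multiple of `h ^ l`.
    refine ⟨(deform p M w ν).comp (C ν * X), ?_, (rootMultiplicity_comp_mul hq0 hν.ne' 0).1, hc2,
      by omega⟩
    rw [deform, Polynomial.sum_comp]
    refine Submodule.sum_mem _ fun e he => ?_
    have hterm : (C (p.coeff e) * (X ^ (e - M * w e) * (X ^ M + C (ν ^ M)) ^ w e)).comp (C ν * X) =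
        (p.coeff e * ν ^ e) • (X ^ (e - M * w e) * (X ^ M + 1) ^ w e) := by
      have h3 : C (ν ^ e) = C ν ^ (e - M * w e) * (C ν ^ M) ^ w e := by
        rw [← pow_mul, ← pow_add, ← C_pow]
        congr 2
        have := hwle e he
        omega
      rw [smul_eq_C_mul, C_mul, h3]
      simp only [mul_comp, C_comp, pow_comp, add_comp, X_comp, C_pow]
      have h4 : (C ν * X) ^ M + C ν ^ M = C ν ^ M * (X ^ M + 1) := by ring
      rw [h4, mul_pow, mul_pow]
      ring
    rw [hterm]
    refine Submodule.smul_mem _ _ ?_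
    rcases hmem e he with h | ⟨l, hl1, hl2, rfl⟩
    · rw [hw1 e h, mul_zero, Nat.sub_zero, pow_zero, mul_one]
      exact X_pow_mem_melnikovSpace hm h
    · rw [hw2, ← hMl l, Nat.add_sub_cancel_left]
      have h5 : X ^ (2 * l) * (X ^ M + 1) ^ l = hPoly m ^ l := by
        rw [pow_mul, ← mul_pow, mul_add, ← pow_add, hPoly, mul_one, add_comm]
        congr 3
        omega
      rw [h5]
      exact hh l hl1 hl2

end PiecewiseCenter

namespace PiecewiseCenter

/-! ### The bounds -/

variable {k m n : ℕ}

theorem exists_nontrivial_polynomial (hm : m = 2 * k + 1) (P : Perturbation n)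
    (h : MelnikovNontrivial m P) : ∃ Q ∈ melnikovSpace m n, Q ≠ 0 ∧
      (∀ s, 0 < s → melnikov m P (sqRadius m s) = Q.eval s) ∧
      ∀ s, 0 < s → ∫ t in 0..2 * Real.pi, radial m (pAt P t) (qAt P t) t s = Q.eval s := by
  obtain ⟨Q, hQ, e⟩ := exists_melnikovPolynomial m P
  have hM : ∀ s, 0 < s → melnikov m P (sqRadius m s) = Q.eval s := fun s hs => by
    rw [melnikov_sqRadius P hm hs, e s hs]
  refine ⟨Q, hQ, ?_, hM, fun s hs => by rw [integral_radial_eq, e s hs]⟩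
  rintro rfl
  obtain ⟨x, hx, hne⟩ := h
  have hm0 : 0 < m := by omega
  rw [melnikov_eq_eval hm0 hM hx, Polynomial.eval_zero] at hne
  exact hne rfl

/-- The number of exponents bounds both cyclicities. -/
theorem counts_le (hm : m = 2 * k + 1) :
    Z m n ≤ ((oddExponents k (n / 2)).card + (evenExponents m ((n + 1) / 2)).card - 1 : ℕ) ∧
      melnikovZ m n ≤
        ((oddExponents k (n / 2)).card + (evenExponents m ((n + 1) / 2)).card - 1 : ℕ) := by
  have hm0 : 0 < m := by omega
  constructor
  · refine iSup₂_le fun P hP => ?_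
    obtain ⟨Q, hQ, h0, -, hI⟩ := exists_nontrivial_polynomial hm P hP
    refine (bifurcatingCount_le hm h0 hI).trans (Nat.cast_le.2 ?_)
    have := posRootCount_lt_of_mem_melnikovSpace hm hQ h0
    omega
  · refine iSup₂_le fun P hP => ?_
    obtain ⟨Q, hQ, h0, hM, -⟩ := exists_nontrivial_polynomial hm P hP
    rw [melnikovZeroCount_eq hm0 h0 hM, Nat.cast_le]
    have := posRootCount_lt_of_mem_melnikovSpace hm hQ h0
    omega

/-- Some system reaches the lower bound. -/
theorem exists_reaching (hm : m = 2 * k + 1) :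
    ∃ (P : Perturbation n) (l : ℕ), l + 1 = (oddExponents k (n / 2)).card + (n + 1) / 2 ∧
      MelnikovNontrivial m P ∧ melnikovZeroCount m P = l ∧ ExactlyBifurcating m P l ∧
      (l : ℕ∞) ≤ bifurcatingCount m P := by
  have hm0 : 0 < m := by omega
  obtain ⟨Q, hQ, h0, hsimple, hcount⟩ := exists_mem_melnikovSpace_simple (n := n) hm
  obtain ⟨P, e⟩ := exists_perturbation_of_mem hQ
  have hM : ∀ s, 0 < s → melnikov m P (sqRadius m s) = Q.eval s := fun s hs => by
    rw [melnikov_sqRadius P hm hs, e s]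
  have hI : ∀ s, 0 < s → ∫ t in 0..2 * Real.pi, radial m (pAt P t) (qAt P t) t s = Q.eval s :=
    fun s _ => by rw [integral_radial_eq, e s]
  obtain ⟨hex, hle⟩ := exactlyBifurcating_of_simple hm h0 hI hsimple
  refine ⟨P, posRootCount Q, hcount, ?_, melnikovZeroCount_eq hm0 h0 hM, hex, hle⟩
  obtain ⟨s, hs, hne⟩ : ∃ s : ℝ, 0 < s ∧ Q.eval s ≠ 0 := by
    by_contra hall
    push Not at hall
    exact h0 (Polynomial.eq_zero_of_infinite_isRoot Q
      ((Set.Ioi_infinite (0 : ℝ)).mono fun s hs => hall s hs))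
  exact ⟨sqRadius m s, sqRadius_pos m hs, by rw [hM s hs]; exact hne⟩

theorem floor_add_div_two (n j : ℕ) : ⌊((n : ℚ) + j) / 2⌋ = (((n + j) / 2 : ℕ) : ℤ) := by
  have := Rat.floor_natCast_div_natCast (n + j) 2
  push_cast at this ⊢
  exact this

theorem floor_div_two (n : ℕ) : ⌊(n : ℚ) / 2⌋ = ((n / 2 : ℕ) : ℤ) := by
  simpa using floor_add_div_two n 0

theorem floor_sub_one_div_two (n : ℕ) :
    ⌊((n : ℚ) - 1) / 2⌋ = (((n + 1) / 2 : ℕ) : ℤ) - 1 := by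
  have h : ((n : ℚ) - 1) / 2 = ((n : ℚ) + (1 : ℕ)) / 2 - 1 := by push_cast; ring
  rw [h, Int.floor_sub_one, floor_add_div_two]

theorem delta_eq (n : ℕ) : delta n = ((n + 1) / 2 : ℕ) - ((n / 2 : ℕ) : ℤ) - 1 := by
  unfold delta
  rcases Nat.even_or_odd' n with ⟨a, rfl | rfl⟩
  · rw [if_neg (by simp)]
    omega
  · rw [if_pos ⟨a, rfl⟩]
    omega

end PiecewiseCenter

open PiecewiseCenter in
theorem theorem1p1 (k m n : ℕ) (hm : m = 2 * k + 1) :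
    ∃ z w : ℕ, Z m n = z ∧ melnikovZ m n = w ∧
      ((n : ℤ) < m - 1 →
        (∀ v ∈ ({z, w} : Set ℕ),
          (v : ℚ) ≤ 1 / 2 * ⌊((n : ℚ) + 3) / 2⌋ * ⌊((n : ℚ) + 5) / 2⌋
              + ⌊((n : ℚ) + 2) / 2⌋ * ⌊((n : ℚ) + 4) / 2⌋ - 2 ∧
          (v : ℤ) ≥ ⌊(n : ℚ) / 2⌋ * ⌊((n : ℚ) + 6) / 2⌋ + ⌊((n : ℚ) - 1) / 2⌋ + 2) ∧
        IsReached m n (⌊(n : ℚ) / 2⌋ * ⌊((n : ℚ) + 6) / 2⌋ + ⌊((n : ℚ) - 1) / 2⌋ + 2)) ∧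
      ((m : ℤ) - 1 ≤ n ∧ (n : ℤ) < 2 * m - 1 → ∀ v ∈ ({z, w} : Set ℕ),
        (v : ℚ) ≤ 1 / 2 * ⌊((n : ℚ) + 3) / 2⌋ * ⌊((n : ℚ) + 5) / 2⌋
            + (2 * k + 1) * ⌊(n : ℚ) / 2⌋ - ((k : ℚ) - 1) ^ 2) ∧
      ((n : ℤ) ≥ 2 * m - 1 → ∀ v ∈ ({z, w} : Set ℕ),
        (v : ℤ) ≤ (2 * k + 1) * (2 * ⌊(n : ℚ) / 2⌋ + delta n) + k * (5 - 3 * k) + 1) ∧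
      ((m : ℤ) - 1 ≤ n →
        (∀ v ∈ ({z, w} : Set ℕ),
          (v : ℤ) ≥ 2 * (k + 1) * ⌊(n : ℚ) / 2⌋ + delta n - ((k : ℤ) - 1) ^ 2 + 2) ∧
        IsReached m n
          (2 * (k + 1) * ⌊(n : ℚ) / 2⌋ + delta n - ((k : ℤ) - 1) ^ 2 + 2)) := by
  have hm0 : 0 < m := by omega
  obtain ⟨hZ, hW⟩ := counts_le (n := n) hm
  obtain ⟨P, l, hl, hnt, hzc, hex, hbc⟩ := exists_reaching (n := n) hm
  obtain ⟨z, hz⟩ := ENat.ne_top_iff_exists.1 (ne_top_of_le_ne_top (ENat.natCast_ne_top _) hZ)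
  obtain ⟨w, hw⟩ := ENat.ne_top_iff_exists.1 (ne_top_of_le_ne_top (ENat.natCast_ne_top _) hW)
  have hlz : l ≤ z := by
    have : (l : ℕ∞) ≤ Z m n := hbc.trans (le_iSup₂_of_le P hnt le_rfl)
    rw [← hz] at this
    exact_mod_cast this
  have hlw : l ≤ w := by
    have : (l : ℕ∞) ≤ melnikovZ m n := hzc.ge.trans (le_iSup₂_of_le P hnt le_rfl)
    rw [← hw] at this
    exact_mod_cast this
  rw [← hz] at hZ
  rw [← hw] at hW
  have hZ : z ≤ _ := Nat.cast_le.1 hZ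
  have hW : w ≤ _ := Nat.cast_le.1 hW
  have h1 := one_mem_oddExponents k (n / 2)
  have hopos : 0 < (oddExponents k (n / 2)).card := Finset.card_pos.2 ⟨1, h1⟩
  -- From here on both numbers are treated alike; what is left is arithmetic of the exponent counts.
  have hv : ∀ v ∈ ({z, w} : Set ℕ), l ≤ v ∧
      v + 1 ≤ (oddExponents k (n / 2)).card + (evenExponents m ((n + 1) / 2)).card := by
    rintro v (rfl | rfl)
    · exact ⟨hlz, by omega⟩
    · exact ⟨hlw, by omega⟩
  have hev := card_evenExponents_add_one_le (m := m) (L := (n + 1) / 2) hm0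
  have hev1 := two_mul_sum_min_le m ((n + 1) / 2 + 1)
  have hreach : ∀ N : ℤ, (l : ℤ) = N → IsReached m n N := fun N hN => ⟨P, l, hN, hnt, hzc, hex⟩
  have f2 : ⌊((n : ℚ) + 2) / 2⌋ = ((n / 2 : ℕ) : ℤ) + 1 := by
    have := floor_add_div_two n 2; push_cast at this; rw [this]; omega
  have f3 : ⌊((n : ℚ) + 3) / 2⌋ = (((n + 1) / 2 : ℕ) : ℤ) + 1 := by
    have := floor_add_div_two n 3; push_cast at this; rw [this]; omega
  have f4 : ⌊((n : ℚ) + 4) / 2⌋ = ((n / 2 : ℕ) : ℤ) + 2 := by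
    have := floor_add_div_two n 4; push_cast at this; rw [this]; omega
  have f5 : ⌊((n : ℚ) + 5) / 2⌋ = (((n + 1) / 2 : ℕ) : ℤ) + 2 := by
    have := floor_add_div_two n 5; push_cast at this; rw [this]; omega
  have f6 : ⌊((n : ℚ) + 6) / 2⌋ = ((n / 2 : ℕ) : ℤ) + 3 := by
    have := floor_add_div_two n 6; push_cast at this; rw [this]; omega
  rw [f2, f3, f4, f5, f6, floor_div_two, floor_sub_one_div_two, delta_eq]
  have hLm : 2 * m - 1 ≤ n → m ≤ (n + 1) / 2 := fun h => by omega
  have hNlt : n < m - 1 → n / 2 + 1 ≤ k := fun h => by omega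
  have hNle : m - 1 ≤ n → k ≤ n / 2 := fun h => by omega
  set N := n / 2
  set L := (n + 1) / 2
  set O := (oddExponents k N).card
  set V := (evenExponents m L).card
  refine ⟨z, w, hz.symm, hw.symm, fun hn => ?_, fun hn v hvm => ?_, fun hn v hvm => ?_,
    fun hn => ?_⟩
  · have hO : O = (N + 1) * (N + 2) := card_oddExponents_of_lt (hNlt (by omega))
    have hlN : (l : ℤ) = (N : ℤ) * ((N : ℤ) + 3) + ((L : ℤ) - 1) + 2 := by
      have : (l : ℤ) + 1 = O + L := by exact_mod_cast hl
      rw [hO] at this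
      push_cast at this
      linear_combination this
    refine ⟨fun v hvm => ⟨?_, ?_⟩, hreach _ hlN⟩
    -- The `2` added to `v` is one unit from Descartes' strict inequality and one from the missing
    -- exponent `0`.
    · have h2 : 2 * (v + 2) ≤ 2 * ((N + 1) * (N + 2)) + (L + 1) * (L + 1 + 1) := by
        have := (hv v hvm).2
        omega
      have h3 : (2 : ℚ) * (v + 2) ≤ 2 * ((N + 1) * (N + 2)) + (L + 1) * (L + 1 + 1) := by
        exact_mod_cast h2
      push_cast
      linarith
    · have : (l : ℤ) ≤ v := by exact_mod_cast (hv v hvm).1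
      linarith
  · have hO : O + k ^ 2 = (2 * k + 1) * (N + 1) := card_oddExponents_of_le (hNle (by omega))
    have h2 : 2 * (v + 2) ≤ 2 * O + (L + 1) * (L + 1 + 1) := by
      have := (hv v hvm).2
      omega
    have h3 : (2 : ℚ) * (v + 2) ≤ 2 * O + (L + 1) * (L + 1 + 1) := by exact_mod_cast h2
    have h4 : (O : ℚ) + k ^ 2 = (2 * k + 1) * (N + 1) := by exact_mod_cast hO
    push_cast
    linarith
  · have hO : O + k ^ 2 = (2 * k + 1) * (N + 1) := card_oddExponents_of_le (hNle (by omega))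
    -- For `n ≥ 2 * m - 1` one has `L ≥ m`, so the digit bound `i < m` takes effect in the even
    -- exponents and the count grows linearly beyond it.
    obtain ⟨j, hj⟩ := Nat.exists_eq_add_of_le (hLm (by omega))
    have hev2 := two_mul_sum_min_add_le m (j + 1)
    rw [← Nat.add_assoc, ← hj] at hev2
    have h2 : 2 * (v + 2) ≤ 2 * O + (m * (m + 1) + 2 * (j + 1) * m) := by
      have := (hv v hvm).2
      omega
    have h3 : (2 : ℤ) * (v + 2) ≤ 2 * O + (m * (m + 1) + 2 * (j + 1) * m) := by exact_mod_cast h2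
    have h4 : (O : ℤ) + k ^ 2 = (2 * k + 1) * (N + 1) := by exact_mod_cast hO
    have h5 : (L : ℤ) = m + j := by exact_mod_cast hj
    have h6 : (m : ℤ) = 2 * k + 1 := by exact_mod_cast hm
    have h7 : (j : ℤ) = L - (2 * k + 1) := by linarith
    rw [h7, h6] at h3
    linarith
  · have hO : O + k ^ 2 = (2 * k + 1) * (N + 1) := card_oddExponents_of_le (hNle (by omega))
    have h4 : (O : ℤ) + k ^ 2 = (2 * k + 1) * (N + 1) := by exact_mod_cast hO
    have hlN : (l : ℤ) = 2 * ((k : ℤ) + 1) * (N : ℤ) + ((L : ℤ) - N - 1) - ((k : ℤ) - 1) ^ 2 + 2 := by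
      have : (l : ℤ) + 1 = O + L := by exact_mod_cast hl
      linear_combination this + h4
    refine ⟨fun v hvm => ?_, hreach _ hlN⟩
    have : (l : ℤ) ≤ v := by exact_mod_cast (hv v hvm).1
    linarith
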